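/- **Theorem.** Let $\chi$ be a multiplicative character of $\mathbb Z/n\mathbb Z$ ($n\ge 1$), extended by $\chi(y)=0$ for $\gcd(y,n)\neq 1$ and regarded as a function on $\mathbb Z$. It is *completely nontrivial* if in its factorisation $\chi(x)=\prod_{p\mid n}\chi_p(x)$, with $\chi_p$ a multiplicative character modulo the exact power of $p$ dividing $n$, every $\chi_p$ is nontrivial. In the *shifted multiplicative character problem with unknown $n$* one is given black boxes for a completely nontrivial $\chi$ and for a function $f:\mathbb Z\to\mathbb C$ such that $f(x)=\chi(x+s)$ for all $x$, where the integers $n$ and $s$ are unknown; the task is to find all $t\in\mathbb Z$ with $f(x)=\chi(x+t)$ for all $x\in\mathbb Z$. Given an upper bound on the size of the period of $f$, this problem can be solved efficiently on a quantum computer. Precisely: there are a single quantum algorithm and a polynomial $P$ such that, for all $n$, $\chi$, $s$, $f$ as above and every integer $N\ge\ell$, where $\ell$ is the period (the least positive period) of $f$, the algorithm, on input $N$ and with quantum black-box access to $f$ and $\chi$, always halts within time $P(\lfloor \log_2 N\rfloor+1)$, and with probability at least $2/3$ it outputs integers $m,t_0\geq 0$ such that $\{t\in\mathbb Z : f(x)=\chi(x+t)\text{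 for all }x\in\mathbb Z\}=t_0+m\mathbb Z$. Here a quantum algorithm is a program for a random access machine with classical control, whose quantum memory is a superposition of integer registers. It has the usual classical arithmetic and control flow, bitwise exclusive or of the value of an arithmetic expression into a quantum register, Hadamard gates on single bits, phase gates $e^{2\pi i a/2^k}$, and measurements of registers. A query to a function $g\in\{f,\chi\}$ at a natural number $x$ with precision $k$ acts by exclusive or of a description of $g(x)$ into a register: one bit saying whether $g(x)\ne0$ and, if $g(x)=e^{2\pi i\theta}$ with $0\le\theta<1$, the first $k$ binary digits of $\theta$. Every instruction costs one plus the bit lengths of the numbers involved (the maximum over the basis states of a superposition); bit positions, $k$ in phase gates and $k$ in queries are charged by their value. -/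

import Mathlib

/-!
# Shifted multiplicative characters and a quantum random access machine

Multiplicative characters of `ℤ/nℤ`, extended by zero to non-units, are Mathlib's
`DirichletCharacter ℂ n`.  Mathlib has no quantum computer, so the second half of this file builds
one: a random access machine with classical control, whose quantum memory is a superposition of
integer registers, and which has black-box access to complex-valued functions on `ℤ`.  Time is
measured by the logarithmic cost criterion.
-/

namespace HiddenShift

/-! ### Characters -/

/-- A multiplicative character `χ` of `ℤ/nℤ` is *completely nontrivial* if, in its factorisation
`χ(x) = ∏_p χ_p(x)` with `χ_p` a multiplicative character modulo the exact power of `p` dividing `n`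
(`p` running over the primes dividing `n`), every `χ_p` is nontrivial. -/
def CompletelyNontrivial {n : ℕ} (χ : DirichletCharacter ℂ n) : Prop :=
  ∃ c : (p : ℕ) → DirichletCharacter ℂ (p ^ n.factorization p),
    (∀ x : ℤ, χ (x : ZMod n) = ∏ p ∈ n.primeFactors, c p (x : ZMod (p ^ n.factorization p))) ∧
      ∀ p ∈ n.primeFactors, c p ≠ 1

/-- `ℓ` is the period of `f`: the least positive integer with `f (x + ℓ) = f x` for all `x`. -/
def IsPeriodOf (f : ℤ → ℂ) (ℓ : ℕ) : Prop :=
  IsLeast {m : ℕ | 0 < m ∧ ∀ x : ℤ, f (x + m) = f x} ℓ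

/-! ### Arithmetic expressions and their logarithmic cost -/

/-- Arithmetic expressions over natural-number variables. -/
inductive Expr (V : Type) : Type
  | const (a : ℕ)
  | var (v : V)
  | add (e₁ e₂ : Expr V)
  | sub (e₁ e₂ : Expr V)
  | mul (e₁ e₂ : Expr V)
  | div (e₁ e₂ : Expr V)
  | mod (e₁ e₂ : Expr V)

/-- Value of an expression (with truncated subtraction and integer division). -/
def Expr.eval {V : Type} (env : V → ℕ) : Expr V → ℕ
  | .const a => a
  | .var v => env v
  | .add e₁ e₂ => e₁.eval env + e₂.eval env
  | .sub e₁ e₂ => e₁.eval env - e₂.eval env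
  | .mul e₁ e₂ => e₁.eval env * e₂.eval env
  | .div e₁ e₂ => e₁.eval env / e₂.eval env
  | .mod e₁ e₂ => e₁.eval env % e₂.eval env

/-- Logarithmic cost of evaluating an expression: the sum, over all of its nodes, of one plus the
bit length of the value computed there. -/
def Expr.cost {V : Type} (env : V → ℕ) : Expr V → ℕ
  | .const a => 1 + Nat.size a
  | .var v => 1 + Nat.size (env v)
  | .add e₁ e₂ => e₁.cost env + e₂.cost env + (1 + Nat.size (e₁.eval env + e₂.eval env))
  | .sub e₁ e₂ => e₁.cost env + e₂.cost env + (1 + Nat.size (e₁.eval env - e₂.eval env))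
  | .mul e₁ e₂ => e₁.cost env + e₂.cost env + (1 + Nat.size (e₁.eval env * e₂.eval env))
  | .div e₁ e₂ => e₁.cost env + e₂.cost env + (1 + Nat.size (e₁.eval env / e₂.eval env))
  | .mod e₁ e₂ => e₁.cost env + e₂.cost env + (1 + Nat.size (e₁.eval env % e₂.eval env))

/-! ### Programs -/

/-- Programs.  An `Expr ℕ` reads classical registers only; an `Expr (ℕ ⊕ ℕ)` reads classical
registers (`Sum.inl`) and quantum registers (`Sum.inr`). -/
inductive Cmd : Type
  /-- Do nothing. -/
  | skip
  /-- Classical register `i` becomes the value of `e`. -/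
  | assign (i : ℕ) (e : Expr ℕ)
  /-- Sequential composition. -/
  | seq (c d : Cmd)
  /-- Run `c` if `e` is nonzero, and `d` otherwise. -/
  | ite (e : Expr ℕ) (c d : Cmd)
  /-- While `e` is nonzero, run `c`. -/
  | loop (e : Expr ℕ) (c : Cmd)
  /-- Bitwise exclusive or of the value of `e` into quantum register `j`. -/
  | qxor (j : ℕ) (e : Expr (ℕ ⊕ ℕ))
  /-- Hadamard gate on the bit of quantum register `j` whose position is the value of `e`. -/
  | had (j : ℕ) (e : Expr ℕ)
  /-- Phase gate `exp (2πi e / 2 ^ k)`. -/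
  | phase (e : Expr (ℕ ⊕ ℕ)) (k : Expr ℕ)
  /-- Query black box `o` at the value of `e` with `k` bits of precision: the answer is put into
  quantum register `j` by exclusive or. -/
  | query (o : Fin 2) (j : ℕ) (e : Expr (ℕ ⊕ ℕ)) (k : Expr ℕ)
  /-- Measure quantum register `j`, with the outcome stored in classical register `i`. -/
  | measure (j i : ℕ)

/-! ### Semantics -/

/-- Contents of the registers, each of which holds a natural number. -/
abbrev Store : Type := ℕ → ℕ

/-- Quantum memory: a finite superposition of basis states `|b⟩`, where `b : Store`.  States are not
renormalised after a measurement, so that the squared norm of the state of a branch of the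
computation is the probability of that branch. -/
abbrev QState : Type := Store →₀ ℂ

open scoped Classical in
/-- The `k`-bit description of a complex number that is zero or of modulus one: `0` for zero, and
`2 ^ k + ⌊2 ^ k θ⌋` for `exp (2πi θ)` with `0 ≤ θ < 1` (a leading bit that says that the number is
not zero, followed by the first `k` binary digits of `θ`). -/
noncomputable def phaseCode (k : ℕ) (z : ℂ) : ℕ :=
  if z = 0 then 0
  else 2 ^ k + ⌊(2 : ℝ) ^ k * Int.fract (Complex.arg z / (2 * Real.pi))⌋₊

/-- The action of `qxor j e` on basis labels.  The operand is evaluated with quantum register `j` read as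
zero, hence does not depend on the target, and the map is an involution. -/
def xorLabel (σ : Store) (j : ℕ) (e : Expr (ℕ ⊕ ℕ)) (b : Store) : Store :=
  Function.update b j (b j ^^^ e.eval (Sum.elim σ (Function.update b j 0)))

/-- The action of a query to the function `g` on basis labels, again an involution. -/
noncomputable def queryLabel (g : ℤ → ℂ) (σ : Store) (j : ℕ) (e : Expr (ℕ ⊕ ℕ)) (k : ℕ)
    (b : Store) : Store :=
  Function.update b j
    (b j ^^^ phaseCode k (g ((e.eval (Sum.elim σ (Function.update b j 0)) : ℕ) : ℤ)))

/-- The Hadamard gate on bit `i` of register `j`, on a basis state. -/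
noncomputable def hadBasis (j i : ℕ) (b : Store) : QState :=
  Finsupp.single b (((if (b j).testBit i then -1 else 1) / Real.sqrt 2 : ℝ) : ℂ) +
    Finsupp.single (Function.update b j (b j ^^^ 2 ^ i)) ((1 / Real.sqrt 2 : ℝ) : ℂ)

/-- The phase gate on a basis state. -/
noncomputable def phaseBasis (σ : Store) (e : Expr (ℕ ⊕ ℕ)) (k : ℕ) (b : Store) : QState :=
  Finsupp.single b
    (Complex.exp (2 * Real.pi * Complex.I * (e.eval (Sum.elim σ b) : ℂ) / (2 : ℂ) ^ k))

/-- Linear extension to superpositions of a map given on basis states. -/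
noncomputable def applyBasis (U : Store → QState) (ψ : QState) : QState :=
  Finsupp.linearCombination ℂ U ψ

/-- The largest cost `w b` over the basis states `b` present in a superposition. -/
noncomputable def supCost (ψ : QState) (w : Store → ℕ) : ℕ := ψ.support.sup w

/-- Configurations: what is left to run, the classical registers, the quantum memory, and the time
used so far. -/
structure Config : Type where
  code : List Cmd
  cl : Store
  qu : QState
  time : ℕ

/-- The squared norm of a (not normalised) quantum state. -/
noncomputable def normSq (ψ : QState) : ℝ := ∑ b ∈ ψ.support, ‖ψ b‖ ^ 2

/-- One step of the machine with black boxes `O`: the configurations that can come next.  There is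
one of them, except that a measurement has one for each possible outcome.  A step costs one plus the
bit lengths of the numbers involved; bit positions, precisions of phases and precisions of queries
are charged by their value.  In a superposition the largest cost of a basis state counts. -/
noncomputable def step (O : Fin 2 → ℤ → ℂ) : Config → Multiset Config
  | ⟨[], σ, ψ, t⟩ => {⟨[], σ, ψ, t⟩}
  | ⟨.skip :: r, σ, ψ, t⟩ => {⟨r, σ, ψ, t + 1⟩}
  | ⟨.assign i e :: r, σ, ψ, t⟩ =>
      {⟨r, Function.update σ i (e.eval σ), ψ, t + (1 + e.cost σ)⟩}
  | ⟨.seq c d :: r, σ, ψ, t⟩ => {⟨c :: d :: r, σ, ψ, t + 1⟩}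
  | ⟨.ite e c d :: r, σ, ψ, t⟩ =>
      {⟨(if e.eval σ = 0 then d else c) :: r, σ, ψ, t + (1 + e.cost σ)⟩}
  | ⟨.loop e c :: r, σ, ψ, t⟩ =>
      {⟨if e.eval σ = 0 then r else c :: .loop e c :: r, σ, ψ, t + (1 + e.cost σ)⟩}
  | ⟨.qxor j e :: r, σ, ψ, t⟩ =>
      {⟨r, σ, applyBasis (fun b => Finsupp.single (xorLabel σ j e b) 1) ψ,
        t + (1 + supCost ψ fun b =>
          Nat.size (b j) + e.cost (Sum.elim σ (Function.update b j 0)))⟩}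
  | ⟨.had j e :: r, σ, ψ, t⟩ =>
      {⟨r, σ, applyBasis (hadBasis j (e.eval σ)) ψ,
        t + (1 + e.cost σ + e.eval σ + supCost ψ fun b => Nat.size (b j))⟩}
  | ⟨.phase e k :: r, σ, ψ, t⟩ =>
      {⟨r, σ, applyBasis (phaseBasis σ e (k.eval σ)) ψ,
        t + (1 + k.cost σ + k.eval σ + supCost ψ fun b => e.cost (Sum.elim σ b))⟩}
  | ⟨.query o j e k :: r, σ, ψ, t⟩ =>
      {⟨r, σ, applyBasis (fun b => Finsupp.single (queryLabel (O o) σ j e (k.eval σ) b) 1) ψ,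
        t + (1 + k.cost σ + k.eval σ + supCost ψ fun b =>
          Nat.size (b j) + e.cost (Sum.elim σ (Function.update b j 0)))⟩}
  | ⟨.measure j i :: r, σ, ψ, t⟩ =>
      (ψ.support.image fun b => b j).val.map fun v =>
        ⟨r, Function.update σ i v, ψ.filter (fun b => b j = v),
          t + (1 + supCost ψ fun b => Nat.size (b j))⟩

/-- All configurations reachable in exactly `T` steps (a halted configuration stays as it is). -/
noncomputable def run (O : Fin 2 → ℤ → ℂ) : ℕ → Config → Multiset Config
  | 0, c => {c}
  | T + 1, c => (step O c).bind (run O T)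

/-- Initial configuration: the input in classical register `0`, and everything else zero. -/
noncomputable def start (P : Cmd) (input : ℕ) : Config :=
  ⟨[P], Function.update 0 0 input, Finsupp.single 0 1, 0⟩

/-- With black boxes `O`, the program `P` on the given input halts on every branch within time `T`. -/
def HaltsWithin (O : Fin 2 → ℤ → ℂ) (P : Cmd) (input T : ℕ) : Prop :=
  ∀ c ∈ run O T (start P input), c.code = [] ∧ c.time ≤ T

open scoped Classical in
/-- The probability that the machine has halted after at most `T` steps and its classical registers
satisfy `good`. -/
noncomputable def successProb (O : Fin 2 → ℤ → ℂ) (P : Cmd) (input T : ℕ)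
    (good : Store → Prop) : ℝ :=
  (((run O T (start P input)).filter fun c => c.code = [] ∧ good c.cl).map
    fun c => normSq c.qu).sum

end HiddenShift

/-!
Write `ℓ` for the period, `Q = 2 ^ q` for the order of the Fourier transform, and `e θ` for
`exp (2πi θ)`.

A completely nontrivial character has a conductor with the same prime divisors as its modulus, so
that as a function on the integers it equals the primitive character it comes from
(`CompletelyNontrivial.eq_primitiveCharacter`). The period of a shifted primitive character is the
conductor (`eq_of_isPeriodOf`), and the shifts to be found form the residue class of `s` modulo `ℓ`
(`shift_iff`). It remains to find `ℓ` and one element of this class, for a primitive `χ` modulo `ℓ`.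

*The period.* By the Gauss sum expansion, `f x = χ (x + s)` is a combination of the exponentials
`e (-w x / ℓ)` in which `w` has the coefficient `χ⁻¹ w * e (-w s / ℓ)` up to a constant (`eq_trig`);
it vanishes unless `w` is coprime to `ℓ`. As `Q` is much larger than `ℓ ^ 2`, the Fourier transform
of order `Q` of the values of `f` is concentrated near the points `w Q / ℓ` with `w` coprime to `ℓ`
(`sum_not_isClose_le`), and `ℓ` is the denominator of a convergent of `v / Q` for a measured `v`
close to such a point (`Det.contfrac`). The superposition of the values of `f` is prepared by
querying whether `f x ≠ 0`, measuring the answer, and turning a query for the argument of `f x` into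
a phase. The measurement has the desired outcome with probability about `φ(ℓ) / ℓ`, which is at
least `1 / q` (`inv_le_totient_div`). Otherwise the attempt has no effect, and a wrong denominator
is so much rarer than a right one that the last guess of many is likely to be right.

*The shift.* Once `ℓ` is known, `w` can be computed from a `v` close to `w Q / ℓ`. Multiplication of
the transform by `χ w` cancels the factor `χ⁻¹ w` (`norm_mul_ft_sub_le`) and leaves the phase
`e (-w s / ℓ)`. At the arguments congruent to `-s` the remaining terms all have the same phase, and
the proportion of the weight on this class is about `(φ(ℓ) / ℓ) ^ 2`. Hence a second transform,
which inverts the first up to a reflection, gives an element of the class of `s` with probability at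
least inversely polynomial in `q` (`inv_le_sum_norm_recovered`).

*Verification.* A guess `t` for the shift is replaced only if `f x ≠ χ (x + t)` at a random `x`, so
the right shift is never given up. A wrong shift is exposed often enough, because
`∑ ‖χ (x + d) - χ x‖ ^ 2 ≥ φ(ℓ)` for `d ≠ 0` modulo `ℓ` (`totient_le_sum_norm_shift_sub`). By
Parseval this is the sum of `‖1 - μ‖ ^ 2` over `μ = e (u d / ℓ)` with `u` coprime to `ℓ`; since
`x ≥ 1 + log x`, the sum is at least `φ(ℓ)` plus twice the logarithm of `∏ ‖1 - μ‖`, which is a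
power of the absolute value of a nonzero integer, the value at `1` of a cyclotomic polynomial.

Programs are analysed with two judgements, `Det` for commands with a single branch and `Ens` for
commands whose measurements lead to several. Usually the payoff in `Ens` is the squared norm of the
unnormalised state of a branch, that is, the probability of this branch, if the branch is
successful, and zero otherwise. The length of an execution is bounded by `Cmd.timeBound`, a
polynomial in a bound for the sizes of all registers, and repetition is covered by `Ens.repeat`;
`Ens.halts_and_succeeds` passes to the semantics of the machine.
-/

namespace HiddenShift

/-! ### Expressions: notation and size bounds -/

instance {V : Type} : Add (Expr V) := ⟨.add⟩
instance {V : Type} : Sub (Expr V) := ⟨.sub⟩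
instance {V : Type} : Mul (Expr V) := ⟨.mul⟩
instance {V : Type} : Div (Expr V) := ⟨.div⟩
instance {V : Type} : Mod (Expr V) := ⟨.mod⟩

namespace Expr

variable {V : Type} (env : V → ℕ)

@[simp] theorem eval_const (a : ℕ) : (Expr.const a).eval env = a := rfl
@[simp] theorem eval_var (v : V) : (Expr.var v).eval env = env v := rfl
@[simp] theorem eval_add (a b : Expr V) : (a + b).eval env = a.eval env + b.eval env := rfl
@[simp] theorem eval_sub (a b : Expr V) : (a - b).eval env = a.eval env - b.eval env := rfl
@[simp] theorem eval_mul (a b : Expr V) : (a * b).eval env = a.eval env * b.eval env := rfl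
@[simp] theorem eval_div (a b : Expr V) : (a / b).eval env = a.eval env / b.eval env := rfl
@[simp] theorem eval_mod (a b : Expr V) : (a % b).eval env = a.eval env % b.eval env := rfl

/-- If all variables have at most `B ≥ 1` bits, then the value has at most `e.sizeFactor * B`
bits. -/
def sizeFactor : Expr V → ℕ
  | .const a => Nat.size a
  | .var _ => 1
  | .add a b => a.sizeFactor + b.sizeFactor + 1
  | .sub a _ => a.sizeFactor
  | .mul a b => a.sizeFactor + b.sizeFactor
  | .div a _ => a.sizeFactor
  | .mod a _ => a.sizeFactor

/-- If all variables have at most `B ≥ 1` bits, then evaluation costs at most `e.costFactor * B`. -/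
def costFactor : Expr V → ℕ
  | .const a => 1 + Nat.size a
  | .var _ => 2
  | .add a b => a.costFactor + b.costFactor + (1 + (a.sizeFactor + b.sizeFactor + 1))
  | .sub a b => a.costFactor + b.costFactor + (1 + a.sizeFactor)
  | .mul a b => a.costFactor + b.costFactor + (1 + (a.sizeFactor + b.sizeFactor))
  | .div a b => a.costFactor + b.costFactor + (1 + a.sizeFactor)
  | .mod a b => a.costFactor + b.costFactor + (1 + a.sizeFactor)

end Expr

theorem size_add_le (a b : ℕ) : Nat.size (a + b) ≤ Nat.size a + Nat.size b + 1 := by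
  rw [Nat.size_le]
  have ha := Nat.lt_size_self a
  have hb := Nat.lt_size_self b
  have h1 : 2 ^ Nat.size a ≤ 2 ^ (Nat.size a + Nat.size b) :=
    Nat.pow_le_pow_right (by norm_num) (by omega)
  have h2 : 2 ^ Nat.size b ≤ 2 ^ (Nat.size a + Nat.size b) :=
    Nat.pow_le_pow_right (by norm_num) (by omega)
  rw [pow_succ]; omega

theorem size_mul_le (a b : ℕ) : Nat.size (a * b) ≤ Nat.size a + Nat.size b := by
  rw [Nat.size_le, pow_add]
  exact Nat.mul_lt_mul'' (Nat.lt_size_self a) (Nat.lt_size_self b)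

namespace Expr

variable {V : Type} {env : V → ℕ} {B : ℕ}

theorem size_eval_le (hB : 1 ≤ B) (h : ∀ v, Nat.size (env v) ≤ B) (e : Expr V) :
    Nat.size (e.eval env) ≤ e.sizeFactor * B := by
  induction e with
  | const a => exact Nat.le_mul_of_pos_right _ hB
  | var v => simpa [eval, sizeFactor] using h v
  | add a b iha ihb =>
      refine (size_add_le _ _).trans ?_
      simp only [sizeFactor, add_mul]; omega
  | sub a b iha ihb => exact (Nat.size_le_size (Nat.sub_le _ _)).trans iha
  | mul a b iha ihb =>
      refine (size_mul_le _ _).trans ?_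
      simp only [sizeFactor, add_mul]; omega
  | div a b iha ihb => exact (Nat.size_le_size (Nat.div_le_self _ _)).trans iha
  | mod a b iha ihb => exact (Nat.size_le_size (Nat.mod_le _ _)).trans iha

theorem cost_le (hB : 1 ≤ B) (h : ∀ v, Nat.size (env v) ≤ B) (e : Expr V) :
    e.cost env ≤ e.costFactor * B := by
  induction e with
  | const a => exact Nat.le_mul_of_pos_right _ hB
  | var v => have := h v; simp only [cost, costFactor]; omega
  | add a b iha ihb =>
      have := size_eval_le hB h (.add a b)
      simp only [cost, costFactor, eval, sizeFactor, add_mul] at *; omega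
  | sub a b iha ihb =>
      have := size_eval_le hB h (.sub a b)
      simp only [cost, costFactor, eval, sizeFactor, add_mul] at *; omega
  | mul a b iha ihb =>
      have := size_eval_le hB h (.mul a b)
      simp only [cost, costFactor, eval, sizeFactor, add_mul] at *; omega
  | div a b iha ihb =>
      have := size_eval_le hB h (.div a b)
      simp only [cost, costFactor, eval, sizeFactor, add_mul] at *; omega
  | mod a b iha ihb =>
      have := size_eval_le hB h (.mod a b)
      simp only [cost, costFactor, eval, sizeFactor, add_mul] at *; omega

end Expr

/-! ### Gates preserve the norm -/

theorem normSq_eq_sum {ψ : QState} {S : Finset Store} (h : ψ.support ⊆ S) :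
    normSq ψ = ∑ b ∈ S, ‖ψ b‖ ^ 2 := by
  refine Finset.sum_subset h fun b _ hb => ?_
  simp [Finsupp.notMem_support_iff.mp hb]

@[simp] theorem normSq_single (b : Store) (α : ℂ) : normSq (Finsupp.single b α) = ‖α‖ ^ 2 := by
  rw [normSq_eq_sum Finsupp.support_single_subset]; simp

theorem normSq_nonneg (ψ : QState) : 0 ≤ normSq ψ := Finset.sum_nonneg fun _ _ => by positivity

theorem applyBasis_single (U : Store → QState) (b : Store) (c : ℂ) :
    applyBasis U (Finsupp.single b c) = c • U b := by
  simp [applyBasis]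

theorem applyBasis_sum {ι : Type*} (U : Store → QState) (s : Finset ι) (ψ : ι → QState) :
    applyBasis U (∑ i ∈ s, ψ i) = ∑ i ∈ s, applyBasis U (ψ i) := by
  simp [applyBasis]

/-- Exclusive or into register `j` of a quantity that does not depend on register `j`; both `qxor`
and `query` act like this on basis states. -/
def xorWith (j : ℕ) (g : Store → ℕ) (b : Store) : Store :=
  Function.update b j (b j ^^^ g (Function.update b j 0))

theorem xorWith_involutive (j : ℕ) (g : Store → ℕ) : Function.Involutive (xorWith j g) := by
  intro b
  simp [xorWith]

theorem xorLabel_eq (σ : Store) (j : ℕ) (e : Expr (ℕ ⊕ ℕ)) :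
    xorLabel σ j e = xorWith j fun b => e.eval (Sum.elim σ b) := rfl

theorem queryLabel_eq (g : ℤ → ℂ) (σ : Store) (j : ℕ) (e : Expr (ℕ ⊕ ℕ)) (k : ℕ) :
    queryLabel g σ j e k =
      xorWith j fun b => phaseCode k (g ((e.eval (Sum.elim σ b) : ℕ) : ℤ)) := rfl

theorem normSq_applyBasis_perm {π : Store → Store} (hπ : Function.Injective π) (ψ : QState) :
    normSq (applyBasis (fun b => Finsupp.single (π b) 1) ψ) = normSq ψ := by
  classical
  have : applyBasis (fun b => Finsupp.single (π b) 1) ψ = Finsupp.mapDomain π ψ := by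
    simp [applyBasis, Finsupp.linearCombination_apply, Finsupp.mapDomain]
  rw [this, normSq, normSq, Finsupp.mapDomain_support_of_injective hπ,
    Finset.sum_image (hπ.injOn)]
  simp [Finsupp.mapDomain_apply hπ]

theorem applyBasis_diagonal_apply (u : Store → ℂ) (ψ : QState) (b : Store) :
    applyBasis (fun b => Finsupp.single b (u b)) ψ b = u b * ψ b := by
  induction ψ using Finsupp.induction_linear with
  | zero => simp [applyBasis]
  | add f g hf hg =>
      have : applyBasis (fun b => Finsupp.single b (u b)) (f + g) =
        applyBasis (fun b => Finsupp.single b (u b)) f +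
          applyBasis (fun b => Finsupp.single b (u b)) g := by simp [applyBasis]
      rw [this, Finsupp.add_apply, hf, hg, Finsupp.add_apply, mul_add]
  | single a c =>
      rw [applyBasis_single]
      by_cases h : a = b
      · subst h; simp [mul_comm]
      · simp [h]

theorem normSq_applyBasis_diagonal {u : Store → ℂ} (hu : ∀ b, ‖u b‖ = 1) (ψ : QState) :
    normSq (applyBasis (fun b => Finsupp.single b (u b)) ψ) = normSq ψ := by
  have h : (applyBasis (fun b => Finsupp.single b (u b)) ψ).support ⊆ ψ.support := by
    intro b hb
    rw [Finsupp.mem_support_iff, applyBasis_diagonal_apply] at hb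
    exact Finsupp.mem_support_iff.mpr (right_ne_zero_of_mul hb)
  rw [normSq_eq_sum h, normSq]
  refine Finset.sum_congr rfl fun b _ => ?_
  rw [applyBasis_diagonal_apply, norm_mul, hu, one_mul]

/-- Flipping bit `i` of register `j`. -/
def flipBit (j i : ℕ) (b : Store) : Store := Function.update b j (b j ^^^ 2 ^ i)

theorem flipBit_involutive (j i : ℕ) : Function.Involutive (flipBit j i) := by
  intro b
  simp [flipBit]

theorem testBit_flipBit (j i : ℕ) (b : Store) :
    (flipBit j i b j).testBit i = !(b j).testBit i := by
  simp [flipBit, Nat.testBit_xor, Nat.testBit_two_pow_self]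

theorem applyBasis_hadBasis_apply (j i : ℕ) (ψ : QState) (b : Store) :
    applyBasis (hadBasis j i) ψ b =
      (((if (b j).testBit i then -1 else 1) / Real.sqrt 2 : ℝ) : ℂ) * ψ b +
        ((1 / Real.sqrt 2 : ℝ) : ℂ) * ψ (flipBit j i b) := by
  classical
  induction ψ using Finsupp.induction_linear with
  | zero => simp [applyBasis]
  | add f g hf hg =>
      have : applyBasis (hadBasis j i) (f + g) =
        applyBasis (hadBasis j i) f + applyBasis (hadBasis j i) g := by simp [applyBasis]
      rw [this, Finsupp.add_apply, hf, hg, Finsupp.add_apply, Finsupp.add_apply]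
      ring
  | single a c =>
      rw [applyBasis_single]
      have h2 : (a = flipBit j i b) ↔ (flipBit j i a = b) := by
        constructor
        · rintro rfl; exact flipBit_involutive j i b
        · rintro rfl; exact (flipBit_involutive j i a).symm
      change (c • (Finsupp.single a (((if (a j).testBit i then -1 else 1) / Real.sqrt 2 : ℝ) : ℂ) +
        Finsupp.single (flipBit j i a) ((1 / Real.sqrt 2 : ℝ) : ℂ)) : QState) b = _
      rw [Finsupp.smul_apply, Finsupp.add_apply, Finsupp.single_apply, Finsupp.single_apply,
        Finsupp.single_apply, Finsupp.single_apply, smul_eq_mul]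
      simp only [h2]
      by_cases h : a = b
      · subst h
        by_cases h' : flipBit j i a = a <;> simp [h'] <;> ring
      · by_cases h' : flipBit j i a = b <;> simp [h, h'] ; ring

theorem normSq_applyBasis_hadBasis (j i : ℕ) (ψ : QState) :
    normSq (applyBasis (hadBasis j i) ψ) = normSq ψ := by
  classical
  set S : Finset Store := ψ.support ∪ ψ.support.image (flipBit j i) with hS
  have hflip : ∀ b ∈ S, flipBit j i b ∈ S := by
    intro b hb
    rcases Finset.mem_union.mp hb with h | h
    · exact Finset.mem_union_right _ (Finset.mem_image_of_mem _ h)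
    · obtain ⟨a, ha, rfl⟩ := Finset.mem_image.mp h
      rw [flipBit_involutive j i a]
      exact Finset.mem_union_left _ ha
  have hinv := flipBit_involutive j i
  have hreindex : ∀ g : Store → ℝ, ∑ b ∈ S, g (flipBit j i b) = ∑ b ∈ S, g b := fun g =>
    Finset.sum_nbij' (flipBit j i) (flipBit j i) hflip hflip (fun b _ => hinv b)
      (fun b _ => hinv b) (fun b _ => rfl)
  have hsupp : (applyBasis (hadBasis j i) ψ).support ⊆ S := by
    intro b hb
    by_contra hbS
    have h1 : ψ b = 0 := by
      by_contra h
      exact hbS (Finset.mem_union_left _ (Finsupp.mem_support_iff.mpr h))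
    have h2 : ψ (flipBit j i b) = 0 := by
      by_contra h
      have h3 := hflip _ (Finset.mem_union_left _ (Finsupp.mem_support_iff.mpr h))
      exact hbS (hinv b ▸ h3)
    rw [Finsupp.mem_support_iff, applyBasis_hadBasis_apply, h1, h2] at hb
    simp at hb
  rw [normSq_eq_sum hsupp, normSq_eq_sum (Finset.subset_union_left : ψ.support ⊆ S)]
  set sg : Store → ℝ := fun b => if (b j).testBit i then -1 else 1
  set X : Store → ℝ := fun b => sg b * (ψ b * (starRingEnd ℂ) (ψ (flipBit j i b))).re
  have hterm : ∀ b, ‖applyBasis (hadBasis j i) ψ b‖ ^ 2 =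
      (‖ψ b‖ ^ 2 + ‖ψ (flipBit j i b)‖ ^ 2) / 2 + X b := by
    intro b
    have h2 : (Real.sqrt 2)⁻¹ ^ 2 = (2 : ℝ)⁻¹ := by
      rw [inv_pow, Real.sq_sqrt (by norm_num)]
    have hsg : sg b ^ 2 = 1 := by simp only [sg]; split_ifs <;> norm_num
    rw [applyBasis_hadBasis_apply]
    simp only [X, ← Complex.normSq_eq_norm_sq, Complex.normSq_apply]
    change (((sg b / Real.sqrt 2 : ℝ) : ℂ) * _ + _).re * (((sg b / Real.sqrt 2 : ℝ) : ℂ) * _ + _).re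
      + (((sg b / Real.sqrt 2 : ℝ) : ℂ) * _ + _).im *
        (((sg b / Real.sqrt 2 : ℝ) : ℂ) * _ + _).im = _
    simp only [Complex.add_re, Complex.add_im, Complex.re_ofReal_mul, Complex.im_ofReal_mul]
    simp only [Complex.mul_re, Complex.conj_re, Complex.conj_im, div_eq_mul_inv, one_mul]
    linear_combination (sg b ^ 2 * ((ψ b).re ^ 2 + (ψ b).im ^ 2) +
      ((ψ (flipBit j i b)).re ^ 2 + (ψ (flipBit j i b)).im ^ 2) + 2 * sg b *
        ((ψ b).re * (ψ (flipBit j i b)).re + (ψ b).im * (ψ (flipBit j i b)).im)) * h2 +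
        (2 : ℝ)⁻¹ * ((ψ b).re ^ 2 + (ψ b).im ^ 2) * hsg
  have hX : ∑ b ∈ S, X b = 0 := by
    have h1 : ∀ b, X (flipBit j i b) = - X b := by
      intro b
      have : sg (flipBit j i b) = - sg b := by
        simp only [sg, testBit_flipBit]
        cases (b j).testBit i <;> simp
      simp only [X, this, hinv b, Complex.mul_re, Complex.conj_re, Complex.conj_im]
      ring
    have h2 := hreindex X
    simp only [h1, Finset.sum_neg_distrib] at h2
    linarith
  simp only [hterm, Finset.sum_add_distrib, ← Finset.sum_div, hX,
    hreindex fun b => ‖ψ b‖ ^ 2]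
  ring

/-- The total probability of the branches is conserved: gates are unitary, and a measurement splits
the state into orthogonal parts. -/
theorem sum_normSq_step (O : Fin 2 → ℤ → ℂ) (c : Config) :
    ((step O c).map fun c' => normSq c'.qu).sum = normSq c.qu := by
  obtain ⟨code, σ, ψ, t⟩ := c
  match code with
  | [] | .skip :: _ | .assign _ _ :: _ | .seq _ _ :: _ | .ite _ _ _ :: _ | .loop _ _ :: _ =>
      simp only [step, Multiset.map_singleton, Multiset.sum_singleton]
  | .qxor j e :: _ =>
      simp only [step, Multiset.map_singleton, Multiset.sum_singleton, xorLabel_eq]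
      exact normSq_applyBasis_perm (xorWith_involutive j _).injective ψ
  | .had j e :: _ =>
      simp only [step, Multiset.map_singleton, Multiset.sum_singleton]
      exact normSq_applyBasis_hadBasis j _ ψ
  | .phase e k :: _ =>
      simp only [step, Multiset.map_singleton, Multiset.sum_singleton]
      refine normSq_applyBasis_diagonal (fun b => ?_) ψ
      rw [Complex.norm_exp]
      simp only [Real.exp_eq_one_iff]
      set a := e.eval (Sum.elim σ b)
      have : 2 * (Real.pi : ℂ) * Complex.I * (a : ℂ) / 2 ^ k.eval σ =
          ((2 * Real.pi * a / 2 ^ k.eval σ : ℝ) : ℂ) * Complex.I := by push_cast; ring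
      rw [this, Complex.re_ofReal_mul]; simp
  | .query o j e k :: _ =>
      simp only [step, Multiset.map_singleton, Multiset.sum_singleton, queryLabel_eq]
      exact normSq_applyBasis_perm (xorWith_involutive j _).injective ψ
  | .measure j i :: r =>
      classical
      simp only [step, Multiset.map_map, Function.comp_def]
      change ∑ v ∈ ψ.support.image fun b => b j, normSq (ψ.filter fun b => b j = v) = _
      rw [normSq, ← Finset.sum_fiberwise_of_maps_to
        (g := fun b : Store => b j) (t := ψ.support.image fun b => b j)
        (fun b hb => Finset.mem_image_of_mem _ hb)]
      refine Finset.sum_congr rfl fun v _ => ?_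
      rw [normSq, Finsupp.support_filter]
      refine Finset.sum_congr rfl fun b hb => ?_
      rw [Finsupp.filter_apply_pos (fun b : Store => b j = v) _ (Finset.mem_filter.mp hb).2]

section Executions

/-! ### Big-step executions -/

/-- From `c`, at most `n` steps of the machine lead to the configurations in the multiset. -/
inductive Leads (O : Fin 2 → ℤ → ℂ) : ℕ → Config → Multiset Config → Prop
  | refl (n : ℕ) (c : Config) : Leads O n c {c}
  | step (n : ℕ) (c : Config) (F : Config → Multiset Config) (hc : c.code ≠ [])
      (h : ∀ c' ∈ step O c, Leads O n c' (F c')) : Leads O (n + 1) c ((step O c).bind F)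

variable {O : Fin 2 → ℤ → ℂ}

theorem Leads.mono {n m : ℕ} {c : Config} {M : Multiset Config} (h : Leads O n c M) (hm : n ≤ m) :
    Leads O m c M := by
  induction h generalizing m with
  | refl n c => exact .refl m c
  | step n c F hc h ih =>
      obtain ⟨k, rfl⟩ : ∃ k, m = k + 1 := ⟨m - 1, by omega⟩
      exact .step k c F hc fun c' hc' => ih c' hc' (by omega)

theorem Leads.trans {n m : ℕ} {c : Config} {M : Multiset Config} {G : Config → Multiset Config}
    (h : Leads O n c M) (hG : ∀ c' ∈ M, Leads O m c' (G c')) : Leads O (n + m) c (M.bind G) := by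
  induction h with
  | refl n c =>
      rw [Multiset.singleton_bind]
      exact (hG c (by simp)).mono (by omega)
  | step n c F hc h ih =>
      rw [Multiset.bind_assoc, show n + 1 + m = n + m + 1 by omega]
      exact .step _ c _ hc fun c' hc' => ih c' hc' fun c'' hc'' =>
        hG c'' (Multiset.mem_bind.mpr ⟨c', hc', hc''⟩)

theorem run_halted (n : ℕ) {c : Config} (hc : c.code = []) : run O n c = {c} := by
  obtain ⟨code, σ, ψ, t⟩ := c
  subst hc
  induction n with
  | zero => rfl
  | succ n ih => rw [run, step, Multiset.singleton_bind, ih]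

theorem Leads.run_eq {n : ℕ} {c : Config} {M : Multiset Config} (h : Leads O n c M)
    (hM : ∀ c' ∈ M, c'.code = []) : run O n c = M := by
  induction h with
  | refl n c => exact run_halted n (hM c (by simp))
  | step n c F hc h ih =>
      rw [run]
      exact Multiset.bind_congr fun c' hc' => ih c' hc' fun c'' hc'' =>
        hM c'' (Multiset.mem_bind.mpr ⟨c', hc', hc''⟩)

theorem Leads.sum_normSq {n : ℕ} {c : Config} {M : Multiset Config} (h : Leads O n c M) :
    (M.map fun c' => normSq c'.qu).sum = normSq c.qu := by
  induction h with
  | refl n c => simp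
  | step n c F hc h ih =>
      rw [Multiset.map_bind, Multiset.sum_bind, ← sum_normSq_step O c]
      congr 1
      exact Multiset.map_congr rfl fun c' hc' => ih c' hc'

/-- Started in the classical store `σ` and the quantum state `ψ`, the command `c` terminates after
at most `T` steps that take time at most `T`, and `M` collects the final states of all branches. -/
def Big (O : Fin 2 → ℤ → ℂ) (c : Cmd) (σ : Store) (ψ : QState) (T : ℕ)
    (M : Multiset (Store × QState)) : Prop :=
  ∀ (r : List Cmd) (t : ℕ), ∃ M' : Multiset Config, Leads O T ⟨c :: r, σ, ψ, t⟩ M' ∧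
    (∀ c' ∈ M', c'.code = r ∧ c'.time ≤ t + T) ∧ M'.map (fun c' => (c'.cl, c'.qu)) = M

theorem Big.mono {c : Cmd} {σ : Store} {ψ : QState} {T T' : ℕ} {M : Multiset (Store × QState)}
    (h : Big O c σ ψ T M) (hT : T ≤ T') : Big O c σ ψ T' M := fun r t =>
  let ⟨M', h1, h2, h3⟩ := h r t
  ⟨M', h1.mono hT, fun c' hc' => ⟨(h2 c' hc').1, (h2 c' hc').2.trans (by omega)⟩, h3⟩

theorem Big.sum_normSq {c : Cmd} {σ : Store} {ψ : QState} {T : ℕ} {M : Multiset (Store × QState)}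
    (h : Big O c σ ψ T M) : (M.map fun o => normSq o.2).sum = normSq ψ := by
  obtain ⟨M', h1, -, rfl⟩ := h [] 0
  simpa [Multiset.map_map, Function.comp_def] using h1.sum_normSq

theorem Big.of_step {c : Cmd} {σ : Store} {ψ : QState} {T τ : ℕ} {M : Multiset (Store × QState)}
    (h1 : 1 ≤ T) (hτ : τ ≤ T)
    (h : ∀ r t, step O ⟨c :: r, σ, ψ, t⟩ = M.map fun o => ⟨r, o.1, o.2, t + τ⟩) :
    Big O c σ ψ T M := by
  intro r t
  refine ⟨step O ⟨c :: r, σ, ψ, t⟩, ?_, ?_, ?_⟩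
  · have := Leads.step (O := O) (T - 1) ⟨c :: r, σ, ψ, t⟩ (fun c' => {c'}) (by simp)
      fun c' _ => .refl _ c'
    rw [Nat.sub_add_cancel h1, Multiset.bind_singleton, Multiset.map_id'] at this
    exact this
  · rw [h]
    intro c' hc'
    obtain ⟨o, -, rfl⟩ := Multiset.mem_map.mp hc'
    exact ⟨rfl, by simp; omega⟩
  · rw [h, Multiset.map_map]; simp

theorem Big.trans_step {c : Cmd} {cs : List Cmd} {σ : Store} {ψ : QState} {T τ : ℕ}
    {M : Multiset (Store × QState)} (h1 : 1 ≤ τ)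
    (h : ∀ r t, ∃ τ' ≤ τ, step O ⟨c :: r, σ, ψ, t⟩ = {⟨cs ++ r, σ, ψ, t + τ'⟩})
    (hcs : ∀ r t, ∃ M' : Multiset Config, Leads O T ⟨cs ++ r, σ, ψ, t⟩ M' ∧
      (∀ c' ∈ M', c'.code = r ∧ c'.time ≤ t + T) ∧ M'.map (fun c' => (c'.cl, c'.qu)) = M) :
    Big O c σ ψ (τ + T) M := by
  intro r t
  obtain ⟨τ', hτ', hs⟩ := h r t
  obtain ⟨M', h2, h3, h4⟩ := hcs r (t + τ')
  refine ⟨M', ?_, fun c' hc' => ⟨(h3 c' hc').1, (h3 c' hc').2.trans (by omega)⟩, h4⟩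
  have := Leads.step (O := O) T ⟨c :: r, σ, ψ, t⟩ (fun _ => M') (by simp)
    (by rw [hs]; intro c' hc'; rw [Multiset.mem_singleton.mp hc']; exact h2)
  rw [hs, Multiset.singleton_bind] at this
  exact this.mono (by omega)

theorem Big.comp {c d : Cmd} {σ : Store} {ψ : QState} {T₁ T₂ : ℕ}
    {M : Multiset (Store × QState)} {F : Store × QState → Multiset (Store × QState)}
    (hc : Big O c σ ψ T₁ M) (hd : ∀ o ∈ M, Big O d o.1 o.2 T₂ (F o)) (r : List Cmd) (t : ℕ) :
    ∃ M' : Multiset Config, Leads O (T₁ + T₂) ⟨[c, d] ++ r, σ, ψ, t⟩ M' ∧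
      (∀ c' ∈ M', c'.code = r ∧ c'.time ≤ t + (T₁ + T₂)) ∧
        M'.map (fun c' => (c'.cl, c'.qu)) = M.bind F := by
  obtain ⟨M', h1, h2, rfl⟩ := hc (d :: r) t
  have : ∀ c' ∈ M', ∃ M'' : Multiset Config, Leads O T₂ c' M'' ∧
      (∀ c'' ∈ M'', c''.code = r ∧ c''.time ≤ c'.time + T₂) ∧
      M''.map (fun c'' => (c''.cl, c''.qu)) = F (c'.cl, c'.qu) := by
    intro c' hc'
    have h3 := hd (c'.cl, c'.qu) (Multiset.mem_map_of_mem (fun c' : Config => (c'.cl, c'.qu)) hc')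
      r c'.time
    have h4 : c' = ⟨d :: r, c'.cl, c'.qu, c'.time⟩ := by
      rw [← (h2 c' hc').1]
    rw [← h4] at h3
    exact h3
  choose! G hG1 hG2 hG3 using this
  refine ⟨M'.bind G, h1.trans hG1, ?_, ?_⟩
  · intro c'' hc''
    obtain ⟨c', hc', hm⟩ := Multiset.mem_bind.mp hc''
    have := hG2 c' hc' c'' hm
    have := (h2 c' hc').2
    exact ⟨by tauto, by omega⟩
  · rw [Multiset.map_bind, Multiset.bind_map]
    exact Multiset.bind_congr fun c' hc' => hG3 c' hc'

theorem Big.seq {c d : Cmd} {σ : Store} {ψ : QState} {T₁ T₂ : ℕ}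
    {M : Multiset (Store × QState)} {F : Store × QState → Multiset (Store × QState)}
    (hc : Big O c σ ψ T₁ M) (hd : ∀ o ∈ M, Big O d o.1 o.2 T₂ (F o)) :
    Big O (.seq c d) σ ψ (1 + (T₁ + T₂)) (M.bind F) :=
  Big.trans_step le_rfl (fun _ _ => ⟨1, le_rfl, rfl⟩) (hc.comp hd)

/-! ### Time bounds -/

/-- A bound on the running time of a program all of whose registers always have at most `B` bits
and all of whose loops are iterated at most `L` times whenever they are reached.  The semiring is
`ℕ` for the bound itself and `ℕ[X]` for its dependence on the length of the input. -/
def Cmd.timeBound {R : Type*} [CommSemiring R] (B L : R) : Cmd → R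
  | .skip => 1
  | .assign _ e => 1 + e.costFactor * B
  | .seq c d => 1 + (c.timeBound B L + d.timeBound B L)
  | .ite e c d => 1 + e.costFactor * B + (c.timeBound B L + d.timeBound B L)
  | .loop e c => (L + 1) * (1 + e.costFactor * B + c.timeBound B L)
  | .qxor _ e => 1 + (1 + e.costFactor) * B
  | .had _ e => 1 + (e.costFactor + 2) * B
  | .phase e k => 1 + (k.costFactor + 1 + e.costFactor) * B
  | .query _ _ e k => 1 + (k.costFactor + 2 + e.costFactor) * B
  | .measure _ _ => 1 + B

theorem Cmd.map_timeBound {R S : Type*} [CommSemiring R] [CommSemiring S] (φ : R →+* S) (B L : R)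
    (c : Cmd) : φ (c.timeBound B L) = c.timeBound (φ B) (φ L) := by
  have h2 : φ 2 = 2 := map_ofNat φ 2
  induction c <;> simp_all [Cmd.timeBound]

/-- All registers have at most `B` bits. -/
def Bounded (B : ℕ) (σ : Store) (ψ : QState) : Prop :=
  1 ≤ B ∧ (∀ i, Nat.size (σ i) ≤ B) ∧ ∀ b ∈ ψ.support, ∀ j, Nat.size (b j) ≤ B

/-- `Big` with the time bound `Cmd.timeBound`. -/
def Runs (O : Fin 2 → ℤ → ℂ) (B L : ℕ) (c : Cmd) (σ : Store) (ψ : QState)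
    (M : Multiset (Store × QState)) : Prop :=
  Big O c σ ψ (c.timeBound B L) M

/-- The command `c` has a single branch, which ends in a state that satisfies `Post`. -/
def Det (O : Fin 2 → ℤ → ℂ) (B L : ℕ) (c : Cmd) (σ : Store) (ψ : QState)
    (Post : Store → QState → Prop) : Prop :=
  ∃ σ' ψ', Runs O B L c σ ψ {(σ', ψ')} ∧ Post σ' ψ'

/-- All branches of the command `c` end in states that satisfy `Post`, and the sum of the payoffs
`W` of the final states is at least `v`.  With the payoff `normSq ψ` on states with a certain
property this bounds from below the probability of that property. -/
def Ens (O : Fin 2 → ℤ → ℂ) (B L : ℕ) (c : Cmd) (σ : Store) (ψ : QState)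
    (Post : Store → QState → Prop) (W : Store → QState → ℝ) (v : ℝ) : Prop :=
  ∃ M, Runs O B L c σ ψ M ∧ (∀ o ∈ M, Post o.1 o.2) ∧ v ≤ (M.map fun o => W o.1 o.2).sum

variable {B L : ℕ} {c d : Cmd} {σ : Store} {ψ : QState} {Post Mid : Store → QState → Prop}
  {W W' : Store → QState → ℝ} {v : ℝ}

theorem Runs.seq {M : Multiset (Store × QState)} {F : Store × QState → Multiset (Store × QState)}
    (hc : Runs O B L c σ ψ M) (hd : ∀ o ∈ M, Runs O B L d o.1 o.2 (F o)) :
    Runs O B L (.seq c d) σ ψ (M.bind F) :=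
  Big.seq hc hd

theorem Det.mono (h : Det O B L c σ ψ Mid) (hP : ∀ σ' ψ', Mid σ' ψ' → Post σ' ψ') :
    Det O B L c σ ψ Post :=
  let ⟨σ', ψ', h1, h2⟩ := h
  ⟨σ', ψ', h1, hP σ' ψ' h2⟩

theorem Det.seq (h : Det O B L c σ ψ Mid) (hd : ∀ σ' ψ', Mid σ' ψ' → Det O B L d σ' ψ' Post) :
    Det O B L (.seq c d) σ ψ Post := by
  obtain ⟨σ', ψ', h1, h2⟩ := h
  obtain ⟨σ'', ψ'', h3, h4⟩ := hd σ' ψ' h2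
  refine ⟨σ'', ψ'', ?_, h4⟩
  have := Runs.seq h1 (F := fun _ => {(σ'', ψ'')}) (d := d)
    (by intro o ho; rw [Multiset.mem_singleton.mp ho]; exact h3)
  simpa using this

theorem Ens.seq (h : Ens O B L c σ ψ Mid W' v)
    (hd : ∀ σ' ψ', Mid σ' ψ' → Ens O B L d σ' ψ' Post W (W' σ' ψ')) :
    Ens O B L (.seq c d) σ ψ Post W v := by
  obtain ⟨M, h1, h2, h3⟩ := h
  have : ∀ o ∈ M, ∃ N, Runs O B L d o.1 o.2 N ∧ (∀ o' ∈ N, Post o'.1 o'.2) ∧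
      W' o.1 o.2 ≤ (N.map fun o => W o.1 o.2).sum := fun o ho => hd o.1 o.2 (h2 o ho)
  choose! F hF1 hF2 hF3 using this
  refine ⟨M.bind F, h1.seq hF1, ?_, h3.trans ?_⟩
  · intro o ho
    obtain ⟨o', ho', hm⟩ := Multiset.mem_bind.mp ho
    exact hF2 o' ho' o hm
  · rw [Multiset.map_bind, Multiset.sum_bind]
    exact Multiset.sum_map_le_sum_map _ _ hF3

theorem Det.ens (h : Det O B L c σ ψ Mid) (hP : ∀ σ' ψ', Mid σ' ψ' → Post σ' ψ' ∧ v ≤ W σ' ψ') :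
    Ens O B L c σ ψ Post W v := by
  obtain ⟨σ', ψ', h1, h2⟩ := h
  exact ⟨_, h1, by simpa using (hP σ' ψ' h2).1, by simpa using (hP σ' ψ' h2).2⟩

theorem Det.seq_ens (h : Det O B L c σ ψ Mid)
    (hd : ∀ σ' ψ', Mid σ' ψ' → Ens O B L d σ' ψ' Post W v) :
    Ens O B L (.seq c d) σ ψ Post W v :=
  Ens.seq (W' := fun _ _ => v) (h.ens fun _ _ h' => ⟨h', le_rfl⟩) hd

theorem Ens.mono {Post' : Store → QState → Prop} {v' : ℝ} (h : Ens O B L c σ ψ Post W v)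
    (hP : ∀ σ' ψ', Post σ' ψ' → Post' σ' ψ' ∧ W σ' ψ' ≤ W' σ' ψ') (hv : v' ≤ v) :
    Ens O B L c σ ψ Post' W' v' := by
  obtain ⟨M, h1, h2, h3⟩ := h
  exact ⟨M, h1, fun o ho => (hP _ _ (h2 o ho)).1, hv.trans (h3.trans
    (Multiset.sum_map_le_sum_map _ _ fun o ho => (hP _ _ (h2 o ho)).2))⟩

/-- Probabilities of complementary events add up to one, as gates and measurements preserve the
total squared norm. -/
theorem Ens.affine (h : Ens O B L c σ ψ Post W v) (α : ℝ) {β : ℝ} (hβ : 0 ≤ β) :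
    Ens O B L c σ ψ Post (fun σ' ψ' => α * normSq ψ' + β * W σ' ψ') (α * normSq ψ + β * v) := by
  obtain ⟨M, h1, h2, h3⟩ := h
  refine ⟨M, h1, h2, ?_⟩
  rw [Multiset.sum_map_add, Multiset.sum_map_mul_left, Multiset.sum_map_mul_left, h1.sum_normSq]
  gcongr

/-! ### Rules for single instructions -/

theorem supCost_le {w : Store → ℕ} {C : ℕ} (h : ∀ b ∈ ψ.support, w b ≤ C) : supCost ψ w ≤ C :=
  Finset.sup_le h

theorem Bounded.elim (h : Bounded B σ ψ) {b : Store} (hb : b ∈ ψ.support) (v : ℕ ⊕ ℕ) :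
    Nat.size (Sum.elim σ b v) ≤ B := by
  cases v with
  | inl i => exact h.2.1 i
  | inr j => exact h.2.2 b hb j

theorem Bounded.elim_update (h : Bounded B σ ψ) {b : Store} (hb : b ∈ ψ.support) (j : ℕ)
    (v : ℕ ⊕ ℕ) : Nat.size (Sum.elim σ (Function.update b j 0) v) ≤ B := by
  cases v with
  | inl i => exact h.2.1 i
  | inr i =>
      by_cases hi : i = j
      · subst hi; simp
      · simpa [hi] using h.2.2 b hb i

theorem Bounded.expr (h : Bounded B σ ψ) (e : Expr ℕ) : e.cost σ ≤ e.costFactor * B :=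
  e.cost_le h.1 h.2.1

theorem Det.skip (hP : Post σ ψ) : Det O B L .skip σ ψ Post :=
  ⟨σ, ψ, Big.of_step (τ := 1) (by simp [Cmd.timeBound]) (by simp [Cmd.timeBound])
    (fun _ _ => rfl), hP⟩

theorem Det.assign {i : ℕ} {e : Expr ℕ} (hB : Bounded B σ ψ)
    (hP : Post (Function.update σ i (e.eval σ)) ψ) : Det O B L (.assign i e) σ ψ Post := by
  have := hB.expr e
  exact ⟨_, ψ, Big.of_step (τ := 1 + e.cost σ) (by simp [Cmd.timeBound])
    (by simp [Cmd.timeBound]; omega) (fun _ _ => rfl), hP⟩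

theorem Det.qxor {j : ℕ} {e : Expr (ℕ ⊕ ℕ)} (hB : Bounded B σ ψ)
    (hP : Post σ (applyBasis (fun b => Finsupp.single (xorLabel σ j e b) 1) ψ)) :
    Det O B L (.qxor j e) σ ψ Post := by
  refine ⟨_, _, Big.of_step (by simp [Cmd.timeBound]) ?_ (fun _ _ => rfl), hP⟩
  simp only [Cmd.timeBound, Nat.cast_id]
  gcongr
  refine supCost_le fun b hb => ?_
  have h1 := hB.2.2 b hb j
  have h2 := e.cost_le hB.1 (hB.elim_update hb j)
  rw [add_mul]; omega

theorem Det.had {j : ℕ} {e : Expr ℕ} (hB : Bounded B σ ψ) (he : e.eval σ ≤ B)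
    (hP : Post σ (applyBasis (hadBasis j (e.eval σ)) ψ)) : Det O B L (.had j e) σ ψ Post := by
  refine ⟨_, _, Big.of_step (by simp [Cmd.timeBound]) ?_ (fun _ _ => rfl), hP⟩
  have h1 := hB.expr e
  have h2 : supCost ψ (fun b => Nat.size (b j)) ≤ B := supCost_le fun b hb => hB.2.2 b hb j
  simp only [Cmd.timeBound, Nat.cast_id, add_mul]
  omega

theorem Det.phase {e : Expr (ℕ ⊕ ℕ)} {k : Expr ℕ} (hB : Bounded B σ ψ) (hk : k.eval σ ≤ B)
    (hP : Post σ (applyBasis (phaseBasis σ e (k.eval σ)) ψ)) :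
    Det O B L (.phase e k) σ ψ Post := by
  refine ⟨_, _, Big.of_step (by simp [Cmd.timeBound]) ?_ (fun _ _ => rfl), hP⟩
  have h1 := hB.expr k
  have h2 : supCost ψ (fun b => e.cost (Sum.elim σ b)) ≤ e.costFactor * B :=
    supCost_le fun b hb => e.cost_le hB.1 (hB.elim hb)
  simp only [Cmd.timeBound, Nat.cast_id, add_mul]
  omega

theorem Det.query {o : Fin 2} {j : ℕ} {e : Expr (ℕ ⊕ ℕ)} {k : Expr ℕ} (hB : Bounded B σ ψ)
    (hk : k.eval σ ≤ B)
    (hP : Post σ (applyBasis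
      (fun b => Finsupp.single (queryLabel (O o) σ j e (k.eval σ) b) 1) ψ)) :
    Det O B L (.query o j e k) σ ψ Post := by
  refine ⟨_, _, Big.of_step (by simp [Cmd.timeBound]) ?_ (fun _ _ => rfl), hP⟩
  have h1 := hB.expr k
  have h2 : supCost ψ (fun b => Nat.size (b j) + e.cost (Sum.elim σ (Function.update b j 0))) ≤
      B + e.costFactor * B := by
    refine supCost_le fun b hb => ?_
    have h1 := hB.2.2 b hb j
    have h2 := e.cost_le hB.1 (hB.elim_update hb j)
    omega
  simp only [Cmd.timeBound, Nat.cast_id, add_mul]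
  omega

theorem Det.assign_seq {i : ℕ} {e : Expr ℕ} (hB : Bounded B σ ψ)
    (h : Det O B L d (Function.update σ i (e.eval σ)) ψ Post) :
    Det O B L (.seq (.assign i e) d) σ ψ Post :=
  Det.seq (Det.assign (Post := fun σ' ψ' => σ' = _ ∧ ψ' = _) hB ⟨rfl, rfl⟩)
    (by rintro _ _ ⟨rfl, rfl⟩; exact h)

theorem Det.qxor_seq {j : ℕ} {e : Expr (ℕ ⊕ ℕ)} {ψ' : QState} (hB : Bounded B σ ψ)
    (hψ : applyBasis (fun b => Finsupp.single (xorLabel σ j e b) 1) ψ = ψ')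
    (h : Det O B L d σ ψ' Post) : Det O B L (.seq (.qxor j e) d) σ ψ Post :=
  Det.seq (Det.qxor (Post := fun σ' ψ' => σ' = _ ∧ ψ' = _) hB ⟨rfl, rfl⟩)
    (by rintro _ _ ⟨rfl, rfl⟩; exact hψ ▸ h)

theorem Det.had_seq {j : ℕ} {e : Expr ℕ} {ψ' : QState} (hB : Bounded B σ ψ) (he : e.eval σ ≤ B)
    (hψ : applyBasis (hadBasis j (e.eval σ)) ψ = ψ')
    (h : Det O B L d σ ψ' Post) : Det O B L (.seq (.had j e) d) σ ψ Post :=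
  Det.seq (Det.had (Post := fun σ' ψ' => σ' = _ ∧ ψ' = _) hB he ⟨rfl, rfl⟩)
    (by rintro _ _ ⟨rfl, rfl⟩; exact hψ ▸ h)

theorem Det.phase_seq {e : Expr (ℕ ⊕ ℕ)} {k : Expr ℕ} {ψ' : QState} (hB : Bounded B σ ψ)
    (hk : k.eval σ ≤ B) (hψ : applyBasis (phaseBasis σ e (k.eval σ)) ψ = ψ')
    (h : Det O B L d σ ψ' Post) : Det O B L (.seq (.phase e k) d) σ ψ Post :=
  Det.seq (Det.phase (Post := fun σ' ψ' => σ' = _ ∧ ψ' = _) hB hk ⟨rfl, rfl⟩)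
    (by rintro _ _ ⟨rfl, rfl⟩; exact hψ ▸ h)

theorem Det.query_seq {o : Fin 2} {j : ℕ} {e : Expr (ℕ ⊕ ℕ)} {k : Expr ℕ} {ψ' : QState}
    (hB : Bounded B σ ψ) (hk : k.eval σ ≤ B)
    (hψ : applyBasis (fun b => Finsupp.single (queryLabel (O o) σ j e (k.eval σ) b) 1) ψ = ψ')
    (h : Det O B L d σ ψ' Post) : Det O B L (.seq (.query o j e k) d) σ ψ Post :=
  Det.seq (Det.query (Post := fun σ' ψ' => σ' = _ ∧ ψ' = _) hB hk ⟨rfl, rfl⟩)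
    (by rintro _ _ ⟨rfl, rfl⟩; exact hψ ▸ h)

theorem Ens.measure {j i : ℕ} (hB : Bounded B σ ψ)
    (hP : ∀ v ∈ ψ.support.image fun b => b j,
      Post (Function.update σ i v) (ψ.filter fun b => b j = v)) :
    Ens O B L (.measure j i) σ ψ Post W (∑ v ∈ ψ.support.image fun b => b j,
      W (Function.update σ i v) (ψ.filter fun b => b j = v)) := by
  have h2 : supCost ψ (fun b => Nat.size (b j)) ≤ B := supCost_le fun b hb => hB.2.2 b hb j
  refine ⟨(ψ.support.image fun b => b j).val.map fun v =>
    (Function.update σ i v, ψ.filter fun b => b j = v),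
    Big.of_step (τ := 1 + supCost ψ fun b => Nat.size (b j)) (by simp [Cmd.timeBound])
      (by simp [Cmd.timeBound]; omega) (fun r t => ?_), ?_, ?_⟩
  · rw [Multiset.map_map]; rfl
  · intro o ho
    obtain ⟨v, hv, rfl⟩ := Multiset.mem_map.mp ho
    exact hP v hv
  · rw [Multiset.map_map]; rfl

/-- Measuring a register of a basis state has a single outcome. -/
theorem Det.measure_single {j i : ℕ} {b : Store} {α : ℂ} (hα : α ≠ 0)
    (hB : Bounded B σ (Finsupp.single b α))
    (hP : Post (Function.update σ i (b j)) (Finsupp.single b α)) :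
    Det O B L (.measure j i) σ (Finsupp.single b α) Post := by
  have h2 : supCost (Finsupp.single b α) (fun b => Nat.size (b j)) ≤ B :=
    supCost_le fun b hb => hB.2.2 b hb j
  refine ⟨_, _, Big.of_step (τ := 1 + supCost (Finsupp.single b α) fun b => Nat.size (b j))
    (by simp [Cmd.timeBound]) (by simp [Cmd.timeBound]; omega) (fun r t => ?_), hP⟩
  have hs : (Finsupp.single b α).support = {b} :=
    Finsupp.support_eq_singleton.mpr ⟨by simpa using hα, by simp⟩
  simp only [step, hs, Finset.image_singleton,
    Finset.singleton_val, Multiset.map_singleton]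
  rw [Finsupp.filter_single_of_pos (fun b' : Store => b' j = b j) rfl]

theorem Runs.ite {e : Expr ℕ} {M : Multiset (Store × QState)} (hB : Bounded B σ ψ)
    (hc : e.eval σ ≠ 0 → Runs O B L c σ ψ M) (hd : e.eval σ = 0 → Runs O B L d σ ψ M) :
    Runs O B L (.ite e c d) σ ψ M := by
  have h1 := hB.expr e
  refine Big.trans_step (cs := [if e.eval σ = 0 then d else c]) (by simp)
    (fun r t => ⟨1 + e.cost σ, by simpa using h1, rfl⟩) ?_
  have : Big O (if e.eval σ = 0 then d else c) σ ψ (c.timeBound B L + d.timeBound B L) M := by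
    split_ifs with h
    · exact (hd h).mono (by omega)
    · exact (hc h).mono (by omega)
  exact this

theorem Det.ite {e : Expr ℕ} (hB : Bounded B σ ψ)
    (hc : e.eval σ ≠ 0 → Det O B L c σ ψ Post) (hd : e.eval σ = 0 → Det O B L d σ ψ Post) :
    Det O B L (.ite e c d) σ ψ Post := by
  by_cases h : e.eval σ = 0
  · obtain ⟨σ', ψ', h1, h2⟩ := hd h
    exact ⟨σ', ψ', Runs.ite hB (fun h' => absurd h h') fun _ => h1, h2⟩
  · obtain ⟨σ', ψ', h1, h2⟩ := hc h
    exact ⟨σ', ψ', Runs.ite hB (fun _ => h1) fun h' => absurd h' h, h2⟩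

/-! ### Rules for loops -/

theorem Big.loop_exit {e : Expr ℕ} (hB : Bounded B σ ψ) (he : e.eval σ = 0) :
    Big O (.loop e c) σ ψ (1 + e.costFactor * B + c.timeBound B L) {(σ, ψ)} := by
  have h1 := hB.expr e
  refine Big.of_step (τ := 1 + e.cost σ) (by omega) (by omega) fun r t => ?_
  simp [step, he]

theorem Big.loop_iterate {e : Expr ℕ} {T : ℕ} {M : Multiset (Store × QState)}
    {F : Store × QState → Multiset (Store × QState)} (hB : Bounded B σ ψ) (he : e.eval σ ≠ 0)
    (hc : Runs O B L c σ ψ M) (hl : ∀ o ∈ M, Big O (.loop e c) o.1 o.2 T (F o)) :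
    Big O (.loop e c) σ ψ (1 + e.costFactor * B + c.timeBound B L + T) (M.bind F) := by
  have h1 := hB.expr e
  rw [add_assoc]
  refine Big.trans_step (cs := [c, .loop e c]) (by omega)
    (fun r t => ⟨1 + e.cost σ, by omega, ?_⟩) (Big.comp hc hl)
  simp [step, he]

/-- Loops in single-branch programs: `Inv i` holds after `i` iterations. -/
theorem Det.loop {e : Expr ℕ} (Inv : ℕ → Store → QState → Prop) (h0 : Inv 0 σ ψ)
    (hB : ∀ i σ ψ, Inv i σ ψ → Bounded B σ ψ)
    (hstep : ∀ i σ ψ, Inv i σ ψ → e.eval σ ≠ 0 → i < L ∧ Det O B L c σ ψ (Inv (i + 1))) :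
    Det O B L (.loop e c) σ ψ fun σ' ψ' => ∃ i, Inv i σ' ψ' ∧ e.eval σ' = 0 := by
  have key : ∀ n i σ ψ, Inv i σ ψ → L ≤ i + n → ∃ σ' ψ',
      Big O (.loop e c) σ ψ ((n + 1) * (1 + e.costFactor * B + c.timeBound B L)) {(σ', ψ')} ∧
        ∃ i, Inv i σ' ψ' ∧ e.eval σ' = 0 := by
    intro n
    induction n with
    | zero =>
        intro i σ ψ hi hL
        by_cases he : e.eval σ = 0
        · exact ⟨σ, ψ, (Big.loop_exit (L := L) (hB i σ ψ hi) he).mono (by simp), i, hi, he⟩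
        · exact absurd (hstep i σ ψ hi he).1 (by omega)
    | succ n ih =>
        intro i σ ψ hi hL
        by_cases he : e.eval σ = 0
        · exact ⟨σ, ψ, (Big.loop_exit (hB i σ ψ hi) he).mono
            (Nat.le_mul_of_pos_left _ (by omega)), i, hi, he⟩
        · obtain ⟨-, σ₁, ψ₁, h1, h2⟩ := hstep i σ ψ hi he
          obtain ⟨σ', ψ', h3, h4⟩ := ih (i + 1) σ₁ ψ₁ h2 (by omega)
          refine ⟨σ', ψ', ?_, h4⟩
          have := Big.loop_iterate (F := fun _ => {(σ', ψ')}) (hB i σ ψ hi) he h1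
            (by intro o ho; rw [Multiset.mem_singleton.mp ho]; exact h3)
          rw [Multiset.singleton_bind] at this
          exact this.mono (le_of_eq (by ring))
  obtain ⟨σ', ψ', h1, h2⟩ := key L 0 σ ψ h0 (by omega)
  exact ⟨σ', ψ', by simpa [Runs, Cmd.timeBound] using h1, h2⟩

/-- Loops in programs with several branches: `V i σ ψ` bounds from below the payoff to be expected
from a state `(σ, ψ)` that is reached after `i` iterations. -/
theorem Ens.loop {e : Expr ℕ} (Inv : ℕ → Store → QState → Prop) (V : ℕ → Store → QState → ℝ)
    (h0 : Inv 0 σ ψ) (hB : ∀ i σ ψ, Inv i σ ψ → Bounded B σ ψ)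
    (hstep : ∀ i σ ψ, Inv i σ ψ → e.eval σ ≠ 0 →
      i < L ∧ Ens O B L c σ ψ (Inv (i + 1)) (V (i + 1)) (V i σ ψ))
    (hend : ∀ i σ ψ, Inv i σ ψ → e.eval σ = 0 → V i σ ψ ≤ W σ ψ) :
    Ens O B L (.loop e c) σ ψ (fun σ' ψ' => ∃ i, Inv i σ' ψ' ∧ e.eval σ' = 0) W (V 0 σ ψ) := by
  have key : ∀ n i σ ψ, Inv i σ ψ → L ≤ i + n → ∃ M,
      Big O (.loop e c) σ ψ ((n + 1) * (1 + e.costFactor * B + c.timeBound B L)) M ∧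
        (∀ o ∈ M, ∃ i, Inv i o.1 o.2 ∧ e.eval o.1 = 0) ∧
          V i σ ψ ≤ (M.map fun o => W o.1 o.2).sum := by
    intro n
    induction n with
    | zero =>
        intro i σ ψ hi hL
        by_cases he : e.eval σ = 0
        · exact ⟨_, (Big.loop_exit (L := L) (hB i σ ψ hi) he).mono (by simp),
            by simpa using ⟨⟨i, hi⟩, he⟩, by simpa using hend i σ ψ hi he⟩
        · exact absurd (hstep i σ ψ hi he).1 (by omega)
    | succ n ih =>
        intro i σ ψ hi hL
        by_cases he : e.eval σ = 0
        · exact ⟨_, (Big.loop_exit (hB i σ ψ hi) he).mono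
            (Nat.le_mul_of_pos_left _ (by omega)),
            by simpa using ⟨⟨i, hi⟩, he⟩, by simpa using hend i σ ψ hi he⟩
        · obtain ⟨-, M, h1, h2, h3⟩ := hstep i σ ψ hi he
          have : ∀ o ∈ M, ∃ N, Big O (.loop e c) o.1 o.2
              ((n + 1) * (1 + e.costFactor * B + c.timeBound B L)) N ∧
              (∀ o ∈ N, ∃ i, Inv i o.1 o.2 ∧ e.eval o.1 = 0) ∧
              V (i + 1) o.1 o.2 ≤ (N.map fun o => W o.1 o.2).sum :=
            fun o ho => ih (i + 1) o.1 o.2 (h2 o ho) (by omega)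
          choose! F hF1 hF2 hF3 using this
          refine ⟨M.bind F, (Big.loop_iterate (hB i σ ψ hi) he h1 hF1).mono (le_of_eq (by ring)),
            ?_, h3.trans ?_⟩
          · intro o ho
            obtain ⟨o', ho', hm⟩ := Multiset.mem_bind.mp ho
            exact hF2 o' ho' o hm
          · rw [Multiset.map_bind, Multiset.sum_bind]
            exact Multiset.sum_map_le_sum_map _ _ hF3
  obtain ⟨M, h1, h2, h3⟩ := key L 0 σ ψ h0 (by omega)
  exact ⟨M, by simpa [Runs, Cmd.timeBound] using h1, h2, h3⟩

/-! ### From executions to the machine -/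

open scoped Classical in
/-- A program all of whose executions run within the resource bounds halts within its time bound,
and the expected payoff bounds its probability of success from below. -/
theorem Ens.halts_and_succeeds {P : Cmd} {N : ℕ} {good : Store → Prop}
    (h : Ens O B L P (Function.update 0 0 N) (Finsupp.single 0 1) Post
      (fun σ ψ => if good σ then normSq ψ else 0) v) :
    HaltsWithin O P N (P.timeBound B L) ∧ v ≤ successProb O P N (P.timeBound B L) good := by
  obtain ⟨M, h1, -, h3⟩ := h
  obtain ⟨M', h4, h5, rfl⟩ := h1 [] 0
  have hrun : run O (P.timeBound B L) (start P N) = M' := h4.run_eq fun c' hc' => (h5 c' hc').1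
  refine ⟨fun c hc => ?_, ?_⟩
  · rw [hrun] at hc
    simpa using h5 c hc
  · rw [successProb, hrun]
    have : ∀ M'' : Multiset Config, (∀ c ∈ M'', c.code = []) →
        ((M''.filter fun c => c.code = [] ∧ good c.cl).map fun c => normSq c.qu).sum =
          (M''.map fun c => if good c.cl then normSq c.qu else 0).sum := by
      intro M''
      induction M'' using Multiset.induction with
      | empty => simp
      | cons c s ih =>
          intro hs
          have hc := hs c (by simp)
          have := ih fun c' hc' => hs c' (Multiset.mem_cons_of_mem hc')
          by_cases hg : good c.cl
          · rw [Multiset.filter_cons_of_pos _ ⟨hc, hg⟩]; simp [this, hg]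
          · rw [Multiset.filter_cons_of_neg _ (fun h' => hg h'.2)]; simp [this, hg]
    rw [this M' fun c hc => (h5 c hc).1]
    simpa [Multiset.map_map, Function.comp_def] using h3

/-! ### States of the quantum memory -/

/-- `exp (2πi θ)`. -/
noncomputable def ex (θ : ℝ) : ℂ := Complex.exp (2 * Real.pi * Complex.I * θ)

theorem ex_add (a b : ℝ) : ex (a + b) = ex a * ex b := by
  rw [ex, ex, ex, ← Complex.exp_add]; push_cast; ring_nf

@[simp] theorem ex_zero : ex 0 = 1 := by simp [ex]

@[simp] theorem ex_intCast (n : ℤ) : ex n = 1 := by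
  rw [ex, Complex.exp_eq_one_iff]; exact ⟨n, by push_cast; ring⟩

theorem ex_add_int (a : ℝ) (n : ℤ) : ex (a + n) = ex a := by simp [ex_add]

@[simp] theorem norm_ex (θ : ℝ) : ‖ex θ‖ = 1 := by
  have : 2 * (Real.pi : ℂ) * Complex.I * θ = ((2 * Real.pi * θ : ℝ) : ℂ) * Complex.I := by
    push_cast; ring
  rw [ex, this, Complex.norm_exp_ofReal_mul_I]

/-- The Fourier transform of order `Q` of a vector indexed by `0, …, Q - 1`. -/
noncomputable def ft (Q : ℕ) (a : ℕ → ℂ) (v : ℕ) : ℂ :=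
  ((Real.sqrt Q : ℝ) : ℂ)⁻¹ * ∑ x ∈ Finset.range Q, ex ((x : ℝ) * v / Q) * a x

/-- The basis state with `x` in register `j` and zero in all others. -/
def ket (j x : ℕ) : Store := Function.update 0 j x

/-- The basis state with `x` in register `i`, `y` in register `j` and zero in all others. -/
def ket₂ (i j x y : ℕ) : Store := Function.update (ket i x) j y

/-- The superposition in which register `j` holds `x < Q` with amplitude `a x`, and all other
registers are zero. -/
noncomputable def regState (j Q : ℕ) (a : ℕ → ℂ) : QState :=
  ∑ x ∈ Finset.range Q, Finsupp.single (ket j x) (a x)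

@[simp] theorem ket_zero (j : ℕ) : ket j 0 = 0 := by simp [ket]

@[simp] theorem ket_self (j x : ℕ) : ket j x j = x := by simp [ket]

theorem ket_ne {i j : ℕ} (h : i ≠ j) (x : ℕ) : ket j x i = 0 := by simp [ket, h]

theorem ket_injective (j : ℕ) : Function.Injective (ket j) := fun x y h => by
  simpa using congrFun h j

section Ket₂

variable {i j : ℕ} (h : i ≠ j) (x y z : ℕ)
include h

theorem ket₂_fst : ket₂ i j x y i = x := by simp [ket₂, h]
omit h in
@[simp] theorem ket₂_snd : ket₂ i j x y j = y := by simp [ket₂]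
theorem update_ket₂_fst : Function.update (ket₂ i j x y) i z = ket₂ i j z y := by
  rw [ket₂, Function.update_comm h.symm, ket, Function.update_idem]; rfl
omit h in
@[simp] theorem update_ket₂_snd : Function.update (ket₂ i j x y) j z = ket₂ i j x z := by
  rw [ket₂, Function.update_idem]; rfl
theorem ket₂_zero : ket₂ i j x 0 = ket i x := by
  rw [ket₂, Function.update_eq_self_iff, ket_ne h.symm]
omit h in
@[simp] theorem ket₂_zero_left : ket₂ i j 0 y = ket j y := by
  rw [ket₂, ket_zero, ket]

end Ket₂

/-! ### Sizes of registers in superpositions -/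

/-- All registers of all basis states in `ψ` have at most `B` bits. -/
def QBounded (B : ℕ) (ψ : QState) : Prop := ∀ b ∈ ψ.support, ∀ j, Nat.size (b j) ≤ B

theorem QBounded.single {b : Store} (h : ∀ j, Nat.size (b j) ≤ B) (α : ℂ) :
    QBounded B (Finsupp.single b α) := by
  intro b' hb'
  rw [Finset.mem_singleton.mp (Finsupp.support_single_subset hb')]
  exact h

theorem QBounded.sum {ι : Type*} {s : Finset ι} {ψ : ι → QState} (h : ∀ i ∈ s, QBounded B (ψ i)) :
    QBounded B (∑ i ∈ s, ψ i) := by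
  classical
  intro b hb
  obtain ⟨i, hi, hb'⟩ := Finset.mem_biUnion.mp (Finsupp.support_finsetSum hb)
  exact h i hi b hb'

theorem QBounded.add {ψ₁ ψ₂ : QState} (h₁ : QBounded B ψ₁) (h₂ : QBounded B ψ₂) :
    QBounded B (ψ₁ + ψ₂) := by
  classical
  intro b hb
  rcases Finset.mem_union.mp (Finsupp.support_add hb) with h | h
  exacts [h₁ b h, h₂ b h]

theorem size_update_le {σ : Store} (h : ∀ i, Nat.size (σ i) ≤ B) (i : ℕ) {a : ℕ}
    (ha : Nat.size a ≤ B) (k : ℕ) : Nat.size (Function.update σ i a k) ≤ B := by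
  by_cases hk : k = i
  · subst hk; simpa using ha
  · simpa [hk] using h k

theorem size_ket_le {x : ℕ} (hx : Nat.size x ≤ B) (j k : ℕ) : Nat.size (ket j x k) ≤ B :=
  size_update_le (fun _ => by simp) j hx k

theorem size_ket₂_le {x y : ℕ} (hx : Nat.size x ≤ B) (hy : Nat.size y ≤ B) (i j k : ℕ) :
    Nat.size (ket₂ i j x y k) ≤ B :=
  size_update_le (size_ket_le hx i) j hy k

theorem size_le_of_lt_two_pow {x q : ℕ} (h : x < 2 ^ q) (hq : q ≤ B) : Nat.size x ≤ B :=
  (Nat.size_le.mpr h).trans hq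

theorem QBounded.regState {q : ℕ} (hq : q ≤ B) (j : ℕ) (a : ℕ → ℂ) :
    QBounded B (regState j (2 ^ q) a) :=
  .sum fun _ hx => .single (size_ket_le (size_le_of_lt_two_pow (Finset.mem_range.mp hx) hq) j) _

/-! ### The quantum Fourier transform -/

/-- Sequential composition. -/
infixr:67 " ;; " => Cmd.seq

/-- A classical register in an expression over classical and quantum registers. -/
abbrev cl (i : ℕ) : Expr (ℕ ⊕ ℕ) := .var (.inl i)

/-- A quantum register in an expression over classical and quantum registers. -/
abbrev qu (j : ℕ) : Expr (ℕ ⊕ ℕ) := .var (.inr j)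

/-- A classical register in an expression over classical registers. -/
abbrev reg (i : ℕ) : Expr ℕ := .var i

/-- One iteration of the Fourier transform: the top bit of what is left of register `a` moves to
register `b`, is transformed there, and is rotated by the lower bits in register `a`. -/
def qftStep (a b : ℕ) : Cmd :=
  .qxor b (qu a / cl 12 * cl 11) ;; .qxor a (qu b / cl 11 * cl 12) ;; .had b (reg 10) ;;
    .phase (qu b / cl 11 * qu a) (reg 2 - reg 10) ;;
      .assign 10 (reg 10 + .const 1) ;; .assign 11 (reg 11 * .const 2) ;;
        .assign 12 (reg 12 / .const 2)

/-- Fourier transform from register `a` to register `b`. The number of qubits `q` is in classical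
register `2`, and `2 ^ q` in register `3`; register `10` counts the iterations, and after `m` of
them registers `11` and `12` hold `2 ^ m` and `2 ^ (q - 1 - m)`. -/
def qft (a b : ℕ) : Cmd :=
  .assign 10 (.const 0) ;; .assign 11 (.const 1) ;; .assign 12 (reg 3 / .const 2) ;;
    .loop (reg 2 - reg 10) (qftStep a b)

/-- The state after `m` iterations of the Fourier transform of order `2 ^ q`. -/
noncomputable def qftState (a b q m : ℕ) (α : ℕ → ℂ) : QState :=
  ∑ x ∈ Finset.range (2 ^ q), ∑ v ∈ Finset.range (2 ^ m),
    Finsupp.single (ket₂ a b (x % 2 ^ (q - m)) v)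
      (((Real.sqrt 2 : ℝ) : ℂ)⁻¹ ^ m * ex ((x : ℝ) * v / 2 ^ q) * α x)

theorem xor_mul_two_pow {v m t : ℕ} (hv : v < 2 ^ m) : v ^^^ t * 2 ^ m = v + t * 2 ^ m := by
  rw [Nat.xor_comm, mul_comm, add_comm]
  refine Nat.eq_of_testBit_eq fun i => ?_
  rw [Nat.testBit_xor, Nat.testBit_two_pow_mul_add _ hv, Nat.testBit_two_pow_mul]
  by_cases hi : i < m
  · simp [hi, Nat.not_le.mpr hi]
  · have : v.testBit i = false :=
      Nat.testBit_lt_two_pow (hv.trans_le (Nat.pow_le_pow_right (by norm_num) (by omega)))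
    simp [hi, Nat.not_lt.mp hi, this]

theorem qftState_zero {a b q : ℕ} (hab : a ≠ b) (α : ℕ → ℂ) :
    qftState a b q 0 α = regState a (2 ^ q) α := by
  refine Finset.sum_congr rfl fun x hx => ?_
  simp [ket₂_zero hab, Nat.mod_eq_of_lt (Finset.mem_range.mp hx), -Finsupp.single_mul]

theorem qftState_last {a b q : ℕ} (α : ℕ → ℂ) :
    qftState a b q q α = regState b (2 ^ q) (ft (2 ^ q) α) := by
  rw [qftState, regState, Finset.sum_comm]
  refine Finset.sum_congr rfl fun v _ => ?_
  simp only [Nat.sub_self, pow_zero, Nat.mod_one, ket₂_zero_left]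
  rw [← Finsupp.single_finsetSum, ft, Finset.mul_sum]
  congr 1
  refine Finset.sum_congr rfl fun x _ => ?_
  have : Real.sqrt ((2 ^ q : ℕ) : ℝ) = Real.sqrt 2 ^ q := by
    rw [Real.sqrt_eq_iff_mul_self_eq (by positivity) (by positivity), ← mul_pow,
      Real.mul_self_sqrt (by norm_num)]
    push_cast; rfl
  rw [this]; push_cast
  rw [inv_pow, mul_assoc]

theorem hadBasis_ket₂ {a b m t y v : ℕ} (hv : v < 2 ^ m) (ht : t < 2) :
    hadBasis b m (ket₂ a b y (v + t * 2 ^ m)) =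
      Finsupp.single (ket₂ a b y v) ((Real.sqrt 2 : ℝ) : ℂ)⁻¹ +
        Finsupp.single (ket₂ a b y (v + 2 ^ m)) (((Real.sqrt 2 : ℝ) : ℂ)⁻¹ * ex (t / 2)) := by
  have h1 : v ^^^ 2 ^ m = v + 2 ^ m := by simpa using xor_mul_two_pow (t := 1) hv
  have h2 : (v + 2 ^ m).testBit m = true := by
    rw [add_comm]; simp [Nat.testBit_two_pow_add_eq, Nat.testBit_lt_two_pow hv]
  have h3 : ex (1 / 2) = -1 := by
    rw [ex, ← Complex.exp_pi_mul_I]; push_cast; ring_nf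
  obtain rfl | rfl : t = 0 ∨ t = 1 := by omega
  · simp [hadBasis, Nat.testBit_lt_two_pow hv, h1]
  · have h4 : (v + 2 ^ m) ^^^ 2 ^ m = v := by rw [← h1]; simp
    simp only [hadBasis, ket₂_snd, one_mul, h2, h4, update_ket₂_snd, Nat.cast_one, h3]
    rw [add_comm]; simp [neg_div]

theorem xorLabel_move_up {a b j m x v : ℕ} (hab : a ≠ b) (h11 : σ 11 = 2 ^ m) (h12 : σ 12 = 2 ^ j)
    (hv : v < 2 ^ m) :
    xorLabel σ b (qu a / cl 12 * cl 11) (ket₂ a b x v) = ket₂ a b x (v + x / 2 ^ j * 2 ^ m) := by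
  simp [xorLabel, h11, h12, ket₂_fst hab, xor_mul_two_pow hv]

theorem xorLabel_clear {a b j m y v t : ℕ} (hab : a ≠ b) (h11 : σ 11 = 2 ^ m) (h12 : σ 12 = 2 ^ j)
    (hv : v < 2 ^ m) (hy : y < 2 ^ j) :
    xorLabel σ a (qu b / cl 11 * cl 12) (ket₂ a b (y + t * 2 ^ j) (v + t * 2 ^ m)) =
      ket₂ a b y (v + t * 2 ^ m) := by
  have h1 : (v + t * 2 ^ m) / 2 ^ m = t := by
    rw [Nat.add_mul_div_right _ _ (by positivity), Nat.div_eq_of_lt hv, zero_add]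
  have h2 : (y + t * 2 ^ j) ^^^ t * 2 ^ j = y := by rw [← xor_mul_two_pow hy]; simp
  simp [xorLabel, h11, h12, ket₂_fst hab, update_ket₂_fst hab, h1, h2]

theorem phaseBasis_eq (σ : Store) (e : Expr (ℕ ⊕ ℕ)) (k : ℕ) (b : Store) :
    phaseBasis σ e k b = Finsupp.single b (ex (e.eval (Sum.elim σ b) / 2 ^ k)) := by
  rw [phaseBasis, ex]; congr 2; push_cast; ring

theorem applyBasis_sum_single {ι : Type*} (U : Store → QState) (s : Finset ι) (b : ι → Store)
    (α : ι → ℂ) :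
    applyBasis U (∑ i ∈ s, Finsupp.single (b i) (α i)) = ∑ i ∈ s, α i • U (b i) := by
  simp [applyBasis_sum, applyBasis_single]

/-- What a command leaves unchanged: the registers outside `S`.  The others stay bounded. -/
structure Frame (B : ℕ) (S : Finset ℕ) (σ σ' : Store) : Prop where
  size_le : ∀ i, Nat.size (σ' i) ≤ B
  eq : ∀ i ∉ S, σ' i = σ i

theorem Frame.update {S : Finset ℕ} {σ σ' : Store} (h : Frame B S σ σ') {i a : ℕ} (hi : i ∈ S)
    (ha : Nat.size a ≤ B) : Frame B S σ (Function.update σ' i a) where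
  size_le := size_update_le h.size_le i ha
  eq k hk := by
    have : k ≠ i := fun h' => hk (h' ▸ hi)
    simpa [this] using h.eq k hk

theorem Frame.refl {σ : Store} (h : ∀ i, Nat.size (σ i) ≤ B) (S : Finset ℕ) : Frame B S σ σ :=
  ⟨h, fun _ _ => rfl⟩

theorem Frame.trans {S S' : Finset ℕ} {σ σ' σ'' : Store} (h : Frame B S σ σ')
    (h' : Frame B S' σ' σ'') (hS : S ⊆ S') : Frame B S' σ σ'' :=
  ⟨h'.size_le, fun i hi => (h'.eq i hi).trans (h.eq i fun hi' => hi (hS hi'))⟩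

/-- One iteration of the Fourier transform. -/
theorem Det.qftStep {a b q m : ℕ} {α : ℕ → ℂ} (hab : a ≠ b) (hB : 1 ≤ B) (hq : q + 1 ≤ B)
    (hσ : ∀ i, Nat.size (σ i) ≤ B) (h2 : σ 2 = q) (h10 : σ 10 = m) (h11 : σ 11 = 2 ^ m)
    (h12 : σ 12 = 2 ^ q / 2 ^ (m + 1)) (hm : m < q) :
    Det O B L (qftStep a b) σ (qftState a b q m α) fun σ' ψ' =>
      Frame B {10, 11, 12} σ σ' ∧ σ' 10 = m + 1 ∧ σ' 11 = 2 ^ (m + 1) ∧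
        σ' 12 = 2 ^ q / 2 ^ (m + 2) ∧ ψ' = qftState a b q (m + 1) α := by
  obtain ⟨j, rfl⟩ : ∃ j, q = j + 1 + m := ⟨q - 1 - m, by omega⟩
  have h12' : σ 12 = 2 ^ j := by
    rw [h12, show j + 1 + m = j + (m + 1) by ring, pow_add, Nat.mul_div_cancel _ (by positivity)]
  set Q := 2 ^ (j + 1 + m) with hQ
  have hjm : j + 1 + m - m = j + 1 := by omega
  have hmj : j + 1 + m - (m + 1) = j := by omega
  have hpj : 2 ^ (j + 1) ≤ Q := Nat.pow_le_pow_right (by norm_num) (by omega)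
  have hpj' : 2 ^ j ≤ Q := Nat.pow_le_pow_right (by norm_num) (by omega)
  have hpm : 2 ^ (m + 1) ≤ Q := Nat.pow_le_pow_right (by norm_num) (by omega)
  have hsz : ∀ {x}, x < Q → Nat.size x ≤ B := fun h => size_le_of_lt_two_pow h (by omega)
  -- the top bit and the rest of what is left of `x`
  set t : ℕ → ℕ := fun x => x % 2 ^ (j + 1) / 2 ^ j with ht
  set y : ℕ → ℕ := fun x => x % 2 ^ j with hy
  have ht2 : ∀ x, t x < 2 := fun x => by
    rw [ht]; exact Nat.div_lt_of_lt_mul (by rw [← pow_succ]; exact Nat.mod_lt _ (by positivity))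
  have hyt : ∀ x, x % 2 ^ (j + 1) = y x + t x * 2 ^ j := fun x => by
    have h1 : x % 2 ^ (j + 1) % 2 ^ j = x % 2 ^ j := Nat.mod_mod_of_dvd _ (pow_dvd_pow 2 (by omega))
    have h2 := Nat.mod_add_div (x % 2 ^ (j + 1)) (2 ^ j)
    rw [h1] at h2
    rw [← h2, mul_comm]
  have hylt : ∀ x, y x < 2 ^ j := fun x => Nat.mod_lt _ (by positivity)
  have hvt : ∀ {x v}, v < 2 ^ m → v + t x * 2 ^ m < Q := fun {x v} hv => by
    have : t x * 2 ^ m ≤ 1 * 2 ^ m := Nat.mul_le_mul_right _ (by have := ht2 x; omega)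
    rw [pow_succ] at hpm; omega
  set C : ℕ → ℕ → ℂ := fun x v =>
    ((Real.sqrt 2 : ℝ) : ℂ)⁻¹ ^ m * ex ((x : ℝ) * v / 2 ^ (j + 1 + m)) * α x
  have hψ : qftState a b (j + 1 + m) m α = ∑ x ∈ Finset.range Q, ∑ v ∈ Finset.range (2 ^ m),
      Finsupp.single (ket₂ a b (x % 2 ^ (j + 1)) v) (C x v) := by rw [qftState, hjm]
  have hb0 : QBounded B (qftState a b (j + 1 + m) m α) := by
    rw [hψ]
    refine .sum fun x _ => .sum fun v hv => .single (size_ket₂_le (hsz ?_) (hsz ?_) _ _) _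
    · exact (Nat.mod_lt _ (by positivity)).trans_le hpj
    · have := Finset.mem_range.mp hv
      rw [pow_succ] at hpm; omega
  refine Det.qxor_seq (ψ' := ∑ x ∈ Finset.range Q,
    ∑ v ∈ Finset.range (2 ^ m),
      Finsupp.single (ket₂ a b (x % 2 ^ (j + 1)) (v + t x * 2 ^ m)) (C x v))
    ⟨hB, hσ, hb0⟩ ?_ ?_
  · rw [hψ, applyBasis_sum]
    refine Finset.sum_congr rfl fun x _ => ?_
    rw [applyBasis_sum_single]
    refine Finset.sum_congr rfl fun v hv => ?_
    rw [xorLabel_move_up hab h11 h12' (Finset.mem_range.mp hv), Finsupp.smul_single_one]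
  refine Det.qxor_seq (ψ' := ∑ x ∈ Finset.range Q,
    ∑ v ∈ Finset.range (2 ^ m), Finsupp.single (ket₂ a b (y x) (v + t x * 2 ^ m)) (C x v))
    ⟨hB, hσ, ?_⟩ ?_ ?_
  · refine QBounded.sum fun x _ => .sum fun v hv => .single (size_ket₂_le (hsz ?_) (hsz ?_) _ _) _
    · exact (Nat.mod_lt _ (by positivity)).trans_le hpj
    · exact hvt (Finset.mem_range.mp hv)
  · rw [applyBasis_sum]
    refine Finset.sum_congr rfl fun x _ => ?_
    rw [applyBasis_sum_single]
    refine Finset.sum_congr rfl fun v hv => ?_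
    rw [hyt, xorLabel_clear hab h11 h12' (Finset.mem_range.mp hv) (hylt x), Finsupp.smul_single_one]
  refine Det.had_seq (ψ' := ∑ x ∈ Finset.range Q,
    ∑ v ∈ Finset.range (2 ^ m),
      (Finsupp.single (ket₂ a b (y x) v) (C x v * ((Real.sqrt 2 : ℝ) : ℂ)⁻¹) +
        Finsupp.single (ket₂ a b (y x) (v + 2 ^ m))
          (C x v * (((Real.sqrt 2 : ℝ) : ℂ)⁻¹ * ex (t x / 2)))))
    ⟨hB, hσ, ?_⟩ ?_ ?_ ?_
  · refine QBounded.sum fun x _ => .sum fun v hv => .single (size_ket₂_le (hsz ?_) (hsz ?_) _ _) _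
    · exact (hylt x).trans_le hpj'
    · exact hvt (Finset.mem_range.mp hv)
  · simp only [Expr.eval_var, h10]; omega
  · rw [applyBasis_sum]
    refine Finset.sum_congr rfl fun x _ => ?_
    rw [applyBasis_sum_single]
    refine Finset.sum_congr rfl fun v hv => ?_
    rw [Expr.eval_var, h10, hadBasis_ket₂ (Finset.mem_range.mp hv) (ht2 x), smul_add,
      Finsupp.smul_single, Finsupp.smul_single, smul_eq_mul, smul_eq_mul]
  have hb : ∀ {x v}, v ∈ Finset.range (2 ^ m) → ∀ c c' : ℂ,
      QBounded B (Finsupp.single (ket₂ a b (y x) v) c +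
        Finsupp.single (ket₂ a b (y x) (v + 2 ^ m)) c') := by
    intro x v hv c c'
    have hv' := Finset.mem_range.mp hv
    rw [pow_succ] at hpm
    exact .add (.single (size_ket₂_le (hsz ((hylt x).trans_le hpj')) (hsz (by omega)) _ _) _)
      (.single (size_ket₂_le (hsz ((hylt x).trans_le hpj')) (hsz (by omega)) _ _) _)
  refine Det.phase_seq (ψ' := qftState a b (j + 1 + m) (m + 1) α)
    ⟨hB, hσ, QBounded.sum fun x _ => .sum fun v hv => hb hv _ _⟩ ?_ ?_ ?_
  · simp only [Expr.eval_sub, Expr.eval_var, h10, h2]; omega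
  · rw [qftState, applyBasis_sum, hmj]
    refine Finset.sum_congr rfl fun x _ => ?_
    rw [applyBasis_sum, pow_succ 2 m, mul_two, Finset.sum_range_add, ← Finset.sum_add_distrib]
    refine Finset.sum_congr rfl fun v hv => ?_
    have hv' := Finset.mem_range.mp hv
    have hk : Expr.eval σ (reg 2 - reg 10) = j + 1 := by
      rw [Expr.eval_sub, Expr.eval_var, Expr.eval_var, h2, h10, hjm]
    have hadd : ∀ ψ₁ ψ₂ : QState, ∀ U, applyBasis U (ψ₁ + ψ₂) = applyBasis U ψ₁ + applyBasis U ψ₂ :=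
      fun ψ₁ ψ₂ U => by simp [applyBasis]
    rw [hadd, applyBasis_single, applyBasis_single, phaseBasis_eq, phaseBasis_eq, hk]
    have e1 : (qu b / cl 11 * qu a).eval (Sum.elim σ (ket₂ a b (y x) v)) = 0 := by
      simp [h11, Nat.div_eq_of_lt hv']
    have e2 : (qu b / cl 11 * qu a).eval (Sum.elim σ (ket₂ a b (y x) (v + 2 ^ m))) = y x := by
      simp [h11, Nat.div_eq_of_lt hv', ket₂_fst hab]
    rw [e1, e2, add_comm (2 ^ m) v, Finsupp.smul_single, Finsupp.smul_single]
    congr 2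
    · simp only [C, Nat.cast_zero, zero_div, ex_zero, smul_eq_mul, mul_one, pow_succ]; ring
    · -- the phases of the new bit: `x * 2 ^ m / 2 ^ q` is `t / 2 + y / 2 ^ (j + 1)` modulo `1`
      have hx : (x : ℝ) = 2 ^ (j + 1) * ((x / 2 ^ (j + 1) : ℕ) : ℝ) + (y x + t x * 2 ^ j) := by
        have := Nat.div_add_mod x (2 ^ (j + 1))
        rw [hyt] at this
        exact_mod_cast this.symm
      have hph : ex ((x : ℝ) * (v + 2 ^ m : ℕ) / 2 ^ (j + 1 + m)) =
          ex ((x : ℝ) * v / 2 ^ (j + 1 + m)) * (ex (t x / 2) * ex (y x / 2 ^ (j + 1))) := by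
        rw [← ex_add, ← ex_add, ← ex_add_int (_ + _) ((x / 2 ^ (j + 1) : ℕ) : ℤ)]
        congr 1
        have h3 : (x : ℝ) * (v + 2 ^ m : ℕ) / 2 ^ (j + 1 + m) =
            (x : ℝ) * v / 2 ^ (j + 1 + m) + x / 2 ^ (j + 1) := by
          push_cast; field_simp; ring
        rw [h3]
        nth_rewrite 2 [hx]
        rw [Int.cast_natCast, pow_succ]
        field_simp; ring
      simp only [C, hph, smul_eq_mul, pow_succ]; ring
  have hq' : QBounded B (qftState a b (j + 1 + m) (m + 1) α) := by
    refine QBounded.sum fun x _ => .sum fun v hv => .single (size_ket₂_le (hsz ?_) (hsz ?_) _ _) _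
    · rw [hmj]; exact (hylt x).trans_le hpj'
    · exact (Finset.mem_range.mp hv).trans_le hpm
  have f0 := Frame.refl hσ {10, 11, 12}
  refine Det.assign_seq ⟨hB, hσ, hq'⟩ ?_
  have hm1 : m + 1 < 2 ^ (j + 1 + m) := lt_of_le_of_lt (by omega) Nat.lt_two_pow_self
  have f1 := f0.update (i := 10) (a := (reg 10 + .const 1).eval σ) (by simp)
    (hsz (by simpa [h10] using hm1))
  refine Det.assign_seq ⟨hB, f1.size_le, hq'⟩ ?_
  have f2 := f1.update (i := 11) (a := 2 ^ (m + 1)) (by simp)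
    (size_le_of_lt_two_pow (q := m + 2) (Nat.pow_lt_pow_right (by norm_num) (by omega)) (by omega))
  have e11 : (reg 11 * .const 2).eval (Function.update σ 10 ((reg 10 + .const 1).eval σ)) =
      2 ^ (m + 1) := by simp [h11, pow_succ]
  rw [e11]
  refine Det.assign ⟨hB, f2.size_le, hq'⟩ ⟨f2.update (by simp) ?_, ?_, ?_, ?_, rfl⟩
  · simp only [Expr.eval_div, Expr.eval_var, Expr.eval_const]
    exact (Nat.size_le_size (Nat.div_le_self _ _)).trans (f2.size_le 12)
  · simp [h10]
  · simp
  · simp [h12, Nat.div_div_eq_div_mul, pow_succ]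

/-- The program for the Fourier transform maps the superposition with amplitudes `α` in register `a`
to the one with amplitudes `ft (2 ^ q) α` in register `b`. -/
theorem Det.qft {a b q : ℕ} {α : ℕ → ℂ} (hab : a ≠ b) (hB : 1 ≤ B) (hq : q + 1 ≤ B) (hL : q ≤ L)
    (hσ : ∀ i, Nat.size (σ i) ≤ B) (h2 : σ 2 = q) (h3 : σ 3 = 2 ^ q) :
    Det O B L (qft a b) σ (regState a (2 ^ q) α) fun σ' ψ' =>
      Frame B {10, 11, 12} σ σ' ∧ ψ' = regState b (2 ^ q) (ft (2 ^ q) α) := by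
  rw [← qftState_zero hab, ← qftState_last (a := a)]
  have hq0 : QBounded B (qftState a b q 0 α) := by
    rw [qftState_zero hab]; exact .regState (by omega) _ _
  have f0 := Frame.refl hσ {10, 11, 12}
  refine Det.assign_seq ⟨hB, hσ, hq0⟩ ?_
  have f1 := f0.update (i := 10) (a := 0) (by simp) (by simp)
  refine Det.assign_seq ⟨hB, f1.size_le, hq0⟩ ?_
  have f2 := f1.update (i := 11) (a := 1) (by simp) (by simpa using hB)
  refine Det.assign_seq ⟨hB, f2.size_le, hq0⟩ ?_
  have f3 := f2.update (i := 12) (a := 2 ^ q / 2) (by simp)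
    ((Nat.size_le_size (Nat.div_le_self _ _)).trans (by rw [← h3]; exact hσ 3))
  refine (Det.loop (fun m σ' ψ' => m ≤ q ∧ Frame B {10, 11, 12} σ σ' ∧ σ' 10 = m ∧ σ' 11 = 2 ^ m ∧
    σ' 12 = 2 ^ q / 2 ^ (m + 1) ∧ ψ' = qftState a b q m α) ?_ ?_ ?_).mono ?_
  · refine ⟨by omega, ?_, by simp, by simp, by simp [h3], rfl⟩
    simpa [h3] using f3
  · rintro m σ' _ ⟨hm, hf, -, -, -, rfl⟩
    refine ⟨hB, hf.size_le, QBounded.sum fun x hx => .sum fun v hv =>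
      .single (size_ket₂_le ?_ ?_ _ _) _⟩
    · exact size_le_of_lt_two_pow ((Nat.mod_lt _ (by positivity)).trans_le
        (Nat.pow_le_pow_right (by norm_num) (Nat.sub_le q m))) (by omega)
    · exact size_le_of_lt_two_pow (Finset.mem_range.mp hv) (by omega)
  · rintro m σ' _ ⟨hm, hf, h10, h11, h12, rfl⟩ he
    have h2' : σ' 2 = q := by rw [hf.eq 2 (by simp), h2]
    simp only [Expr.eval_sub, Expr.eval_var, h2', h10] at he
    refine ⟨by omega, (Det.qftStep hab hB hq hf.size_le h2' h10 h11 h12 (by omega)).mono ?_⟩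
    rintro σ'' ψ'' ⟨hf', h⟩
    exact ⟨by omega, hf.trans hf' (by simp), h⟩
  · rintro σ' _ ⟨m, ⟨hm, hf, h10, -, -, rfl⟩, he⟩
    have h2' : σ' 2 = q := by rw [hf.eq 2 (by simp), h2]
    simp only [Expr.eval_sub, Expr.eval_var, h2', h10] at he
    obtain rfl : m = q := by omega
    exact ⟨hf, rfl⟩

/-! ### Oracle queries and measurements -/

theorem phaseCode_lt (k : ℕ) (z : ℂ) : phaseCode k z < 2 ^ (k + 1) := by
  rw [phaseCode]
  split_ifs with h
  · positivity
  · have : ⌊(2 : ℝ) ^ k * Int.fract (Complex.arg z / (2 * Real.pi))⌋₊ < 2 ^ k := by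
      rw [Nat.floor_lt (mul_nonneg (by positivity) (Int.fract_nonneg _))]
      push_cast
      exact mul_lt_of_lt_one_right (by positivity) (Int.fract_lt_one _)
    rw [pow_succ]; omega

/-- The approximation with `k` bits of precision to a number of modulus one; zero is sent to `1`. -/
noncomputable def approxPhase (k : ℕ) (z : ℂ) : ℂ := ex (phaseCode k z / 2 ^ k)

/-- Multiply the amplitude of a basis state by the (approximate) value of the black box `o` at `e`;
register `1` is used as work space. -/
def phaseOracle (o : Fin 2) (e : Expr (ℕ ⊕ ℕ)) : Cmd :=
  .query o 1 e (reg 2) ;; .phase (qu 1) (reg 2) ;; .query o 1 e (reg 2)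

theorem queryLabel_ket {g : ℤ → ℂ} {j k x y : ℕ} {e : Expr (ℕ ⊕ ℕ)} (hj : j ≠ 1) :
    queryLabel g σ 1 e k (ket₂ j 1 x y) =
      ket₂ j 1 x (y ^^^ phaseCode k (g (e.eval (Sum.elim σ (ket j x)) : ℕ))) := by
  simp [queryLabel, ket₂_zero hj]

/-- Two queries, with a phase gate in between, multiply the amplitude of each `x` by the approximate
value of the black box and leave the auxiliary register `1` clean. -/
theorem Det.phaseOracle {o : Fin 2} {j q : ℕ} {e : Expr (ℕ ⊕ ℕ)} {α : ℕ → ℂ} (hj : j ≠ 1)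
    (hB : 1 ≤ B) (hq : q + 1 ≤ B) (hσ : ∀ i, Nat.size (σ i) ≤ B) (h2 : σ 2 = q) :
    Det O B L (phaseOracle o e) σ (regState j (2 ^ q) α) fun σ' ψ' => σ' = σ ∧
      ψ' = regState j (2 ^ q)
        fun x => approxPhase q (O o (e.eval (Sum.elim σ (ket j x)) : ℕ)) * α x := by
  set w : ℕ → ℕ := fun x => phaseCode q (O o (e.eval (Sum.elim σ (ket j x)) : ℕ)) with hw
  have hb : ∀ α : ℕ → ℂ, QBounded B
      (∑ x ∈ Finset.range (2 ^ q), Finsupp.single (ket₂ j 1 x (w x)) (α x)) := fun α =>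
    .sum fun x hx => .single (size_ket₂_le
      (size_le_of_lt_two_pow (Finset.mem_range.mp hx) (by omega))
      (size_le_of_lt_two_pow (phaseCode_lt _ _) hq) _ _) _
  have hk : (reg 2).eval σ = q := h2
  refine Det.query_seq
    (ψ' := ∑ x ∈ Finset.range (2 ^ q), Finsupp.single (ket₂ j 1 x (w x)) (α x))
    ⟨hB, hσ, QBounded.regState (by omega) _ _⟩ (by omega) ?_ ?_
  · rw [regState, applyBasis_sum_single]
    refine Finset.sum_congr rfl fun x _ => ?_
    rw [← ket₂_zero hj, queryLabel_ket hj, hk, Nat.zero_xor, Finsupp.smul_single_one]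
  refine Det.phase_seq (ψ' := ∑ x ∈ Finset.range (2 ^ q), Finsupp.single (ket₂ j 1 x (w x))
    (approxPhase q (O o (e.eval (Sum.elim σ (ket j x)) : ℕ)) * α x))
    ⟨hB, hσ, hb _⟩ (by omega) ?_ ?_
  · rw [applyBasis_sum_single]
    refine Finset.sum_congr rfl fun x _ => ?_
    rw [phaseBasis_eq, hk, Finsupp.smul_single, smul_eq_mul, mul_comm]
    simp [approxPhase, hw]
  refine Det.query ⟨hB, hσ, hb _⟩ (by omega) ⟨rfl, ?_⟩
  rw [regState, applyBasis_sum_single]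
  refine Finset.sum_congr rfl fun x _ => ?_
  rw [queryLabel_ket hj, hk, Nat.xor_self, Finsupp.smul_single_one, ket₂_zero hj]

/-- Measure register `j`, store the outcome in the classical register `i`, and reset register `j`
to zero. -/
def sample (j i : ℕ) : Cmd := .measure j i ;; .qxor j (cl i)

theorem xorLabel_reset {i j x : ℕ} (hi : σ i = x) : xorLabel σ j (cl i) (ket j x) = 0 := by
  rw [← ket_zero j]; simp [xorLabel, hi, ket]

theorem xorLabel_reset_snd {i j k x y : ℕ} (hi : σ i = y) :
    xorLabel σ j (cl i) (ket₂ k j x y) = ket₂ k j x 0 := by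
  rw [xorLabel, Expr.eval_var, Sum.elim_inl, hi, ket₂_snd, Nat.xor_self, update_ket₂_snd]

theorem filter_regState {j Q : ℕ} {β : ℕ → ℂ} (P : Store → Prop) [DecidablePred P] :
    (regState j Q β).filter P =
      ∑ x ∈ Finset.range Q, Finsupp.single (ket j x) (if P (ket j x) then β x else 0) := by
  rw [regState, Finsupp.filter_sum]
  refine Finset.sum_congr rfl fun x _ => ?_
  split_ifs with h
  · rw [Finsupp.filter_single_of_pos _ h]
  · rw [Finsupp.filter_single_of_neg _ h, Finsupp.single_zero]

theorem regState_apply {j Q x : ℕ} (hx : x < Q) (β : ℕ → ℂ) : regState j Q β (ket j x) = β x := by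
  rw [regState, Finsupp.finsetSum_apply, Finset.sum_eq_single x]
  · simp
  · intro y _ hy
    exact Finsupp.single_eq_of_ne fun h => hy (ket_injective j h).symm
  · exact fun h => absurd (Finset.mem_range.mpr hx) h

theorem mem_support_regState {j Q : ℕ} {β : ℕ → ℂ} {b : Store}
    (hb : b ∈ (regState j Q β).support) : ∃ x < Q, β x ≠ 0 ∧ b = ket j x := by
  classical
  obtain ⟨x, hx, hb'⟩ := Finset.mem_biUnion.mp (Finsupp.support_finsetSum hb)
  have h := Finset.mem_singleton.mp (Finsupp.support_single_subset hb')
  subst h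
  refine ⟨x, Finset.mem_range.mp hx, ?_, rfl⟩
  simpa using hb'

theorem image_support_regState (j Q : ℕ) (β : ℕ → ℂ) :
    (regState j Q β).support.image (fun b => b j) = (Finset.range Q).filter fun x => β x ≠ 0 := by
  ext x
  simp only [Finset.mem_image, Finset.mem_filter, Finset.mem_range]
  constructor
  · rintro ⟨b, hb, rfl⟩
    obtain ⟨x, hx, hx', rfl⟩ := mem_support_regState hb
    simpa using ⟨hx, hx'⟩
  · rintro ⟨hx, hx'⟩
    exact ⟨ket j x, by simpa [regState_apply hx] using hx', by simp⟩

/-- Sampling from a register yields `x` with probability `‖β x‖ ^ 2`. -/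
theorem Ens.sample {j i q : ℕ} {β : ℕ → ℂ} (g : Store → ℝ) (hB : 1 ≤ B) (hq : q ≤ B)
    (hσ : ∀ i, Nat.size (σ i) ≤ B) :
    Ens O B L (sample j i) σ (regState j (2 ^ q) β)
      (fun σ' ψ' => ∃ x < 2 ^ q, ∃ α : ℂ, α ≠ 0 ∧ σ' = Function.update σ i x ∧
        ψ' = Finsupp.single 0 α)
      (fun σ' ψ' => g σ' * normSq ψ')
      (∑ x ∈ Finset.range (2 ^ q), g (Function.update σ i x) * ‖β x‖ ^ 2) := by
  set Q := 2 ^ q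
  have hb : QBounded B (regState j Q β) := .regState hq _ _
  have hf : ∀ x < Q, (regState j Q β).filter (fun b => b j = x) =
      Finsupp.single (ket j x) (β x) := by
    intro x hx
    rw [filter_regState, Finset.sum_eq_single x]
    · simp
    · intro y _ hy; simp [hy]
    · exact fun h => absurd (Finset.mem_range.mpr hx) h
  refine Ens.seq ((Ens.measure (W := fun σ' ψ' => g σ' * normSq ψ')
    (Post := fun σ' ψ' => ∃ x < Q, β x ≠ 0 ∧ σ' = Function.update σ i x ∧
      ψ' = Finsupp.single (ket j x) (β x)) ⟨hB, hσ, hb⟩ ?_).mono (fun _ _ h => ⟨h, le_rfl⟩)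
      (le_of_eq ?_)) ?_
  · rw [image_support_regState]
    intro x hx
    have hx' := Finset.mem_filter.mp hx
    exact ⟨x, Finset.mem_range.mp hx'.1, hx'.2, rfl, hf x (Finset.mem_range.mp hx'.1)⟩
  · rw [image_support_regState, Finset.sum_filter]
    refine Finset.sum_congr rfl fun x hx => ?_
    rw [hf x (Finset.mem_range.mp hx), normSq_single]
    by_cases h : β x = 0 <;> simp [h]
  · rintro σ' ψ' ⟨x, hx, hβ, rfl, rfl⟩
    have hsx : Nat.size x ≤ B := size_le_of_lt_two_pow hx hq
    refine Det.ens (Det.qxor (Post := fun σ' ψ' => σ' = Function.update σ i x ∧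
      ψ' = Finsupp.single 0 (β x)) ⟨hB, size_update_le hσ i hsx,
        QBounded.single (size_ket_le hsx j) _⟩ ⟨rfl, ?_⟩) ?_
    · rw [applyBasis_single, xorLabel_reset (by simp), Finsupp.smul_single_one]
    · rintro _ _ ⟨rfl, rfl⟩
      exact ⟨⟨x, hx, β x, hβ, rfl, rfl⟩, by simp⟩

/-- Measure whether the black box `0` vanishes at the content of register `0`: the outcome, `1` for
a nonzero value, is stored in the classical register `6`. -/
def flag : Cmd := .query 0 1 (qu 0) (.const 0) ;; .measure 1 6 ;; .qxor 1 (cl 6)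

theorem phaseCode_zero (z : ℂ) : phaseCode 0 z = if z = 0 then 0 else 1 := by
  rw [phaseCode]
  split_ifs with h
  · rfl
  · have : ⌊(2 : ℝ) ^ 0 * Int.fract (Complex.arg z / (2 * Real.pi))⌋₊ = 0 := by
      rw [Nat.floor_eq_zero, pow_zero, one_mul]; exact Int.fract_lt_one _
    rw [this]; rfl

/-- The state after the measurement is the part of the superposition on which the outcome `c` is the
right one. The payoff `r c` has to vanish for an outcome that does not occur, as it has no branch.
-/
theorem Ens.flag {q : ℕ} {α : ℕ → ℂ} (r : ℕ → ℝ) (hB : 1 ≤ B) (hq : q ≤ B)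
    (hσ : ∀ i, Nat.size (σ i) ≤ B)
    (hr : ∀ c < 2, (∀ x < 2 ^ q, (if O 0 (x : ℕ) = 0 then 0 else 1) = c → α x = 0) → r c = 0) :
    Ens O B L flag σ (regState 0 (2 ^ q) α)
      (fun σ' ψ' => ∃ c < 2, σ' = Function.update σ 6 c ∧ ψ' = regState 0 (2 ^ q)
        fun x => if (if O 0 (x : ℕ) = 0 then 0 else 1) = c then α x else 0)
      (fun σ' _ => r (σ' 6)) (r 0 + r 1) := by
  set Q := 2 ^ q
  set w : ℕ → ℕ := fun x => if O 0 (x : ℕ) = 0 then 0 else 1 with hw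
  have hw2 : ∀ x, w x < 2 := fun x => by rw [hw]; dsimp only; split_ifs <;> norm_num
  set ψ₁ : QState := ∑ x ∈ Finset.range Q, Finsupp.single (ket₂ 0 1 x (w x)) (α x) with hψ₁
  have hsx : ∀ {x}, x ∈ Finset.range Q → Nat.size x ≤ B := fun hx =>
    size_le_of_lt_two_pow (Finset.mem_range.mp hx) hq
  have hs1 : ∀ {c}, c < 2 → Nat.size c ≤ B := fun {c} hc =>
    size_le_of_lt_two_pow (q := 1) (by omega) hB
  have hb₁ : QBounded B ψ₁ :=
    .sum fun x hx => .single (size_ket₂_le (hsx hx) (hs1 (hw2 x)) _ _) _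
  refine Det.seq_ens (Det.query (Post := fun σ' ψ' => σ' = σ ∧ ψ' = ψ₁)
    ⟨hB, hσ, QBounded.regState hq _ _⟩ (by simp) ⟨rfl, ?_⟩) ?_
  · rw [regState, applyBasis_sum_single]
    refine Finset.sum_congr rfl fun x _ => ?_
    rw [← ket₂_zero (show 0 ≠ 1 by norm_num), queryLabel_ket (by norm_num), Expr.eval_const,
      phaseCode_zero, Nat.zero_xor, Finsupp.smul_single_one]
    simp [hw]
  rintro _ _ ⟨hσ', rfl⟩
  rw [hσ']
  have hfil : ∀ c, ψ₁.filter (fun b => b 1 = c) = ∑ x ∈ Finset.range Q,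
      Finsupp.single (ket₂ 0 1 x c) (if w x = c then α x else 0) := by
    intro c
    rw [hψ₁, Finsupp.filter_sum]
    refine Finset.sum_congr rfl fun x _ => ?_
    split_ifs with h
    · rw [Finsupp.filter_single_of_pos _ (by simpa using h), h]
    · rw [Finsupp.filter_single_of_neg _ (by simpa using h), Finsupp.single_zero]
  have himg : ψ₁.support.image (fun b => b 1) ⊆ Finset.range 2 := by
    classical
    intro c hc
    obtain ⟨b, hb, rfl⟩ := Finset.mem_image.mp hc
    obtain ⟨x, -, hb'⟩ := Finset.mem_biUnion.mp (Finsupp.support_finsetSum hb)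
    rw [Finset.mem_singleton.mp (Finsupp.support_single_subset hb')]
    simpa using hw2 x
  refine Ens.seq ((Ens.measure (W := fun σ' _ => r (σ' 6)) (Post := fun σ' ψ' => ∃ c < 2,
    σ' = Function.update σ 6 c ∧ ψ' = ∑ x ∈ Finset.range Q,
      Finsupp.single (ket₂ 0 1 x c) (if w x = c then α x else 0)) ⟨hB, hσ, hb₁⟩ ?_).mono
      (fun _ _ h => ⟨h, le_rfl⟩) (le_of_eq ?_)) ?_
  · exact fun c hc => ⟨c, Finset.mem_range.mp (himg hc), rfl, hfil c⟩
  · rw [Finset.sum_subset himg, Finset.sum_range_succ, Finset.sum_range_one]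
    · simp
    · intro c hc hc'
      rw [Function.update_self]
      refine hr c (Finset.mem_range.mp hc) fun x hx hxc => ?_
      by_contra hα
      refine hc' (Finset.mem_image.mpr ⟨ket₂ 0 1 x c, ?_, by simp⟩)
      rw [Finsupp.mem_support_iff, hψ₁, Finsupp.finsetSum_apply,
        Finset.sum_eq_single_of_mem x (Finset.mem_range.mpr hx)]
      · rw [show w x = c from hxc]; simpa using hα
      · intro y _ hy
        refine Finsupp.single_eq_of_ne fun h => hy ?_
        have := congrFun h 0
        rw [ket₂_fst (by norm_num), ket₂_fst (by norm_num)] at this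
        exact this.symm
  · rintro _ _ ⟨c, hc, rfl, rfl⟩
    refine Det.ens (Det.qxor (Post := fun σ' ψ' => σ' = Function.update σ 6 c ∧
      ψ' = regState 0 Q fun x => if w x = c then α x else 0)
      ⟨hB, size_update_le hσ 6 (hs1 hc), QBounded.sum fun x hx =>
        .single (size_ket₂_le (hsx hx) (hs1 hc) _ _) _⟩ ⟨rfl, ?_⟩) ?_
    · rw [regState, applyBasis_sum_single]
      refine Finset.sum_congr rfl fun x _ => ?_
      rw [Finsupp.smul_single_one]
      congr 1
      rw [xorLabel_reset_snd (by simp), ket₂_zero (by norm_num)]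
    · rintro _ _ ⟨rfl, rfl⟩
      exact ⟨⟨c, hc, rfl, rfl⟩, le_rfl⟩

/-- Compare the value of the black box `0` at `x` with that of the black box `1` at `x + t`, where
`x` and `t` are the contents of the classical registers `7` and `1`.  Register `9` becomes zero if
and only if the descriptions of the two values agree. -/
def compare : Cmd :=
  .query 0 1 (cl 7) (reg 2) ;; .query 1 1 (cl 7 + cl 1) (reg 2) ;; sample 1 9

theorem Det.compare {q : ℕ} {α : ℂ} (hα : α ≠ 0) (hB : 1 ≤ B) (hq : q + 1 ≤ B)
    (hσ : ∀ i, Nat.size (σ i) ≤ B) (h2 : σ 2 = q) :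
    Det O B L compare σ (Finsupp.single 0 α) fun σ' ψ' => ψ' = Finsupp.single 0 α ∧
      Frame B {9} σ σ' ∧ (σ' 9 = 0 ↔
        phaseCode q (O 0 (σ 7 : ℕ)) = phaseCode q (O 1 ((σ 7 + σ 1 : ℕ) : ℤ))) := by
  set a := phaseCode q (O 0 (σ 7 : ℕ)) with ha
  set b := phaseCode q (O 1 ((σ 7 + σ 1 : ℕ) : ℤ)) with hb
  have hk : (reg 2).eval σ = q := h2
  have hsa : Nat.size a ≤ B := size_le_of_lt_two_pow (phaseCode_lt _ _) hq
  have hsb : Nat.size (a ^^^ b) ≤ B :=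
    size_le_of_lt_two_pow (Nat.xor_lt_two_pow (phaseCode_lt _ _) (phaseCode_lt _ _)) hq
  refine Det.query_seq (ψ' := Finsupp.single (ket 1 a) α)
    ⟨hB, hσ, QBounded.single (by simp) _⟩ (by omega) ?_ ?_
  · rw [applyBasis_single, Finsupp.smul_single_one, hk]
    simp [queryLabel, ket, ha]
  refine Det.query_seq (ψ' := Finsupp.single (ket 1 (a ^^^ b)) α)
    ⟨hB, hσ, QBounded.single (size_ket_le hsa 1) _⟩ (by omega) ?_ ?_
  · rw [applyBasis_single, Finsupp.smul_single_one, hk]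
    simp [queryLabel, ket, hb]
  have hσ' := size_update_le hσ 9 hsb
  refine Det.seq (Det.measure_single (Post := fun σ' ψ' => σ' = Function.update σ 9 (a ^^^ b) ∧
    ψ' = _) hα ⟨hB, hσ, QBounded.single (size_ket_le hsb 1) _⟩ ⟨by simp, rfl⟩) ?_
  rintro _ _ ⟨rfl, rfl⟩
  refine Det.qxor ⟨hB, hσ', QBounded.single (size_ket_le hsb 1) _⟩ ⟨?_, ?_, ?_⟩
  · rw [applyBasis_single, xorLabel_reset (by simp), Finsupp.smul_single_one]
  · exact (Frame.refl hσ {9}).update (by simp) hsb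
  · simp

end Executions

/-! ### Exponential sums and the finite Fourier transform -/

theorem norm_ex_sub_one (θ : ℝ) : ‖ex θ - 1‖ = 2 * |Real.sin (Real.pi * θ)| := by
  have : ex θ = Complex.exp (Complex.I * ((2 * Real.pi * θ : ℝ) : ℂ)) := by
    rw [ex]; push_cast; ring_nf
  rw [this, Complex.norm_exp_I_mul_ofReal_sub_one, norm_mul, Real.norm_eq_abs, Real.norm_eq_abs,
    abs_of_pos (by norm_num : (0 : ℝ) < 2), show 2 * Real.pi * θ / 2 = Real.pi * θ by ring]

theorem norm_ex_sub_ex_le (a b : ℝ) : ‖ex a - ex b‖ ≤ 2 * Real.pi * |a - b| := by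
  have : ex a - ex b = ex b * (ex (a - b) - 1) := by
    rw [mul_sub, ← ex_add, mul_one]; ring_nf
  rw [this, norm_mul, norm_ex, one_mul, norm_ex_sub_one, mul_assoc]
  gcongr
  refine (Real.abs_sin_le_abs).trans_eq ?_
  rw [abs_mul, abs_of_pos Real.pi_pos]

theorem le_norm_ex_sub_one {θ η : ℝ} (hη : ∀ n : ℤ, η ≤ |θ - n|) : 4 * η ≤ ‖ex θ - 1‖ := by
  set r := θ - round θ with hr
  have h1 : ex θ = ex r := by
    rw [← ex_add_int r (round θ), hr, sub_add_cancel]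
  have h2 : |r| ≤ 1 / 2 := abs_sub_round θ
  have h3 : |Real.pi * r| ≤ Real.pi / 2 := by
    rw [abs_mul, abs_of_pos Real.pi_pos]
    nlinarith [Real.pi_pos]
  have h4 := Real.mul_abs_le_abs_sin h3
  rw [abs_mul Real.pi, abs_of_pos Real.pi_pos, ← mul_assoc, div_mul_cancel₀ _ Real.pi_ne_zero] at h4
  rw [h1, norm_ex_sub_one]
  have h5 := hη (round θ)
  linarith

theorem ex_nat_mul (n : ℕ) (θ : ℝ) : ex (n * θ) = ex θ ^ n := by
  rw [ex, ex, ← Complex.exp_nat_mul]; push_cast; ring_nf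

theorem norm_sum_ex_le {θ η : ℝ} (h0 : 0 < η) (hη : ∀ n : ℤ, η ≤ |θ - n|) (Q : ℕ) :
    ‖∑ x ∈ Finset.range Q, ex (x * θ)‖ ≤ 1 / (2 * η) := by
  have h1 := le_norm_ex_sub_one hη
  have h2 : ex θ - 1 ≠ 0 := by
    rw [← norm_pos_iff]; linarith
  simp only [ex_nat_mul]
  rw [geom_sum_eq (sub_ne_zero.mp h2), norm_div]
  have h3 : ‖ex θ ^ Q - 1‖ ≤ 2 := by
    refine (norm_sub_le _ _).trans ?_
    rw [norm_pow, norm_ex, one_pow, norm_one]; norm_num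
  rw [div_le_div_iff₀ (by linarith) (by linarith)]
  nlinarith

theorem norm_sum_ex_le_card (θ : ℝ) (Q : ℕ) : ‖∑ x ∈ Finset.range Q, ex (x * θ)‖ ≤ Q := by
  refine (norm_sum_le _ _).trans ?_
  simp

theorem sum_ex_mul_div {Q : ℕ} (hQ : 0 < Q) (k : ℤ) :
    ∑ v ∈ Finset.range Q, ex (v * (k / Q)) = if (Q : ℤ) ∣ k then (Q : ℂ) else 0 := by
  have hQ' : (Q : ℝ) ≠ 0 := by positivity
  simp only [ex_nat_mul]
  split_ifs with h
  · obtain ⟨m, rfl⟩ := h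
    have : ex (((Q * m : ℤ) : ℝ) / Q) = 1 := by
      push_cast
      rw [mul_div_cancel_left₀ _ hQ', ex_intCast]
    rw [this]; simp
  · have h1 : ex (k / Q) ≠ 1 := by
      intro h1
      rw [ex, Complex.exp_eq_one_iff] at h1
      obtain ⟨n, hn⟩ := h1
      apply h
      refine ⟨n, ?_⟩
      have h2 : ((k : ℝ) / Q : ℝ) = n := by
        have h3 : (2 * (Real.pi : ℂ) * Complex.I) ≠ 0 := Complex.two_pi_I_ne_zero
        rw [mul_comm, mul_left_inj' h3] at hn
        exact_mod_cast hn
      rw [div_eq_iff hQ'] at h2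
      have : (k : ℝ) = ((Q * n : ℤ) : ℝ) := by rw [h2]; push_cast; ring
      exact_mod_cast this
    rw [geom_sum_eq h1, ← ex_nat_mul, mul_div_cancel₀ _ hQ', ex_intCast, sub_self, zero_div]

theorem conj_ex (θ : ℝ) : (starRingEnd ℂ) (ex θ) = ex (-θ) := by
  rw [ex, ex, ← Complex.exp_conj]
  simp only [map_mul, Complex.conj_I, Complex.conj_ofReal, map_ofNat]
  push_cast; ring_nf

theorem ft_sub (Q : ℕ) (a b : ℕ → ℂ) (v : ℕ) :
    ft Q (fun x => a x - b x) v = ft Q a v - ft Q b v := by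
  simp only [ft, mul_sub, Finset.sum_sub_distrib]

theorem ft_const_mul (Q : ℕ) (c : ℂ) (a : ℕ → ℂ) (v : ℕ) :
    ft Q (fun x => c * a x) v = c * ft Q a v := by
  simp only [ft, Finset.mul_sum]
  exact Finset.sum_congr rfl fun x _ => by ring

theorem ft_congr {Q : ℕ} {a b : ℕ → ℂ} (h : ∀ x < Q, a x = b x) (v : ℕ) : ft Q a v = ft Q b v := by
  rw [ft, ft, Finset.sum_congr rfl fun x hx => by rw [h x (Finset.mem_range.mp hx)]]

theorem inv_sqrt_mul_inv_sqrt (Q : ℕ) :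
    ((Real.sqrt Q : ℝ) : ℂ)⁻¹ * ((Real.sqrt Q : ℝ) : ℂ)⁻¹ = (Q : ℂ)⁻¹ := by
  rw [← mul_inv, ← Complex.ofReal_mul, Real.mul_self_sqrt (Nat.cast_nonneg Q),
    Complex.ofReal_natCast]

/-- Parseval's identity. -/
theorem sum_norm_ft_sq {Q : ℕ} (hQ : 0 < Q) (a : ℕ → ℂ) :
    ∑ v ∈ Finset.range Q, ‖ft Q a v‖ ^ 2 = ∑ x ∈ Finset.range Q, ‖a x‖ ^ 2 := by
  have hQ' : (Q : ℂ) ≠ 0 := by exact_mod_cast hQ.ne'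
  have h : ∀ v, ((‖ft Q a v‖ ^ 2 : ℝ) : ℂ) = (Q : ℂ)⁻¹ * ∑ x ∈ Finset.range Q,
      ∑ y ∈ Finset.range Q, (starRingEnd ℂ) (a x) * a y * ex (v * (((y : ℤ) - x : ℤ) / Q)) := by
    intro v
    push_cast
    rw [← Complex.conj_mul', ft, map_mul, map_inv₀, Complex.conj_ofReal, map_sum, mul_mul_mul_comm,
      inv_sqrt_mul_inv_sqrt, Finset.sum_mul_sum]
    congr 1
    refine Finset.sum_congr rfl fun x _ => Finset.sum_congr rfl fun y _ => ?_
    rw [map_mul, conj_ex, show (v : ℝ) * (((y : ℝ) - x) / Q) =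
      -((x : ℝ) * v / Q) + y * v / Q by ring,
      ex_add]
    ring
  have h2 : ((∑ v ∈ Finset.range Q, ‖ft Q a v‖ ^ 2 : ℝ) : ℂ) =
      ((∑ x ∈ Finset.range Q, ‖a x‖ ^ 2 : ℝ) : ℂ) := by
    rw [Complex.ofReal_sum, Finset.sum_congr rfl fun v _ => h v, ← Finset.mul_sum, Finset.sum_comm,
      Complex.ofReal_sum, Finset.mul_sum]
    refine Finset.sum_congr rfl fun x hx => ?_
    rw [Finset.sum_comm, Finset.sum_eq_single_of_mem x hx]
    · rw [← Finset.mul_sum, sum_ex_mul_div hQ, if_pos (by simp), Complex.conj_mul']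
      push_cast; field_simp
    · intro y hy hyx
      rw [← Finset.mul_sum, sum_ex_mul_div hQ, if_neg, mul_zero]
      intro hdvd
      have h1 := Finset.mem_range.mp hx
      have h2 := Finset.mem_range.mp hy
      have h3 := Int.eq_zero_of_abs_lt_dvd hdvd (by rw [abs_lt]; omega)
      omega
  exact_mod_cast h2

theorem sum_norm_ft_sq_le {Q : ℕ} (hQ : 0 < Q) (a : ℕ → ℂ) (S : Finset ℕ)
    (hS : S ⊆ Finset.range Q) :
    ∑ v ∈ S, ‖ft Q a v‖ ^ 2 ≤ ∑ x ∈ Finset.range Q, ‖a x‖ ^ 2 := by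
  rw [← sum_norm_ft_sq hQ]
  exact Finset.sum_le_sum_of_subset_of_nonneg hS fun _ _ _ => by positivity

/-- The Fourier transform is its own inverse up to a reflection. -/
theorem ft_ft {Q : ℕ} (hQ : 0 < Q) (a : ℕ → ℂ) {z : ℕ} (hz : 0 < z) (hzQ : z < Q) :
    ft Q (ft Q a) z = a (Q - z) := by
  have hQ' : (Q : ℂ) ≠ 0 := by exact_mod_cast hQ.ne'
  have : ft Q (ft Q a) z = (Q : ℂ)⁻¹ * ∑ x ∈ Finset.range Q, a x *
      ∑ v ∈ Finset.range Q, ex (v * (((x : ℤ) + z : ℤ) / Q)) := by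
    rw [ft]
    simp only [ft, Finset.mul_sum]
    rw [Finset.sum_comm]
    refine Finset.sum_congr rfl fun x _ => Finset.sum_congr rfl fun v _ => ?_
    rw [← inv_sqrt_mul_inv_sqrt]
    push_cast
    rw [show (v : ℝ) * (((x : ℝ) + z) / Q) = v * z / Q + x * v / Q by ring, ex_add]
    ring
  rw [this, Finset.sum_eq_single_of_mem (Q - z) (Finset.mem_range.mpr (by omega))]
  · rw [sum_ex_mul_div hQ, if_pos ⟨1, by omega⟩]; field_simp
  · intro x hx hxz
    have h1 := Finset.mem_range.mp hx
    rw [sum_ex_mul_div hQ, if_neg, mul_zero]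
    rintro ⟨k, hk⟩
    have h2 : k < 2 := by nlinarith
    have h3 : 0 < k := by nlinarith
    obtain rfl : k = 1 := by omega
    omega

theorem norm_approxPhase (k : ℕ) (z : ℂ) : ‖approxPhase k z‖ = 1 := norm_ex _

/-- Truncating the argument of a number of modulus one to `k` binary digits changes the number by at
most `2π / 2 ^ k`. -/
theorem norm_approxPhase_sub_le (k : ℕ) {z : ℂ} (hz : ‖z‖ = 1) :
    ‖approxPhase k z - z‖ ≤ 2 * Real.pi / 2 ^ k := by
  have hz0 : z ≠ 0 := by rw [← norm_pos_iff, hz]; norm_num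
  set θ := Int.fract (Complex.arg z / (2 * Real.pi)) with hθ
  have h0 : 0 ≤ θ := Int.fract_nonneg _
  have h1 : z = ex θ := by
    have : ex θ = ex (Complex.arg z / (2 * Real.pi)) := by
      rw [← ex_add_int θ ⌊Complex.arg z / (2 * Real.pi)⌋, hθ, Int.fract_add_floor]
    rw [this, ex]
    have h2 : 2 * (Real.pi : ℂ) * Complex.I * ((Complex.arg z / (2 * Real.pi) : ℝ) : ℂ) =
        Complex.arg z * Complex.I := by
      have := Complex.ofReal_ne_zero.mpr Real.pi_ne_zero
      push_cast; field_simp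
    rw [h2]
    have := Complex.norm_mul_exp_arg_mul_I z
    rw [hz] at this
    simpa using this.symm
  have h2 : approxPhase k z = ex (⌊(2 : ℝ) ^ k * θ⌋₊ / 2 ^ k) := by
    rw [approxPhase, phaseCode, if_neg hz0, Nat.cast_add, Nat.cast_pow, Nat.cast_two, add_div,
      div_self (by positivity), add_comm]
    exact_mod_cast ex_add_int _ 1
  rw [h2]
  conv_lhs => rw [h1]
  refine (norm_ex_sub_ex_le _ _).trans ?_
  rw [show 2 * Real.pi / 2 ^ k = 2 * Real.pi * (1 / 2 ^ k) by ring]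
  refine mul_le_mul_of_nonneg_left ?_ (by positivity)
  have h3 := Nat.floor_le (mul_nonneg (by positivity : (0 : ℝ) ≤ 2 ^ k) h0)
  have h4 := Nat.lt_floor_add_one ((2 : ℝ) ^ k * θ)
  rw [abs_le]
  have hk : (0 : ℝ) < 2 ^ k := by positivity
  constructor
  · rw [← sub_nonneg]
    have : (⌊(2 : ℝ) ^ k * θ⌋₊ : ℝ) / 2 ^ k - θ - -(1 / 2 ^ k) =
      ((⌊(2 : ℝ) ^ k * θ⌋₊ : ℝ) + 1 - 2 ^ k * θ) / 2 ^ k := by field_simp; ring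
    rw [this]; apply div_nonneg <;> linarith
  · rw [← sub_nonneg]
    have : 1 / 2 ^ k - ((⌊(2 : ℝ) ^ k * θ⌋₊ : ℝ) / 2 ^ k - θ) =
      (1 + 2 ^ k * θ - (⌊(2 : ℝ) ^ k * θ⌋₊ : ℝ)) / 2 ^ k := by field_simp; ring
    rw [this]; apply div_nonneg <;> linarith

/-- A periodic nonnegative function has its full weight on each complete period. -/
theorem mul_sum_le_sum_of_periodic {ℓ : ℕ} {h : ℕ → ℝ} (h0 : ∀ x, 0 ≤ h x)
    (hper : ∀ x, h (x + ℓ) = h x) (Q : ℕ) :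
    ((Q / ℓ : ℕ) : ℝ) * ∑ x ∈ Finset.range ℓ, h x ≤ ∑ x ∈ Finset.range Q, h x := by
  have h1 : ∀ k, ∑ x ∈ Finset.range (k * ℓ), h x = k * ∑ x ∈ Finset.range ℓ, h x := by
    intro k
    induction k with
    | zero => simp
    | succ k ih =>
        have h2 : ∀ k x, h (k * ℓ + x) = h x := by
          intro k x
          induction k with
          | zero => simp
          | succ k ih => rw [← ih, ← hper (k * ℓ + x)]; congr 1; ring
        rw [add_mul, one_mul, Finset.sum_range_add, ih, Finset.sum_congr rfl fun x _ => h2 k x]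
        push_cast; ring
  rw [← h1]
  exact Finset.sum_le_sum_of_subset_of_nonneg
    (Finset.range_subset_range.mpr (Nat.div_mul_le_self Q ℓ)) fun x _ _ => h0 x

/-- The product is smallest for `S = {2, …, k + 1}`, when it telescopes to `1 / (k + 1)`. -/
theorem inv_card_add_one_le_prod (S : Finset ℕ) (hS : ∀ p ∈ S, 2 ≤ p) :
    ((S.card : ℝ) + 1)⁻¹ ≤ ∏ p ∈ S, (1 - (p : ℝ)⁻¹) := by
  induction S using Finset.induction_on_max with
  | empty => simp
  | insert m S hm ih =>
      have hmS : m ∉ S := fun h => lt_irrefl _ (hm m h)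
      have ih := ih fun p hp => hS p (Finset.mem_insert_of_mem hp)
      rw [Finset.prod_insert hmS, Finset.card_insert_of_notMem hmS]
      -- the largest element is at least `#S + 2`, as all elements are at least `2`
      have hcard : S.card + 2 ≤ m := by
        have hm2 := hS m (Finset.mem_insert_self _ _)
        have : S ⊆ Finset.Ico 2 m := fun p hp =>
          Finset.mem_Ico.mpr ⟨hS p (Finset.mem_insert_of_mem hp), hm p hp⟩
        have := Finset.card_le_card this
        rw [Nat.card_Ico] at this; omega
      have hc : ((S.card : ℝ) + 2) ≤ m := by exact_mod_cast hcard
      have h1 : (m : ℝ)⁻¹ ≤ ((S.card : ℝ) + 2)⁻¹ := inv_anti₀ (by positivity) hc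
      have h2 : (((S.card + 1 : ℕ) : ℝ) + 1)⁻¹ =
          (1 - ((S.card : ℝ) + 2)⁻¹) * ((S.card : ℝ) + 1)⁻¹ := by
        push_cast; field_simp; ring
      rw [h2]
      have h3 : 0 ≤ 1 - ((S.card : ℝ) + 2)⁻¹ := by
        rw [sub_nonneg]
        exact inv_le_one_of_one_le₀ (by linarith [(Nat.cast_nonneg S.card : (0:ℝ) ≤ _)])
      exact mul_le_mul (by linarith) ih (by positivity) (by linarith)

/-- The proportion of units modulo `ℓ` is at least inversely logarithmic. -/
theorem inv_le_totient_div {ℓ q : ℕ} (hℓ : 0 < ℓ) (hq : ℓ < 2 ^ q) :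
    (q : ℝ)⁻¹ ≤ (Nat.totient ℓ : ℝ) / ℓ := by
  have h1 : (Nat.totient ℓ : ℝ) = ℓ * ∏ p ∈ ℓ.primeFactors, (1 - (p : ℝ)⁻¹) := by
    have := Nat.totient_eq_mul_prod_factors ℓ
    have h2 : ((Nat.totient ℓ : ℚ) : ℝ) =
        ((ℓ * ∏ p ∈ ℓ.primeFactors, (1 - (p : ℚ)⁻¹) : ℚ) : ℝ) := by
      rw [this]
    push_cast at h2
    exact h2
  rw [h1, mul_div_cancel_left₀ _ (by positivity)]
  refine le_trans ?_ (inv_card_add_one_le_prod _ fun p hp =>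
    (Nat.prime_of_mem_primeFactors hp).two_le)
  have h2 : 2 ^ ℓ.primeFactors.card ≤ ℓ := by
    calc 2 ^ ℓ.primeFactors.card = ∏ p ∈ ℓ.primeFactors, 2 := by simp
      _ ≤ ∏ p ∈ ℓ.primeFactors, p := Finset.prod_le_prod (by simp)
          fun p hp => (Nat.prime_of_mem_primeFactors hp).two_le
      _ ≤ ℓ := Nat.le_of_dvd hℓ (Nat.prod_primeFactors_dvd ℓ)
  have h3 : ℓ.primeFactors.card < q :=
    (Nat.pow_lt_pow_iff_right (by norm_num)).mp (h2.trans_lt hq)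
  exact inv_anti₀ (by positivity) (by exact_mod_cast h3)

/-! ### Primitive Dirichlet characters -/

/-- A completely nontrivial character has a conductor with the same prime factors as the modulus. -/
theorem CompletelyNontrivial.dvd_conductor {n : ℕ} (hn : 0 < n) {χ : DirichletCharacter ℂ n}
    (hχ : CompletelyNontrivial χ) {p : ℕ} (hp : p.Prime) (hpn : p ∣ n) : p ∣ χ.conductor := by
  obtain ⟨c, hc, hc1⟩ := hχ
  have hpm : p ∈ n.primeFactors := Nat.mem_primeFactors.mpr ⟨hp, hpn, hn.ne'⟩
  by_contra hpc
  set a := n.factorization p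
  set m := n / p ^ a with hm
  have hnm : n = p ^ a * m := (Nat.ordProj_mul_ordCompl_eq_self n p).symm
  have hcop : Nat.Coprime (p ^ a) m := Nat.Coprime.pow_left _ (Nat.coprime_ordCompl hp hn.ne')
  have hdvd : ∀ d, Nat.Coprime d p → d ∣ n → d ∣ m := fun d hd hdn =>
    (Nat.Coprime.pow_right a hd).dvd_of_dvd_mul_left (hnm ▸ hdn)
  have hcm : χ.conductor ∣ m :=
    hdvd _ ((Nat.Prime.coprime_iff_not_dvd hp).mpr hpc).symm χ.conductor_dvd_level
  refine hc1 p hpm (MulChar.ext fun u => ?_)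
  have : NeZero (p ^ a) := ⟨pow_ne_zero _ hp.ne_zero⟩
  -- by the Chinese remainder theorem there is `x` congruent to `u` at `p` and to `1` elsewhere
  obtain ⟨x, hx1, hx2⟩ := Nat.chineseRemainder hcop (u : ZMod (p ^ a)).val 1
  have hxu : ((x : ℤ) : ZMod (p ^ a)) = u := by
    rw [Int.cast_natCast, (ZMod.natCast_eq_natCast_iff _ _ _).mpr hx1, ZMod.natCast_zmod_val]
  have hx1' : ∀ d, d ∣ m → ((x : ℤ) : ZMod d) = 1 := fun d hd => by
    rw [Int.cast_natCast, (ZMod.natCast_eq_natCast_iff _ _ _).mpr (hx2.of_dvd hd), Nat.cast_one]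
  have hxn : IsCoprime (x : ℤ) (n : ℤ) := by
    rw [Nat.isCoprime_iff_coprime, hnm, Nat.coprime_mul_iff_right]
    constructor
    · rw [← ZMod.isUnit_iff_coprime, ← Int.cast_natCast, hxu]; exact u.isUnit
    · rw [Nat.coprime_iff_gcd_eq_one, hx2.gcd_eq, Nat.gcd_one_left]
  have h1 : χ ((x : ℤ) : ZMod n) = 1 := by
    rw [← χ.primitiveCharacter_apply_of_isCoprime hxn, hx1' _ hcm, map_one]
  rw [hc, Finset.prod_eq_single_of_mem p hpm, hxu] at h1
  · rw [h1, MulChar.one_apply_coe]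
  · intro r hr hrp
    have hr' := Nat.mem_primeFactors.mp hr
    rw [hx1', map_one]
    exact hdvd _ (Nat.Coprime.pow_left _ ((Nat.coprime_primes hr'.1 hp).mpr hrp))
      (Nat.ordProj_dvd n r)

/-- As a function on the integers, a completely nontrivial character is a primitive character. -/
theorem CompletelyNontrivial.eq_primitiveCharacter {n : ℕ} (hn : 0 < n)
    {χ : DirichletCharacter ℂ n} (hχ : CompletelyNontrivial χ) (x : ℤ) :
    χ (x : ZMod n) = χ.primitiveCharacter (x : ZMod χ.conductor) := by
  by_cases hx : IsCoprime x (n : ℤ)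
  · rw [χ.primitiveCharacter_apply_of_isCoprime hx]
  · rw [(χ.apply_eq_zero_iff x).mpr hx, eq_comm, DirichletCharacter.apply_eq_zero_iff]
    intro h
    apply hx
    rw [Int.isCoprime_iff_gcd_eq_one] at h ⊢
    change Nat.Coprime x.natAbs n
    by_contra hcop
    obtain ⟨p, hp, hpx, hpn⟩ := Nat.Prime.not_coprime_iff_dvd.mp hcop
    exact Nat.Prime.not_coprime_iff_dvd.mpr ⟨p, hp, hpx, hχ.dvd_conductor hn hp hpn⟩ h

theorem IsPeriodOf.dvd {f : ℤ → ℂ} {ℓ : ℕ} (h : IsPeriodOf f ℓ) {d : ℤ}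
    (hd : ∀ x, f (x + d) = f x) : (ℓ : ℤ) ∣ d := by
  obtain ⟨⟨h0, h1⟩, h2⟩ := h
  have h3 : ∀ (k : ℤ) x, f (x + k * ℓ) = f x := by
    intro k
    induction k using Int.induction_on with
    | zero => simp
    | succ k ih => intro x; rw [add_mul, one_mul, ← add_assoc, h1, ih]
    | pred k ih =>
        intro x
        rw [sub_mul, one_mul, ← h1 (x + (-(k : ℤ) * ℓ - ℓ)),
          show x + (-(k : ℤ) * ℓ - ℓ) + ℓ = x + -(k : ℤ) * ℓ by ring, ih]
  have hℓ : (ℓ : ℤ) ≠ 0 := by exact_mod_cast h0.ne'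
  have hr := Int.emod_nonneg d hℓ
  have hr' := Int.emod_lt_of_pos d (by exact_mod_cast h0 : (0 : ℤ) < ℓ)
  rcases hr.eq_or_lt with h | h
  · exact Int.dvd_of_emod_eq_zero h.symm
  · have h4 : (d % ℓ).toNat ∈ {m : ℕ | 0 < m ∧ ∀ x : ℤ, f (x + m) = f x} := by
      refine ⟨by omega, fun x => ?_⟩
      rw [Int.toNat_of_nonneg hr, ← h3 (d / ℓ), add_assoc, mul_comm, Int.emod_add_mul_ediv, hd]
    have := h2 h4
    omega

/-- The period of a shifted primitive character is its conductor. -/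
theorem eq_of_isPeriodOf {m : ℕ} [NeZero m] {χ : DirichletCharacter ℂ m} (hχ : χ.IsPrimitive)
    {s : ℤ} {f : ℤ → ℂ} (hf : ∀ x : ℤ, f x = χ ((x + s : ℤ) : ZMod m)) {ℓ : ℕ}
    (h : IsPeriodOf f ℓ) : ℓ = m := by
  have hdvd : ℓ ∣ m := by
    have : (ℓ : ℤ) ∣ (m : ℤ) := h.dvd fun x => by rw [hf, hf]; congr 1; push_cast; simp
    exact_mod_cast this
  refine le_antisymm (Nat.le_of_dvd (NeZero.pos m) hdvd) ?_
  have hfac : χ.FactorsThrough ℓ := by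
    rw [DirichletCharacter.factorsThrough_iff_ker_unitsMap hdvd]
    intro u hu
    rw [MonoidHom.mem_ker] at hu ⊢
    obtain ⟨k, hk⟩ : ∃ k : ℤ, ((u : ZMod m).val : ℤ) = 1 + ℓ * k := by
      have h1 : (((u : ZMod m).val : ℤ) : ZMod ℓ) = ((1 : ℤ) : ZMod ℓ) := by
        have h2 := congrArg Units.val hu
        rw [ZMod.unitsMap_def, Units.coe_map] at h2
        rw [Int.cast_natCast, Int.cast_one]
        simpa [ZMod.natCast_val] using h2
      obtain ⟨k, hk⟩ := (ZMod.intCast_eq_intCast_iff_dvd_sub _ _ _).mp h1.symm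
      exact ⟨k, by linarith⟩
    have h3 : ∀ k : ℤ, f (1 - s + ℓ * k) = f (1 - s) := by
      intro k
      induction k using Int.induction_on with
      | zero => simp
      | succ k ih => rw [mul_add, mul_one, ← add_assoc, h.1.2, ih]
      | pred k ih =>
          rw [← h.1.2 (1 - s + ℓ * (-(k : ℤ) - 1)),
            show 1 - s + ℓ * (-(k : ℤ) - 1) + ℓ = 1 - s + ℓ * -(k : ℤ) by ring, ih]
    have h4 := h3 k
    rw [hf, hf, show 1 - s + ℓ * k + s = 1 + ℓ * k by ring, show 1 - s + s = 1 by ring, ← hk,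
      Int.cast_natCast, ZMod.natCast_zmod_val, Int.cast_one, map_one] at h4
    ext
    rw [MulChar.coe_toUnitHom, h4, Units.val_one]
  calc m = χ.conductor := hχ.symm
    _ ≤ ℓ := Nat.sInf_le hfac

/-- The shifts that solve the problem form a residue class modulo the period. -/
theorem shift_iff {m : ℕ} {χ : DirichletCharacter ℂ m} {s : ℤ} {f : ℤ → ℂ}
    (hf : ∀ x : ℤ, f x = χ ((x + s : ℤ) : ZMod m)) (h : IsPeriodOf f m) (t : ℤ) :
    (∀ x : ℤ, f x = χ ((x + t : ℤ) : ZMod m)) ↔ t ≡ s [ZMOD m] := by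
  constructor
  · intro ht
    refine (Int.modEq_iff_dvd.mpr (h.dvd (d := t - s) fun x => ?_)).symm
    rw [hf, ht x]; congr 2; ring
  · intro ht x
    rw [hf]
    congr 1
    rw [ZMod.intCast_eq_intCast_iff]
    exact (ht.add_left x).symm

theorem conj_mulChar {ℓ : ℕ} {χ : DirichletCharacter ℂ ℓ} (a : ZMod ℓ) :
    (starRingEnd ℂ) (χ a) = χ⁻¹ a := by
  rw [← MulChar.star_apply', starRingEnd_apply]

/-! ### Gauss sums and correlations -/

section Gauss

variable {ℓ : ℕ} [NeZero ℓ] {χ : DirichletCharacter ℂ ℓ}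

local notation "𝐞" => (ZMod.stdAddChar : AddChar (ZMod ℓ) ℂ)

theorem conj_stdAddChar (a : ZMod ℓ) : (starRingEnd ℂ) (𝐞 a) = 𝐞 (-a) := by
  rw [AddChar.map_neg_eq_conj]

theorem inv_mul_self_apply (a : ZMod ℓ) : χ⁻¹ a * χ a = if IsUnit a then 1 else 0 := by
  rw [← MulChar.mul_apply, inv_mul_cancel]
  split_ifs with h
  · exact MulChar.one_apply h
  · exact MulChar.map_nonunit _ h

/-- The Fourier expansion of a primitive character. -/
theorem primitive_expansion (hχ : χ.IsPrimitive) (x : ZMod ℓ) :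
    (ℓ : ℂ) * χ x = gaussSum χ 𝐞 * ∑ a, χ⁻¹ a * 𝐞 (-(a * x)) := by
  have h1 : ∀ a, gaussSum χ 𝐞 * (χ⁻¹ a * 𝐞 (-(a * x))) = ∑ y, χ y * 𝐞 (a * (y - x)) := by
    intro a
    rw [← mul_assoc, mul_comm (gaussSum _ _), ← gaussSum_mulShift_of_isPrimitive 𝐞 hχ, gaussSum,
      Finset.sum_mul]
    refine Finset.sum_congr rfl fun y _ => ?_
    rw [AddChar.mulShift_apply, mul_assoc, ← AddChar.map_add_eq_mul]
    congr 2; ring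
  rw [Finset.mul_sum, Finset.sum_congr rfl fun a _ => h1 a, Finset.sum_comm]
  have h2 : ∀ y, ∑ a, χ y * 𝐞 (a * (y - x)) = if y = x then (ℓ : ℂ) * χ y else 0 := by
    intro y
    rw [← Finset.mul_sum, AddChar.sum_mulShift _ (ZMod.isPrimitive_stdAddChar ℓ)]
    simp only [sub_eq_zero, ZMod.card]
    split_ifs <;> simp [mul_comm]
  rw [Finset.sum_congr rfl fun y _ => h2 y]
  simp

theorem sum_inv_mul_stdAddChar (hχ : χ.IsPrimitive) (x : ZMod ℓ) :
    ∑ a, χ⁻¹ a * 𝐞 (-(a * x)) = χ x * (starRingEnd ℂ) (gaussSum χ 𝐞) := by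
  have h := gaussSum_mulShift_of_isPrimitive 𝐞 hχ x
  have h2 := congrArg (starRingEnd ℂ) h
  rw [map_mul, ← conj_mulChar, Complex.conj_conj] at h2
  rw [← h2, gaussSum, map_sum]
  refine Finset.sum_congr rfl fun a _ => ?_
  rw [map_mul, conj_mulChar, AddChar.mulShift_apply, conj_stdAddChar, mul_comm x a]

/-- The absolute value of a primitive Gauss sum. -/
theorem norm_gaussSum_sq (hχ : χ.IsPrimitive) : ‖gaussSum χ 𝐞‖ ^ 2 = ℓ := by
  have h := primitive_expansion hχ 1
  rw [sum_inv_mul_stdAddChar hχ, map_one, one_mul, mul_one, Complex.mul_conj'] at h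
  exact_mod_cast h.symm

theorem norm_mulChar_sq (a : ZMod ℓ) : ‖χ a‖ ^ 2 = if IsUnit a then 1 else 0 := by
  have h : ((‖χ a‖ ^ 2 : ℝ) : ℂ) = if IsUnit a then 1 else 0 := by
    rw [← inv_mul_self_apply (χ := χ), ← conj_mulChar, Complex.conj_mul']; push_cast; rfl
  split_ifs at h ⊢ <;> exact_mod_cast h

theorem sum_isUnit {M : Type*} [AddCommMonoid M] (g : ZMod ℓ → M) :
    ∑ a, (if IsUnit a then g a else 0) = ∑ u : (ZMod ℓ)ˣ, g u := by
  classical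
  rw [← Finset.sum_filter]
  refine (Finset.sum_bij (fun (u : (ZMod ℓ)ˣ) _ => (u : ZMod ℓ)) (by simp)
    (fun u _ v _ h => Units.ext h) (fun a ha => ?_) (fun _ _ => rfl)).symm
  obtain ⟨u, rfl⟩ := (Finset.mem_filter.mp ha).2
  exact ⟨u, Finset.mem_univ _, rfl⟩

theorem sum_norm_mulChar_sq : ∑ a, ‖χ a‖ ^ 2 = Nat.totient ℓ := by
  simp only [norm_mulChar_sq]
  rw [sum_isUnit (fun _ => (1 : ℝ))]
  simp [ZMod.card_units_eq_totient]

/-- The correlation of a primitive character with its shifts is a Ramanujan sum. -/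
theorem sum_shift_mul_conj (hχ : χ.IsPrimitive) (d : ZMod ℓ) :
    ∑ x, χ (x + d) * (starRingEnd ℂ) (χ x) = ∑ u : (ZMod ℓ)ˣ, 𝐞 (-(u * d)) := by
  have hℓ : (ℓ : ℂ) ≠ 0 := by exact_mod_cast NeZero.ne ℓ
  set G := gaussSum χ 𝐞
  have hG : G * (starRingEnd ℂ) G = ℓ := by
    rw [Complex.mul_conj']; exact_mod_cast norm_gaussSum_sq hχ
  have h1 : (ℓ : ℂ) * ∑ x, χ (x + d) * (starRingEnd ℂ) (χ x) =
      ℓ * ∑ u : (ZMod ℓ)ˣ, 𝐞 (-(u * d)) := by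
    calc (ℓ : ℂ) * ∑ x, χ (x + d) * (starRingEnd ℂ) (χ x)
        = ∑ x, ∑ a, G * (χ⁻¹ a * 𝐞 (-(a * d))) * (χ⁻¹ x * 𝐞 (-(x * a))) := by
          rw [Finset.mul_sum]
          refine Finset.sum_congr rfl fun x _ => ?_
          rw [← mul_assoc, primitive_expansion hχ, conj_mulChar, Finset.mul_sum, Finset.sum_mul]
          refine Finset.sum_congr rfl fun a _ => ?_
          rw [mul_add, neg_add, AddChar.map_add_eq_mul, mul_comm x a]; ring
      _ = ∑ a, ℓ * ((χ⁻¹ a * χ a) * 𝐞 (-(a * d))) := by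
          rw [Finset.sum_comm]
          refine Finset.sum_congr rfl fun a _ => ?_
          rw [← Finset.mul_sum, sum_inv_mul_stdAddChar hχ, ← hG]; ring
      _ = _ := by
          rw [← Finset.mul_sum, ← sum_isUnit (fun a => 𝐞 (-(a * d)))]
          congr 1
          refine Finset.sum_congr rfl fun a _ => ?_
          rw [inv_mul_self_apply]; split_ifs <;> simp
  exact mul_left_cancel₀ hℓ h1

end Gauss

/-! ### A lower bound for the distance between shifts -/

/-- The product of `1 - μ` over the primitive `r`-th roots of unity `μ` is an integer, hence at
least one in absolute value for `r ≠ 1`. -/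
theorem one_le_norm_prod_primitiveRoots {r : ℕ} (hr : 1 < r) :
    1 ≤ ‖∏ μ ∈ primitiveRoots r ℂ, (1 - μ)‖ := by
  have h1 : ∏ μ ∈ primitiveRoots r ℂ, (1 - μ) = (((Polynomial.cyclotomic r ℤ).eval 1 : ℤ) : ℂ) := by
    have h := Polynomial.eval_intCast_map (Int.castRingHom ℂ) (Polynomial.cyclotomic r ℤ) 1
    rw [Polynomial.map_cyclotomic, Polynomial.cyclotomic_eq_prod_X_sub_primitiveRoots
      (Complex.isPrimitiveRoot_exp r (by omega)), Polynomial.eval_prod] at h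
    simpa using h
  have h2 : (Polynomial.cyclotomic r ℤ).eval 1 ≠ 0 := by
    intro h
    rw [h, Int.cast_zero, Finset.prod_eq_zero_iff] at h1
    obtain ⟨μ, hμ, h3⟩ := h1
    have h4 := (mem_primitiveRoots (by omega)).mp hμ
    rw [← sub_eq_zero.mp h3] at h4
    have := IsPrimitiveRoot.one.unique h4
    omega
  rw [h1, Complex.norm_intCast]
  exact_mod_cast Int.one_le_abs h2

/-- By `1 + log x ≤ x`, the sum is at least `φ(r)` plus twice the logarithm of the product of all
`‖1 - μ‖`, and this product is at least one. -/
theorem totient_le_sum_primitiveRoots {r : ℕ} (hr : 1 < r) :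
    (Nat.totient r : ℝ) ≤ ∑ μ ∈ primitiveRoots r ℂ, ‖1 - μ‖ ^ 2 := by
  have h0 : ∀ μ ∈ primitiveRoots r ℂ, 0 < ‖1 - μ‖ := by
    intro μ hμ
    rw [norm_pos_iff, sub_ne_zero]
    rintro rfl
    have := IsPrimitiveRoot.one.unique ((mem_primitiveRoots (by omega)).mp hμ)
    omega
  -- apply `x ≥ 1 + log x` to each term
  have h1 : ∀ μ ∈ primitiveRoots r ℂ, 1 + 2 * Real.log ‖1 - μ‖ ≤ ‖1 - μ‖ ^ 2 := by
    intro μ hμ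
    have := Real.log_le_sub_one_of_pos (pow_pos (h0 μ hμ) 2)
    rw [Real.log_pow] at this
    push_cast at this; linarith
  refine le_trans ?_ (Finset.sum_le_sum h1)
  rw [Finset.sum_add_distrib, ← Finset.mul_sum, ← Real.log_prod fun μ hμ => (h0 μ hμ).ne',
    ← norm_prod]
  have h2 := Real.log_nonneg (one_le_norm_prod_primitiveRoots hr)
  have h3 : ∑ μ ∈ primitiveRoots r ℂ, (1 : ℝ) = Nat.totient r := by
    rw [Finset.sum_const, (Complex.isPrimitiveRoot_exp r (by omega)).card_primitiveRoots]; simp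
  linarith

theorem sum_comp_eq_of_surjective {G H : Type*} [Group G] [Fintype G] [Group H] [Fintype H]
    {φ : G →* H} (hφ : Function.Surjective φ) (g : H → ℝ) :
    ∑ u, g (φ u) = (Fintype.card G / Fintype.card H : ℝ) * ∑ w, g w := by
  classical
  set k := (Finset.univ.filter fun u => φ u = 1).card with hk
  have hfib : ∀ w, (Finset.univ.filter fun u => φ u = w).card = k := fun w =>
    MonoidHom.card_fiber_eq_of_mem_range φ (hφ w) (hφ 1)
  have h1 : ∀ g : H → ℝ, ∑ u, g (φ u) = k * ∑ w, g w := by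
    intro g
    rw [← Finset.sum_fiberwise_of_maps_to (g := φ) (t := Finset.univ)
      (fun _ _ => Finset.mem_univ _),
      Finset.mul_sum]
    refine Finset.sum_congr rfl fun w _ => ?_
    rw [Finset.sum_congr rfl (g := fun _ => g w) fun u hu => by rw [(Finset.mem_filter.mp hu).2],
      Finset.sum_const, hfib, nsmul_eq_mul]
  have h2 := h1 fun _ => 1
  simp only [Finset.sum_const, Finset.card_univ, nsmul_eq_mul, mul_one] at h2
  have h3 : (Fintype.card H : ℝ) ≠ 0 := by exact_mod_cast Fintype.card_ne_zero
  rw [h1, h2, mul_div_cancel_right₀ _ h3]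

variable {ℓ : ℕ} [NeZero ℓ] {χ : DirichletCharacter ℂ ℓ}

/-- With `r` the additive order of `d`, the sum runs over each primitive `r`-th root of unity
`φ(ℓ) / φ(r)` times. -/
theorem totient_le_sum_norm_one_sub {d : ZMod ℓ} (hd : d ≠ 0) :
    (Nat.totient ℓ : ℝ) ≤
      ∑ u : (ZMod ℓ)ˣ, ‖1 - (ZMod.stdAddChar ((u : ZMod ℓ) * d) : ℂ)‖ ^ 2 := by
  set ζ : ℂ := ZMod.stdAddChar d with hζ
  set r := orderOf ζ with hr
  have hpow : ∀ k : ℕ, ζ ^ k = ZMod.stdAddChar ((k : ZMod ℓ) * d) := fun k => by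
    rw [hζ, ← AddChar.map_nsmul_eq_pow, nsmul_eq_mul]
  have hrℓ : r ∣ ℓ := orderOf_dvd_of_pow_eq_one (by rw [hpow]; simp)
  have hr0 : 0 < r := Nat.pos_of_dvd_of_pos hrℓ (NeZero.pos ℓ)
  have : NeZero r := ⟨hr0.ne'⟩
  have hζ1 : ζ ≠ 1 := fun h =>
    hd (ZMod.injective_stdAddChar (by rw [← hζ, h, AddChar.map_zero_eq_one]))
  have hr1 : 1 < r := by
    rcases Nat.lt_or_ge 1 r with h | h
    · exact h
    · exact absurd (orderOf_eq_one_iff.mp (show orderOf ζ = 1 by omega)) hζ1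
  have hprim : IsPrimitiveRoot ζ r := IsPrimitiveRoot.orderOf ζ
  have h1 : ∀ u : (ZMod ℓ)ˣ, (ZMod.stdAddChar ((u : ZMod ℓ) * d) : ℂ) =
      ζ ^ (ZMod.unitsMap hrℓ u : ZMod r).val := by
    intro u
    have h2 : ((ZMod.unitsMap hrℓ u : (ZMod r)ˣ) : ZMod r).val = (u : ZMod ℓ).val % r := by
      rw [ZMod.unitsMap_def, Units.coe_map, ← ZMod.val_natCast, ZMod.natCast_val]; rfl
    rw [h2, hr, pow_mod_orderOf, hpow, ZMod.natCast_zmod_val]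
  have h3 : ∑ w : (ZMod r)ˣ, ‖1 - ζ ^ (w : ZMod r).val‖ ^ 2 =
      ∑ μ ∈ primitiveRoots r ℂ, ‖1 - μ‖ ^ 2 := by
    refine Finset.sum_bij (fun (w : (ZMod r)ˣ) _ => ζ ^ (w : ZMod r).val) ?_ ?_ ?_ fun _ _ => rfl
    · intro w _
      rw [mem_primitiveRoots hr0]
      exact hprim.pow_of_coprime _ (ZMod.val_coe_unit_coprime w)
    · intro w _ w' _ h
      exact Units.ext (ZMod.val_injective r (hprim.pow_inj (ZMod.val_lt _) (ZMod.val_lt _) h))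
    · intro μ hμ
      obtain ⟨i, hi, hc, rfl⟩ := hprim.isPrimitiveRoot_iff.mp ((mem_primitiveRoots hr0).mp hμ)
      exact ⟨ZMod.unitOfCoprime i hc, Finset.mem_univ _, by
        rw [ZMod.coe_unitOfCoprime, ZMod.val_natCast, Nat.mod_eq_of_lt hi]⟩
  have hr0' : (Nat.totient r : ℝ) ≠ 0 := by exact_mod_cast (Nat.totient_pos.mpr hr0).ne'
  simp only [h1]
  rw [sum_comp_eq_of_surjective (ZMod.unitsMap_surjective hrℓ)
    (fun w : (ZMod r)ˣ => ‖1 - ζ ^ (w : ZMod r).val‖ ^ 2), h3, ZMod.card_units_eq_totient,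
    ZMod.card_units_eq_totient]
  calc (Nat.totient ℓ : ℝ) = Nat.totient ℓ / Nat.totient r * Nat.totient r := by field_simp
    _ ≤ _ := by gcongr; exact totient_le_sum_primitiveRoots hr1

/-- A primitive character differs substantially from all of its nontrivial shifts. -/
theorem totient_le_sum_norm_shift_sub (hχ : χ.IsPrimitive) {d : ZMod ℓ} (hd : d ≠ 0) :
    (Nat.totient ℓ : ℝ) ≤ ∑ x, ‖χ (x + d) - χ x‖ ^ 2 := by
  have hexp : ∀ a b : ℂ, ‖a - b‖ ^ 2 = ‖a‖ ^ 2 + ‖b‖ ^ 2 - 2 * (a * (starRingEnd ℂ) b).re := by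
    intro a b
    simp only [← Complex.normSq_eq_norm_sq]
    rw [Complex.normSq_sub]
  have h1 : ∑ x, ‖χ (x + d)‖ ^ 2 = (Nat.totient ℓ : ℝ) := by
    rw [← sum_norm_mulChar_sq (χ := χ)]
    exact Fintype.sum_equiv (Equiv.addRight d) _ _ fun _ => rfl
  have h2 : ∑ u : (ZMod ℓ)ˣ, ‖(ZMod.stdAddChar ((u : ZMod ℓ) * -d) : ℂ)‖ ^ 2 = Nat.totient ℓ := by
    simp [ZMod.card_units_eq_totient]
  have h3 := totient_le_sum_norm_one_sub (neg_ne_zero.mpr hd)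
  have h4 := sum_shift_mul_conj hχ d
  simp only [hexp, Finset.sum_sub_distrib, Finset.sum_add_distrib, ← Finset.mul_sum,
    sum_norm_mulChar_sq, h1, ← Complex.re_sum, h4] at h3 ⊢
  simp only [h2, one_mul] at h3
  rw [← map_sum, Complex.conj_re] at h3
  simp only [mul_neg] at h3
  refine h3.trans (le_of_eq ?_)
  simp [ZMod.card_units_eq_totient]

/-! ### Fourier sampling of shifted primitive characters -/

theorem norm_sq_le_two_mul (a b : ℂ) : ‖a‖ ^ 2 ≤ 2 * ‖b‖ ^ 2 + 2 * ‖a - b‖ ^ 2 := by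
  have h1 : ‖a‖ ≤ ‖b‖ + ‖a - b‖ := by
    calc ‖a‖ = ‖b + (a - b)‖ := by ring_nf
      _ ≤ _ := norm_add_le _ _
  nlinarith [norm_nonneg a, sq_nonneg (‖b‖ - ‖a - b‖), norm_nonneg b, norm_nonneg (a - b)]

theorem sum_zmod_eq_sum_range {M : Type*} [AddCommMonoid M] {ℓ : ℕ} [NeZero ℓ] (g : ZMod ℓ → M) :
    ∑ a, g a = ∑ x ∈ Finset.range ℓ, g x :=
  Finset.sum_bij' (fun a _ => a.val) (fun x _ => (x : ZMod ℓ))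
    (fun a _ => Finset.mem_range.mpr (ZMod.val_lt a)) (fun _ _ => Finset.mem_univ _)
    (fun a _ => ZMod.natCast_zmod_val a)
    (fun x hx => ZMod.val_cast_of_lt (Finset.mem_range.mp hx))
    (fun a _ => by rw [ZMod.natCast_zmod_val])

/-- The normalised Dirichlet kernel, the response of the Fourier transform of order `Q` to a
frequency that differs by `θ`. -/
noncomputable def kern (Q : ℕ) (θ : ℝ) : ℂ := (Q : ℂ)⁻¹ * ∑ x ∈ Finset.range Q, ex (x * θ)

theorem norm_kern_le_one (Q : ℕ) (θ : ℝ) : ‖kern Q θ‖ ≤ 1 := by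
  rw [kern, norm_mul, norm_inv, Complex.norm_natCast]
  rcases Nat.eq_zero_or_pos Q with rfl | hQ
  · simp
  · rw [inv_mul_le_iff₀ (by positivity), mul_one]; exact norm_sum_ex_le_card θ Q

theorem norm_kern_le {Q : ℕ} {θ η : ℝ} (h0 : 0 < η) (hη : ∀ n : ℤ, η ≤ |θ - n|) :
    ‖kern Q θ‖ ≤ 1 / (2 * η * Q) := by
  rw [kern, norm_mul, norm_inv, Complex.norm_natCast]
  calc (Q : ℝ)⁻¹ * ‖∑ x ∈ Finset.range Q, ex (x * θ)‖ ≤ (Q : ℝ)⁻¹ * (1 / (2 * η)) := by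
        gcongr; exact norm_sum_ex_le h0 hη Q
    _ = 1 / (2 * η * Q) := by rw [one_div, one_div, mul_inv (2 * η)]; ring

section Sampling

variable {ℓ : ℕ} [NeZero ℓ] {χ : DirichletCharacter ℂ ℓ} {s : ℤ} {f : ℤ → ℂ} {N q : ℕ}

/-- The trigonometric polynomial of period `ℓ` with coefficients `c`. -/
noncomputable def trig (c : ZMod ℓ → ℂ) (x : ℕ) : ℂ := ∑ a, c a * ex (-((a.val : ℝ) * x / ℓ))

theorem ft_trig (c : ZMod ℓ → ℂ) (Q v : ℕ) :
    ft Q (fun x => ((Real.sqrt Q : ℝ) : ℂ)⁻¹ * trig c x) v =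
      ∑ a, c a * kern Q ((v : ℝ) / Q - (a.val : ℝ) / ℓ) := by
  simp only [ft, trig, kern, Finset.mul_sum]
  rw [Finset.sum_comm]
  refine Finset.sum_congr rfl fun a _ => Finset.sum_congr rfl fun x _ => ?_
  rw [← inv_sqrt_mul_inv_sqrt, show (x : ℝ) * ((v : ℝ) / Q - (a.val : ℝ) / ℓ) =
    x * v / Q + -((a.val : ℝ) * x / ℓ) by ring, ex_add]
  ring

theorem stdAddChar_eq_ex (j : ℤ) : (ZMod.stdAddChar (j : ZMod ℓ) : ℂ) = ex ((j : ℝ) / ℓ) := by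
  rw [ZMod.stdAddChar_coe, ex]; congr 1; push_cast; ring

theorem stdAddChar_neg_mul (a : ZMod ℓ) (x : ℕ) :
    (ZMod.stdAddChar (-(a * (x : ZMod ℓ))) : ℂ) = ex (-((a.val : ℝ) * x / ℓ)) := by
  have : -(a * (x : ZMod ℓ)) = ((-(a.val * x : ℤ) : ℤ) : ZMod ℓ) := by
    push_cast; rw [ZMod.natCast_zmod_val]
  rw [this, stdAddChar_eq_ex]; congr 1; push_cast; ring

/-- The Fourier coefficients of `x ↦ χ (x + s)`. -/
noncomputable def coeff (χ : DirichletCharacter ℂ ℓ) (s : ℤ) (a : ZMod ℓ) : ℂ :=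
  (ℓ : ℂ)⁻¹ * gaussSum χ ZMod.stdAddChar * (χ⁻¹ a * ZMod.stdAddChar (-(a * (s : ZMod ℓ))))

/-- A shifted primitive character is the trigonometric polynomial with coefficients proportional to
`χ⁻¹`, and hence supported on the units. -/
theorem eq_trig (hχ : χ.IsPrimitive) (hf : ∀ x : ℤ, f x = χ ((x + s : ℤ) : ZMod ℓ)) (x : ℕ) :
    f x = trig (coeff χ s) x := by
  have hℓ : (ℓ : ℂ) ≠ 0 := by exact_mod_cast NeZero.ne ℓ
  have h := primitive_expansion hχ ((x + s : ℤ) : ZMod ℓ)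
  rw [hf, trig, eq_comm, ← mul_right_inj' hℓ, h, Finset.mul_sum, Finset.mul_sum]
  refine Finset.sum_congr rfl fun a _ => ?_
  rw [coeff, ← stdAddChar_neg_mul, show -(a * ((x + s : ℤ) : ZMod ℓ)) =
    -(a * (s : ZMod ℓ)) + -(a * (x : ZMod ℓ)) by
    push_cast; ring, AddChar.map_add_eq_mul]
  field_simp

theorem norm_inv_mul_gaussSum_sq (hχ : χ.IsPrimitive) :
    ‖(ℓ : ℂ)⁻¹ * gaussSum χ ZMod.stdAddChar‖ ^ 2 = (ℓ : ℝ)⁻¹ := by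
  have hℓ : (ℓ : ℝ) ≠ 0 := by exact_mod_cast NeZero.ne ℓ
  rw [norm_mul, mul_pow, norm_gaussSum_sq hχ, norm_inv, Complex.norm_natCast]
  field_simp

theorem norm_coeff_le (hχ : χ.IsPrimitive) (a : ZMod ℓ) : ‖coeff χ s a‖ ≤ 1 := by
  have h1 : ‖(ℓ : ℂ)⁻¹ * gaussSum χ ZMod.stdAddChar‖ ≤ 1 := by
    rw [← sq_le_one_iff₀ (norm_nonneg _), norm_inv_mul_gaussSum_sq hχ]
    exact inv_le_one_of_one_le₀ (by exact_mod_cast NeZero.pos ℓ)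
  have h2 : ‖χ⁻¹ a‖ ≤ 1 := by
    rw [← sq_le_one_iff₀ (norm_nonneg _), norm_mulChar_sq]; split_ifs <;> norm_num
  rw [coeff, norm_mul, norm_mul (χ⁻¹ a), AddChar.norm_apply, mul_one]
  exact mul_le_one₀ h1 (norm_nonneg _) h2

theorem coeff_of_not_isUnit {a : ZMod ℓ} (ha : ¬ IsUnit a) : coeff χ s a = 0 := by
  rw [coeff, MulChar.map_nonunit _ ha]; ring

theorem norm_eq_one_of_ne_zero {y : ZMod ℓ} (h : χ y ≠ 0) : ‖χ y‖ = 1 := by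
  have h1 : IsUnit y := by
    by_contra h'
    exact h (MulChar.map_nonunit _ h')
  have h2 := norm_mulChar_sq (χ := χ) y
  rw [if_pos h1] at h2
  exact (pow_eq_one_iff_of_nonneg (norm_nonneg _) two_ne_zero).mp h2

/-- The amplitudes that a query with `q` bits of precision gives for the values of `f`. -/
noncomputable def approxValue (q : ℕ) (f : ℤ → ℂ) (x : ℕ) : ℂ :=
  if f x = 0 then 0 else approxPhase q (f x)

theorem norm_approxValue_sub_le (hf : ∀ x : ℤ, f x = χ ((x + s : ℤ) : ZMod ℓ)) (x : ℕ) :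
    ‖approxValue q f x - f x‖ ≤ 2 * Real.pi / 2 ^ q := by
  rw [approxValue]
  split_ifs with h
  · rw [h, sub_zero, norm_zero]; positivity
  · exact norm_approxPhase_sub_le q (by rw [hf] at h ⊢; exact norm_eq_one_of_ne_zero h)

theorem norm_approxValue_sq (x : ℕ) : ‖approxValue q f x‖ ^ 2 = if f x = 0 then 0 else 1 := by
  rw [approxValue]
  split_ifs with h
  · simp
  · rw [norm_approxPhase]; norm_num

theorem norm_inv_sqrt_sq (Q : ℕ) : ‖((Real.sqrt Q : ℝ) : ℂ)⁻¹‖ ^ 2 = (Q : ℝ)⁻¹ := by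
  rw [norm_inv, inv_pow, Complex.norm_real, Real.norm_eq_abs, sq_abs,
    Real.sq_sqrt (Nat.cast_nonneg Q)]

/-- The normalised state prepared from the values of `f`. -/
noncomputable def valueState (q : ℕ) (f : ℤ → ℂ) (x : ℕ) : ℂ :=
  ((Real.sqrt (2 ^ q : ℕ) : ℝ) : ℂ)⁻¹ * approxValue q f x

/-- Rounding the values of `f` to `q` bits of precision has little effect on the Fourier
transform. -/
theorem sum_norm_ft_valueState_sub_le (hf : ∀ x : ℤ, f x = χ ((x + s : ℤ) : ZMod ℓ))
    {S : Finset ℕ} (hS : S ⊆ Finset.range (2 ^ q)) :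
    ∑ v ∈ S, ‖ft (2 ^ q) (valueState q f) v -
      ft (2 ^ q) (fun x => ((Real.sqrt (2 ^ q : ℕ) : ℝ) : ℂ)⁻¹ * f x) v‖ ^ 2 ≤ 40 / 2 ^ q := by
  have hQ : 0 < 2 ^ q := by positivity
  simp only [← ft_sub]
  refine (sum_norm_ft_sq_le hQ _ S hS).trans ?_
  have h1 : ∀ x : ℕ, ‖valueState q f x - ((Real.sqrt (2 ^ q : ℕ) : ℝ) : ℂ)⁻¹ * f x‖ ^ 2 ≤
      ((2 ^ q : ℕ) : ℝ)⁻¹ * (40 / 2 ^ q) := by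
    intro x
    rw [valueState, ← mul_sub, norm_mul, mul_pow, norm_inv_sqrt_sq]
    gcongr
    refine (pow_le_pow_left₀ (norm_nonneg _) (norm_approxValue_sub_le hf x) 2).trans ?_
    rw [div_pow]
    have h2 : (2 * Real.pi) ^ 2 ≤ 40 := by nlinarith [Real.pi_pos, Real.pi_lt_d2]
    have h3 : (2 : ℝ) ^ q ≤ (2 ^ q) ^ 2 := by
      have : (1 : ℝ) ≤ 2 ^ q := one_le_pow₀ (by norm_num)
      nlinarith
    gcongr
  refine (Finset.sum_le_sum fun x _ => h1 x).trans (le_of_eq ?_)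
  rw [Finset.sum_const, Finset.card_range, nsmul_eq_mul]
  field_simp

/-- The outcome `v` of Fourier sampling of order `Q` lies so close to `w Q / ℓ`, for a `w` coprime
to `ℓ`, that it determines `ℓ ≤ N`. -/
def IsClose (N ℓ Q v : ℕ) : Prop :=
  ∃ w : ℤ, IsCoprime w (ℓ : ℤ) ∧ 8 * N * |(ℓ : ℤ) * v - w * Q| ≤ Q

theorem pow_div_le (hq : 1 ≤ q) (H : 2 ^ 20 * N ^ 6 * q ^ 2 ≤ 2 ^ q) :
    (N : ℝ) ^ 6 / 2 ^ q ≤ 1 / (2 ^ 20 * q ^ 2) := by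
  have h : ((2 ^ 20 * N ^ 6 * q ^ 2 : ℕ) : ℝ) ≤ ((2 ^ q : ℕ) : ℝ) := by exact_mod_cast H
  have hq' : (0 : ℝ) < q := by exact_mod_cast hq
  rw [div_le_div_iff₀ (by positivity) (by positivity)]
  push_cast at h
  linarith

open scoped Classical in
/-- Fourier sampling of the values of `f` rarely yields an outcome that is not close to `w Q / ℓ`
for a `w` coprime to `ℓ`. There the kernels of all frequencies are small, so that the transform is
at most `4 N ^ 3 / Q`, and the sum of at most `Q` squares is tiny. -/
theorem sum_not_isClose_le (hχ : χ.IsPrimitive) (hf : ∀ x : ℤ, f x = χ ((x + s : ℤ) : ZMod ℓ))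
    (hN : ℓ ≤ N) (hq : 1 ≤ q) (H : 2 ^ 20 * N ^ 6 * q ^ 2 ≤ 2 ^ q) :
    ∑ v ∈ (Finset.range (2 ^ q)).filter (fun v => ¬ IsClose N ℓ (2 ^ q) v),
      ‖ft (2 ^ q) (valueState q f) v‖ ^ 2 ≤ 1 / (400 * q) := by
  set Q := 2 ^ q with hQ
  set S := (Finset.range Q).filter fun v => ¬ IsClose N ℓ Q v with hS
  have hQ0 : (0 : ℝ) < Q := by positivity
  have hℓ0 : (0 : ℝ) < ℓ := by exact_mod_cast NeZero.pos ℓ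
  have hN1 : (1 : ℝ) ≤ N := by exact_mod_cast (NeZero.pos ℓ).trans_le hN
  have hNℓ : (ℓ : ℝ) ≤ N := by exact_mod_cast hN
  have hq1 : (1 : ℝ) ≤ q := by exact_mod_cast hq
  set u : ℕ → ℂ := fun x => ((Real.sqrt Q : ℝ) : ℂ)⁻¹ * f x
  have h1 : ∀ v ∈ S, ‖ft Q u v‖ ≤ 4 * N ^ 3 / Q := by
    intro v hv
    have hv' := (Finset.mem_filter.mp hv).2
    have : ft Q u v = ∑ a, coeff χ s a * kern Q ((v : ℝ) / Q - (a.val : ℝ) / ℓ) := by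
      rw [← ft_trig]
      exact ft_congr (fun x _ => by rw [← eq_trig hχ hf]) v
    rw [this]
    have hterm : ∀ a : ZMod ℓ, ‖coeff χ s a * kern Q ((v : ℝ) / Q - (a.val : ℝ) / ℓ)‖ ≤
        4 * N * ℓ / Q := by
      intro a
      by_cases ha : IsUnit a
      · rw [norm_mul]
        have hη : (0 : ℝ) < 1 / (8 * N * ℓ) := by positivity
        refine (mul_le_mul (norm_coeff_le hχ a) (norm_kern_le hη fun n => ?_) (norm_nonneg _)
          zero_le_one).trans (le_of_eq (by field_simp; norm_num))
        have hcop : IsCoprime ((a.val : ℤ) + n * ℓ) (ℓ : ℤ) := by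
          rw [IsCoprime.add_mul_right_left_iff, Nat.isCoprime_iff_coprime,
            ← ZMod.isUnit_iff_coprime, ZMod.natCast_zmod_val]
          exact ha
        have h2 : (Q : ℤ) < 8 * N * |(ℓ : ℤ) * v - ((a.val : ℤ) + n * ℓ) * Q| := by
          by_contra h
          exact hv' ⟨_, hcop, not_lt.mp h⟩
        have h3 : (Q : ℝ) < 8 * N * |(ℓ : ℝ) * v - ((a.val : ℝ) + n * ℓ) * Q| := by
          exact_mod_cast h2
        have h4 : (v : ℝ) / Q - (a.val : ℝ) / ℓ - n =
            ((ℓ : ℝ) * v - ((a.val : ℝ) + n * ℓ) * Q) / (ℓ * Q) := by field_simp; ring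
        rw [h4, abs_div, abs_of_pos (mul_pos hℓ0 hQ0),
          div_le_div_iff₀ (by positivity) (by positivity)]
        nlinarith
      · rw [coeff_of_not_isUnit ha, zero_mul, norm_zero]; positivity
    refine (norm_sum_le _ _).trans ((Finset.sum_le_sum fun a _ => hterm a).trans ?_)
    rw [Finset.sum_const, Finset.card_univ, ZMod.card, nsmul_eq_mul, ← mul_div_assoc]
    refine div_le_div_of_nonneg_right ?_ hQ0.le
    calc (ℓ : ℝ) * (4 * N * ℓ) ≤ N * (4 * N * N) := by gcongr
      _ = 4 * N ^ 3 := by ring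
  have h2 : ∑ v ∈ S, ‖ft Q u v‖ ^ 2 ≤ 16 * N ^ 6 / Q := by
    calc ∑ v ∈ S, ‖ft Q u v‖ ^ 2 ≤ ∑ v ∈ S, (4 * (N : ℝ) ^ 3 / Q) ^ 2 :=
          Finset.sum_le_sum fun v hv => pow_le_pow_left₀ (norm_nonneg _) (h1 v hv) 2
      _ = S.card * (4 * (N : ℝ) ^ 3 / Q) ^ 2 := by rw [Finset.sum_const, nsmul_eq_mul]
      _ ≤ Q * (4 * (N : ℝ) ^ 3 / Q) ^ 2 := by
          gcongr
          exact_mod_cast (Finset.card_filter_le _ _).trans (by simp)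
      _ = 16 * N ^ 6 / Q := by field_simp; ring
  have h3 := sum_norm_ft_valueState_sub_le (q := q) hf (S := S) (Finset.filter_subset _ _)
  have h4 : ∑ v ∈ S, ‖ft Q (valueState q f) v‖ ^ 2 ≤ 2 * (16 * N ^ 6 / Q) + 2 * (40 / 2 ^ q) := by
    calc ∑ v ∈ S, ‖ft Q (valueState q f) v‖ ^ 2
        ≤ ∑ v ∈ S, (2 * ‖ft Q u v‖ ^ 2 + 2 * ‖ft Q (valueState q f) v - ft Q u v‖ ^ 2) :=
          Finset.sum_le_sum fun v _ => norm_sq_le_two_mul _ _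
      _ ≤ _ := by
          rw [Finset.sum_add_distrib, ← Finset.mul_sum, ← Finset.mul_sum]
          gcongr
  refine h4.trans ?_
  have h5 := pow_div_le hq H
  have h6 : (Q : ℝ) = 2 ^ q := by rw [hQ]; push_cast; rfl
  have h7 : (1 : ℝ) / 2 ^ q ≤ (N : ℝ) ^ 6 / 2 ^ q := by gcongr; exact one_le_pow₀ hN1
  have h8 : 1 / (2 ^ 20 * (q : ℝ) ^ 2) ≤ 1 / (2 ^ 20 * q) := by
    gcongr; nlinarith
  have h9 : 112 * (1 / (2 ^ 20 * (q : ℝ))) ≤ 1 / (400 * q) := by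
    rw [mul_one_div, div_le_div_iff₀ (by positivity) (by positivity)]
    nlinarith
  rw [h6, mul_div_assoc, show (40 : ℝ) / 2 ^ q = 40 * (1 / 2 ^ q) by ring]
  linarith

theorem half_div_le {Q : ℕ} (h : 4 * ℓ ≤ Q) : (Q : ℝ) / (2 * ℓ) ≤ ((Q / ℓ : ℕ) : ℝ) - 1 := by
  have hℓ0 : 0 < ℓ := NeZero.pos ℓ
  have hℓ : (0 : ℝ) < ℓ := by exact_mod_cast hℓ0
  have h1 : Q < ℓ * (Q / ℓ + 1) := by
    have := Nat.div_add_mod Q ℓ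
    have := Nat.mod_lt Q hℓ0
    rw [mul_add]; omega
  have h2 : (Q : ℝ) < ℓ * (((Q / ℓ : ℕ) : ℝ) + 1) := by exact_mod_cast h1
  have h3 : 4 * (ℓ : ℝ) ≤ Q := by exact_mod_cast h
  rw [div_le_iff₀ (by positivity)]
  nlinarith

theorem four_mul_le (hN : ℓ ≤ N) (hq : 1 ≤ q) (H : 2 ^ 20 * N ^ 6 * q ^ 2 ≤ 2 ^ q) :
    4 * ℓ ≤ 2 ^ q := by
  have hN1 : 1 ≤ N := (NeZero.pos ℓ).trans_le hN
  have h1 : N ≤ N ^ 6 := Nat.le_self_pow (by norm_num) N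
  have h2 : 1 ≤ q ^ 2 := Nat.one_le_pow _ _ hq
  nlinarith

/-- A noticeable proportion of the weight of a uniform superposition is on `x` with `f x ≠ 0`. -/
theorem inv_le_sum_norm_ft_valueState (hf : ∀ x : ℤ, f x = χ ((x + s : ℤ) : ZMod ℓ))
    (hN : ℓ ≤ N) (hq : 1 ≤ q) (H : 2 ^ 20 * N ^ 6 * q ^ 2 ≤ 2 ^ q) :
    1 / (2 * q : ℝ) ≤ ∑ v ∈ Finset.range (2 ^ q), ‖ft (2 ^ q) (valueState q f) v‖ ^ 2 := by
  have hℓ0 : (0 : ℝ) < ℓ := by exact_mod_cast NeZero.pos ℓ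
  have hq0 : (0 : ℝ) < q := by exact_mod_cast hq
  have h4 := four_mul_le hN hq H
  rw [sum_norm_ft_sq (by positivity)]
  have h1 : ∀ x : ℕ, ‖valueState q f x‖ ^ 2 = ((2 ^ q : ℕ) : ℝ)⁻¹ * ‖χ ((x : ZMod ℓ) + s)‖ ^ 2 := by
    intro x
    rw [valueState, norm_mul, mul_pow, norm_inv_sqrt_sq, norm_approxValue_sq, hf]
    push_cast
    congr 1
    split_ifs with h
    · simp [h]
    · rw [norm_eq_one_of_ne_zero h]; norm_num
  simp only [h1]
  rw [← Finset.mul_sum]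
  have h2 := mul_sum_le_sum_of_periodic (ℓ := ℓ) (h := fun x => ‖χ ((x : ZMod ℓ) + s)‖ ^ 2)
    (fun x => by positivity) (fun x => by simp) (2 ^ q)
  have h3 : ∑ x ∈ Finset.range ℓ, ‖χ ((x : ZMod ℓ) + s)‖ ^ 2 = Nat.totient ℓ := by
    rw [← sum_zmod_eq_sum_range (fun a => ‖χ (a + (s : ZMod ℓ))‖ ^ 2),
      ← sum_norm_mulChar_sq (χ := χ)]
    exact Fintype.sum_equiv (Equiv.addRight (s : ZMod ℓ)) _ _ fun _ => rfl
  rw [h3] at h2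
  have h5 := half_div_le h4
  have h6 := inv_le_totient_div (NeZero.pos ℓ) (show ℓ < 2 ^ q by have := NeZero.pos ℓ; omega)
  have hQ0 : (0 : ℝ) < (2 ^ q : ℕ) := by positivity
  rw [inv_mul_eq_div, le_div_iff₀ hQ0]
  refine le_trans ?_ h2
  calc 1 / (2 * q : ℝ) * (2 ^ q : ℕ) = (q : ℝ)⁻¹ * ((2 ^ q : ℕ) / 2) := by field_simp
    _ ≤ Nat.totient ℓ / ℓ * ((2 ^ q : ℕ) / 2) := by gcongr
    _ = ((2 ^ q : ℕ) / (2 * ℓ)) * Nat.totient ℓ := by field_simp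
    _ ≤ _ := by gcongr; linarith

theorem phaseCode_eq_zero_iff (k : ℕ) (z : ℂ) : phaseCode k z = 0 ↔ z = 0 := by
  rw [phaseCode]
  split_ifs with h
  · simp [h]
  · simp only [h, iff_false]; have := Nat.two_pow_pos k; omega

/-- A wrong shift is exposed with noticeable probability at a random argument. -/
theorem le_sum_phaseCode_ne (hχ : χ.IsPrimitive) (hf : ∀ x : ℤ, f x = χ ((x + s : ℤ) : ZMod ℓ))
    (hN : ℓ ≤ N) (hq : 1 ≤ q) (H : 2 ^ 20 * N ^ 6 * q ^ 2 ≤ 2 ^ q) {t : ℕ}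
    (ht : ¬ (t : ℤ) ≡ s [ZMOD ℓ]) :
    1 / (16 * q : ℝ) ≤ ∑ x ∈ Finset.range (2 ^ q),
      (if phaseCode q (f (x : ℕ)) = phaseCode q (χ (((x + t : ℕ) : ℤ) : ZMod ℓ)) then 0
        else ((2 ^ q : ℕ) : ℝ)⁻¹) := by
  have hℓ0 : (0 : ℝ) < ℓ := by exact_mod_cast NeZero.pos ℓ
  have hq0 : (0 : ℝ) < q := by exact_mod_cast hq
  have h4 := four_mul_le hN hq H
  set h : ℕ → ℝ := fun x =>
    if phaseCode q (χ ((x : ZMod ℓ) + s)) = phaseCode q (χ ((x : ZMod ℓ) + t)) then 0 else 1 with hh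
  have hd : ((s - t : ℤ) : ZMod ℓ) ≠ 0 := by
    intro h0
    rw [ZMod.intCast_zmod_eq_zero_iff_dvd] at h0
    exact ht (Int.modEq_iff_dvd.mpr h0)
  have h1 : (Nat.totient ℓ : ℝ) ≤ ∑ x ∈ Finset.range ℓ, ‖χ ((x : ZMod ℓ) + s) - χ (x + t)‖ ^ 2 := by
    rw [← sum_zmod_eq_sum_range (fun a => ‖χ (a + (s : ZMod ℓ)) - χ (a + (t : ZMod ℓ))‖ ^ 2)]
    refine (totient_le_sum_norm_shift_sub hχ hd).trans (le_of_eq ?_)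
    refine Fintype.sum_equiv (Equiv.subRight (t : ZMod ℓ)) _ _ fun x => ?_
    rw [Equiv.subRight_apply]
    congr 3
    · congr 1; push_cast; ring
    · ring_nf
  have hQ0 : (0 : ℝ) < 2 ^ q := by positivity
  have h2 : ∀ x : ℕ, ‖χ ((x : ZMod ℓ) + s) - χ (x + t)‖ ^ 2 ≤ 4 * h x + 160 / 2 ^ q := by
    intro x
    simp only [hh]
    split_ifs with hc
    · -- equal descriptions: both values are close to the same number, or both vanish
      by_cases h0 : χ ((x : ZMod ℓ) + s) = 0
      · rw [h0, (phaseCode_eq_zero_iff q 0).mpr rfl, eq_comm, phaseCode_eq_zero_iff] at hc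
        rw [h0, hc, sub_zero, norm_zero, zero_pow two_ne_zero]; positivity
      · have h0' : χ ((x : ZMod ℓ) + t) ≠ 0 := fun h' => by
          rw [h', (phaseCode_eq_zero_iff q 0).mpr rfl, phaseCode_eq_zero_iff] at hc
          exact h0 hc
        have e1 := norm_approxPhase_sub_le q (norm_eq_one_of_ne_zero h0)
        have e2 := norm_approxPhase_sub_le q (norm_eq_one_of_ne_zero h0')
        have e3 : approxPhase q (χ ((x : ZMod ℓ) + s)) = approxPhase q (χ ((x : ZMod ℓ) + t)) := by
          rw [approxPhase, approxPhase, hc]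
        rw [e3, norm_sub_rev] at e1
        have e4 := norm_sub_le_norm_sub_add_norm_sub (χ ((x : ZMod ℓ) + s))
          (approxPhase q (χ ((x : ZMod ℓ) + t))) (χ ((x : ZMod ℓ) + t))
        have e5 : ‖χ ((x : ZMod ℓ) + s) - χ (x + t)‖ ≤ 2 * (2 * Real.pi / 2 ^ q) := by linarith
        refine (pow_le_pow_left₀ (norm_nonneg _) e5 2).trans ?_
        rw [mul_zero, zero_add, mul_pow, div_pow]
        have e6 : (2 * Real.pi) ^ 2 ≤ 40 := by nlinarith [Real.pi_pos, Real.pi_lt_d2]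
        have e7 : (2 : ℝ) ^ q ≤ (2 ^ q) ^ 2 := by
          have : (1 : ℝ) ≤ 2 ^ q := one_le_pow₀ (by norm_num)
          nlinarith
        calc (2 : ℝ) ^ 2 * ((2 * Real.pi) ^ 2 / (2 ^ q) ^ 2) ≤ 2 ^ 2 * (40 / 2 ^ q) := by gcongr
          _ = 160 / 2 ^ q := by ring
    · have e1 := norm_sub_le (χ ((x : ZMod ℓ) + s)) (χ (x + t))
      have e2 : ‖χ ((x : ZMod ℓ) + s) - χ (x + t)‖ ≤ 2 := by
        linarith [χ.norm_le_one ((x : ZMod ℓ) + s), χ.norm_le_one ((x : ZMod ℓ) + t)]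
      have e3 : (0 : ℝ) ≤ 160 / 2 ^ q := by positivity
      nlinarith [norm_nonneg (χ ((x : ZMod ℓ) + s) - χ (x + t))]
  have hN1 : (1 : ℝ) ≤ N := by exact_mod_cast (NeZero.pos ℓ).trans_le hN
  have hφ : (1 : ℝ) ≤ Nat.totient ℓ := by exact_mod_cast Nat.totient_pos.mpr (NeZero.pos ℓ)
  have h3 : (Nat.totient ℓ : ℝ) / 8 ≤ ∑ x ∈ Finset.range ℓ, h x := by
    have e1 := h1.trans (Finset.sum_le_sum fun x _ => h2 x)
    rw [Finset.sum_add_distrib, ← Finset.mul_sum, Finset.sum_const, Finset.card_range,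
      nsmul_eq_mul] at e1
    have e2 : (ℓ : ℝ) * (160 / 2 ^ q) ≤ 1 / 2 := by
      have e3 := pow_div_le hq H
      have e4 : (ℓ : ℝ) ≤ N ^ 6 := by
        refine le_trans (by exact_mod_cast hN) (le_self_pow₀ hN1 (by norm_num))
      have e5 : 1 / (2 ^ 20 * (q : ℝ) ^ 2) ≤ 1 / 2 ^ 20 := by
        gcongr
        have : (1 : ℝ) ≤ (q : ℝ) ^ 2 := one_le_pow₀ (by exact_mod_cast hq)
        linarith
      calc (ℓ : ℝ) * (160 / 2 ^ q) = 160 * (ℓ / 2 ^ q) := by ring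
        _ ≤ 160 * ((N : ℝ) ^ 6 / 2 ^ q) := by gcongr
        _ ≤ 160 * (1 / 2 ^ 20) := mul_le_mul_of_nonneg_left (e3.trans e5) (by norm_num)
        _ ≤ 1 / 2 := by norm_num
    linarith
  have h5 := mul_sum_le_sum_of_periodic (ℓ := ℓ) (h := h)
    (fun x => by simp only [hh]; split_ifs <;> norm_num) (fun x => by simp [hh]) (2 ^ q)
  have h6 := half_div_le h4
  have h7 := inv_le_totient_div (NeZero.pos ℓ) (show ℓ < 2 ^ q by have := NeZero.pos ℓ; omega)
  have h8 : ∑ x ∈ Finset.range (2 ^ q),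
      (if phaseCode q (f (x : ℕ)) = phaseCode q (χ (((x + t : ℕ) : ℤ) : ZMod ℓ)) then 0
        else ((2 ^ q : ℕ) : ℝ)⁻¹) = ((2 ^ q : ℕ) : ℝ)⁻¹ * ∑ x ∈ Finset.range (2 ^ q), h x := by
    rw [Finset.mul_sum]
    refine Finset.sum_congr rfl fun x _ => ?_
    simp only [hh, hf]
    push_cast
    split_ifs <;> simp
  have hQ0 : (0 : ℝ) < (2 ^ q : ℕ) := by positivity
  rw [h8, inv_mul_eq_div, le_div_iff₀ hQ0]
  refine le_trans ?_ h5
  calc 1 / (16 * q : ℝ) * (2 ^ q : ℕ) = (q : ℝ)⁻¹ * ((2 ^ q : ℕ) / 16) := by field_simp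
    _ ≤ Nat.totient ℓ / ℓ * ((2 ^ q : ℕ) / 16) := by gcongr
    _ = ((2 ^ q : ℕ) / (2 * ℓ)) * (Nat.totient ℓ / 8) := by field_simp; norm_num
    _ ≤ _ := by
      refine mul_le_mul (by linarith) h3 (by positivity) (by positivity)

end Sampling

/-! ### Recovering the shift -/

section Recovery

variable {ℓ : ℕ} [NeZero ℓ] {χ : DirichletCharacter ℂ ℓ} {s : ℤ} {f : ℤ → ℂ} {N q : ℕ}

/-- The integer nearest to `v ℓ / Q`. -/
def nearest (ℓ Q v : ℕ) : ℕ := (2 * v * ℓ + Q) / (2 * Q)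

theorem half_le_abs_of_ne_nearest {Q : ℕ} (hQ : 0 < Q) (v : ℕ) {b : ℤ} (hb : b ≠ nearest ℓ Q v) :
    1 / (2 * (ℓ : ℝ)) ≤ |(v : ℝ) / Q - b / ℓ| := by
  have hℓ : (0 : ℝ) < ℓ := by exact_mod_cast NeZero.pos ℓ
  have hQ' : (0 : ℝ) < Q := by exact_mod_cast hQ
  have h1 : (Q : ℤ) ≤ 2 * |(v : ℤ) * ℓ - b * Q| := by
    have e1 : (2 * Q : ℤ) * nearest ℓ Q v ≤ 2 * v * ℓ + Q := by
      exact_mod_cast Nat.mul_div_le (2 * v * ℓ + Q) (2 * Q)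
    have e2 : (2 * v * ℓ + Q : ℤ) < 2 * Q * (nearest ℓ Q v + 1) := by
      exact_mod_cast Nat.lt_mul_div_succ (2 * v * ℓ + Q) (by omega : 0 < 2 * Q)
    have hQ0 : (0 : ℤ) < Q := by exact_mod_cast hQ
    rcases lt_or_gt_of_ne hb with h | h
    · have := le_abs_self ((v : ℤ) * ℓ - b * Q)
      nlinarith
    · have := neg_abs_le ((v : ℤ) * ℓ - b * Q)
      nlinarith
  have h2 : (Q : ℝ) ≤ 2 * |(v : ℝ) * ℓ - b * Q| := by exact_mod_cast h1
  rw [show (v : ℝ) / Q - b / ℓ = ((v : ℝ) * ℓ - b * Q) / (Q * ℓ) by field_simp, abs_div,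
    abs_of_pos (mul_pos hQ' hℓ), div_le_div_iff₀ (by positivity) (by positivity)]
  nlinarith

/-- The transform of `x ↦ χ (x + s)` is concentrated near the multiples of `Q / ℓ`, where it is
proportional to `χ⁻¹`: multiplication by `χ` at the nearest multiple cancels this factor. -/
theorem norm_mul_ft_sub_le (hχ : χ.IsPrimitive) (hf : ∀ x : ℤ, f x = χ ((x + s : ℤ) : ZMod ℓ))
    (v : ℕ) :
    ‖approxPhase q (χ (nearest ℓ (2 ^ q) v)) *
        ft (2 ^ q) (fun x => ((Real.sqrt (2 ^ q : ℕ) : ℝ) : ℂ)⁻¹ * f x) v -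
      ft (2 ^ q) (fun x => ((Real.sqrt (2 ^ q : ℕ) : ℝ) : ℂ)⁻¹ *
        trig (fun a => coeff χ s a * χ a) x) v‖ ≤ 8 * ℓ ^ 2 / 2 ^ q := by
  set Q := 2 ^ q with hQ
  have hQ0 : 0 < Q := by positivity
  have hℓ : (0 : ℝ) < ℓ := by exact_mod_cast NeZero.pos ℓ
  have hℓ1 : (1 : ℝ) ≤ ℓ := by exact_mod_cast NeZero.pos ℓ
  have hQR : (2 : ℝ) ^ q = Q := by rw [hQ]; push_cast; rfl
  have hQ' : (0 : ℝ) < Q := by exact_mod_cast hQ0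
  rw [ft_congr (b := fun x => ((Real.sqrt Q : ℝ) : ℂ)⁻¹ * trig (coeff χ s) x)
    (fun x _ => by rw [← eq_trig hχ hf]), ft_trig, ft_trig, Finset.mul_sum,
    ← Finset.sum_sub_distrib, hQR]
  have hterm : ∀ a : ZMod ℓ, ‖approxPhase q (χ (nearest ℓ Q v)) *
      (coeff χ s a * kern Q ((v : ℝ) / Q - (a.val : ℝ) / ℓ)) -
      coeff χ s a * χ a * kern Q ((v : ℝ) / Q - (a.val : ℝ) / ℓ)‖ ≤ 8 * ℓ / Q := by
    intro a
    rw [show ∀ x y z w : ℂ, x * (y * z) - y * w * z = y * ((x - w) * z) by intros; ring, norm_mul,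
      norm_mul]
    by_cases ha : IsUnit a
    · refine (mul_le_of_le_one_left (by positivity) (norm_coeff_le hχ a)).trans ?_
      have hχa : ‖χ a‖ = 1 := norm_eq_one_of_ne_zero (ha.map χ).ne_zero
      by_cases h : (nearest ℓ Q v : ZMod ℓ) = a
      · refine (mul_le_of_le_one_right (norm_nonneg _) (norm_kern_le_one _ _)).trans ?_
        rw [h]
        refine (norm_approxPhase_sub_le q hχa).trans ?_
        rw [hQR]
        refine div_le_div_of_nonneg_right ?_ hQ'.le
        linarith [Real.pi_lt_d2]
      · have h1 : ‖approxPhase q (χ (nearest ℓ Q v)) - χ a‖ ≤ 2 := by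
          refine (norm_sub_le _ _).trans ?_
          rw [norm_approxPhase, hχa]; norm_num
        have h2 : ‖kern Q ((v : ℝ) / Q - (a.val : ℝ) / ℓ)‖ ≤ 1 / (2 * (1 / (2 * ℓ)) * Q) := by
          refine norm_kern_le (by positivity) fun n => ?_
          have hb : (a.val : ℤ) + n * ℓ ≠ nearest ℓ Q v := by
            intro hb
            apply h
            have := congrArg (fun z : ℤ => (z : ZMod ℓ)) hb
            push_cast at this
            rw [ZMod.natCast_zmod_val, ZMod.natCast_self, mul_zero, add_zero] at this
            exact this.symm
          refine (half_le_abs_of_ne_nearest hQ0 v hb).trans_eq ?_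
          congr 1
          push_cast
          field_simp
          ring
        refine (mul_le_mul h1 h2 (norm_nonneg _) zero_le_two).trans ?_
        rw [show (2 : ℝ) * (1 / (2 * (1 / (2 * (ℓ : ℝ))) * Q)) = 2 * ℓ / Q by field_simp]
        gcongr
        norm_num
    · rw [coeff_of_not_isUnit ha, norm_zero, zero_mul]; positivity
  refine (norm_sum_le _ _).trans ((Finset.sum_le_sum fun a _ => hterm a).trans (le_of_eq ?_))
  rw [Finset.sum_const, Finset.card_univ, ZMod.card, nsmul_eq_mul]
  ring

/-- At the arguments congruent to `-s` the terms of the trigonometric polynomial add up. -/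
theorem norm_trig_coeff_mul_sq (hχ : χ.IsPrimitive) {x : ℕ} (hx : (x : ZMod ℓ) = -(s : ZMod ℓ)) :
    ‖trig (fun a => coeff χ s a * χ a) x‖ ^ 2 = (Nat.totient ℓ : ℝ) ^ 2 / ℓ := by
  have h : trig (fun a => coeff χ s a * χ a) x =
      (ℓ : ℂ)⁻¹ * gaussSum χ ZMod.stdAddChar * Nat.totient ℓ := by
    rw [trig, ← ZMod.card_units_eq_totient, ← mul_one ((Fintype.card (ZMod ℓ)ˣ : ℕ) : ℂ),
      ← nsmul_eq_mul, ← Finset.card_univ, ← Finset.sum_const,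
      ← sum_isUnit (fun _ => (1 : ℂ)), Finset.mul_sum]
    refine Finset.sum_congr rfl fun a _ => ?_
    rw [← stdAddChar_neg_mul, coeff, hx, ← inv_mul_self_apply (χ := χ)]
    have h1 : (ZMod.stdAddChar (-(a * (s : ZMod ℓ))) : ℂ) *
        ZMod.stdAddChar (-(a * -(s : ZMod ℓ))) = 1 := by
      rw [← AddChar.map_add_eq_mul, mul_neg, neg_neg, neg_add_cancel, AddChar.map_zero_eq_one]
    linear_combination (ℓ : ℂ)⁻¹ * gaussSum χ ZMod.stdAddChar * χ⁻¹ a * χ a * h1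
  rw [h, norm_mul, mul_pow, norm_inv_mul_gaussSum_sq hχ, Complex.norm_natCast]
  ring

/-- The arguments below `Q` that are congruent to the shift up to the reflection `z ↦ Q - z`. -/
theorem div_sub_one_le_card (hQ : 4 * ℓ ≤ 2 ^ q) :
    ((2 ^ q : ℕ) : ℝ) / (2 * ℓ) ≤ (((Finset.range (2 ^ q)).filter fun z =>
      ((z + 2 ^ q * (ℓ - 1) : ℕ) : ℤ) ≡ s [ZMOD ℓ]).erase 0).card := by
  refine (half_div_le hQ).trans ?_
  set S := (Finset.range (2 ^ q)).filter fun z => ((z + 2 ^ q * (ℓ - 1) : ℕ) : ℤ) ≡ s [ZMOD ℓ]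
  set h : ℕ → ℝ := fun z => if (z : ZMod ℓ) = s + (2 ^ q : ℕ) then 1 else 0 with hh
  have hiff : ∀ z : ℕ, ((z + 2 ^ q * (ℓ - 1) : ℕ) : ℤ) ≡ s [ZMOD ℓ] ↔
      (z : ZMod ℓ) = s + (2 ^ q : ℕ) := by
    intro z
    rw [← ZMod.intCast_eq_intCast_iff]
    push_cast [Nat.cast_sub (NeZero.pos ℓ : 1 ≤ ℓ)]
    rw [ZMod.natCast_self, ← sub_eq_zero, ← sub_eq_zero (a := (z : ZMod ℓ))]
    ring_nf
  have h1 := mul_sum_le_sum_of_periodic (ℓ := ℓ) (h := h)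
    (fun x => by simp only [hh]; split_ifs <;> norm_num) (fun x => by simp [hh]) (2 ^ q)
  have h2 : ∑ x ∈ Finset.range ℓ, h x = 1 := by
    rw [hh, ← sum_zmod_eq_sum_range
      (fun a => if a = (s : ZMod ℓ) + ((2 ^ q : ℕ) : ZMod ℓ) then (1 : ℝ) else 0)]
    simp
  have h3 : ∑ x ∈ Finset.range (2 ^ q), h x = S.card := by
    simp only [hh, ← hiff]
    rw [Finset.sum_ite, Finset.sum_const_zero, add_zero, Finset.sum_const, nsmul_eq_mul, mul_one]
  rw [h2, h3, mul_one] at h1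
  have h4 : (S.card : ℝ) ≤ (S.erase 0).card + 1 := by
    have := Finset.pred_card_le_card_erase (s := S) (a := 0)
    exact_mod_cast (by omega : S.card ≤ (S.erase 0).card + 1)
  linarith

/-- After the factor `χ⁻¹` is cancelled, a second Fourier transform yields an outcome in the class
of the shift with noticeable probability. As the transform is its own inverse up to the reflection
`z ↦ Q - z`, and natural numbers have no negatives, the shift is read off as
`z - Q ≡ z + Q (ℓ - 1)`. -/
theorem inv_le_sum_norm_recovered (hχ : χ.IsPrimitive)
    (hf : ∀ x : ℤ, f x = χ ((x + s : ℤ) : ZMod ℓ)) (hN : ℓ ≤ N) (hq : 1 ≤ q)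
    (H : 2 ^ 20 * N ^ 6 * q ^ 2 ≤ 2 ^ q) :
    1 / (8 * q ^ 2 : ℝ) ≤ ∑ z ∈ (Finset.range (2 ^ q)).filter
      (fun z => ((z + 2 ^ q * (ℓ - 1) : ℕ) : ℤ) ≡ s [ZMOD ℓ]),
      ‖ft (2 ^ q) (fun v => approxPhase q (χ (nearest ℓ (2 ^ q) v)) *
        ft (2 ^ q) (valueState q f) v) z‖ ^ 2 := by
  set Q := 2 ^ q with hQ
  set S := (Finset.range Q).filter fun z => ((z + Q * (ℓ - 1) : ℕ) : ℤ) ≡ s [ZMOD ℓ]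
  have hQ0 : 0 < Q := by positivity
  have hℓ : (0 : ℝ) < ℓ := by exact_mod_cast NeZero.pos ℓ
  have hq0 : (0 : ℝ) < q := by exact_mod_cast hq
  have hN1 : (1 : ℝ) ≤ N := by exact_mod_cast (NeZero.pos ℓ).trans_le hN
  have hQR : (2 : ℝ) ^ q = Q := by rw [hQ]; push_cast; rfl
  have hQ' : (0 : ℝ) < Q := by exact_mod_cast hQ0
  have h4 := four_mul_le hN hq H
  set c : ℕ → ℂ := fun v => approxPhase q (χ (nearest ℓ Q v)) with hc
  set u : ℕ → ℂ := fun x => ((Real.sqrt Q : ℝ) : ℂ)⁻¹ * f x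
  set g : ℕ → ℂ := fun x => ((Real.sqrt Q : ℝ) : ℂ)⁻¹ * trig (fun a => coeff χ s a * χ a) x with hg
  have hdiff : ∑ v ∈ Finset.range Q, ‖c v * ft Q (valueState q f) v - ft Q g v‖ ^ 2 ≤
      208 * N ^ 6 / Q := by
    have e1 : ∀ v : ℕ, ‖c v * ft Q (valueState q f) v - ft Q g v‖ ^ 2 ≤
        2 * (8 * ℓ ^ 2 / Q) ^ 2 + 2 * ‖ft Q (valueState q f) v - ft Q u v‖ ^ 2 := by
      intro v
      refine (norm_sq_le_two_mul _ (c v * ft Q u v - ft Q g v)).trans ?_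
      have e2 := norm_mul_ft_sub_le (q := q) hχ hf v
      rw [hQR] at e2
      rw [sub_sub_sub_cancel_right, ← mul_sub, norm_mul, norm_approxPhase, one_mul]
      gcongr
    have e2 := sum_norm_ft_valueState_sub_le (q := q) hf (S := Finset.range Q) subset_rfl
    rw [hQR] at e2
    calc _ ≤ ∑ v ∈ Finset.range Q, (2 * (8 * (ℓ : ℝ) ^ 2 / Q) ^ 2 +
            2 * ‖ft Q (valueState q f) v - ft Q u v‖ ^ 2) := Finset.sum_le_sum fun v _ => e1 v
      _ ≤ Q * (2 * (8 * (ℓ : ℝ) ^ 2 / Q) ^ 2) + 2 * (40 / Q) := by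
          rw [Finset.sum_add_distrib, Finset.sum_const, Finset.card_range, nsmul_eq_mul,
            ← Finset.mul_sum]
          gcongr
      _ = (128 * ℓ ^ 4 + 80) / Q := by field_simp; ring
      _ ≤ 208 * N ^ 6 / Q := by
          gcongr
          have e3 : (ℓ : ℝ) ^ 4 ≤ N ^ 4 := by gcongr
          have e4 : (N : ℝ) ^ 4 ≤ N ^ 6 := pow_le_pow_right₀ hN1 (by norm_num)
          have e5 : (1 : ℝ) ≤ N ^ 6 := one_le_pow₀ hN1
          linarith
  have hmain : (Nat.totient ℓ / ℓ : ℝ) ^ 2 / 2 ≤ ∑ z ∈ S, ‖ft Q (ft Q g) z‖ ^ 2 := by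
    calc (Nat.totient ℓ / ℓ : ℝ) ^ 2 / 2 =
          ((Q : ℕ) : ℝ) / (2 * ℓ) * ((Q : ℝ)⁻¹ * (Nat.totient ℓ ^ 2 / ℓ)) := by field_simp
      _ ≤ (S.erase 0).card * ((Q : ℝ)⁻¹ * (Nat.totient ℓ ^ 2 / ℓ)) := by
          gcongr
          exact div_sub_one_le_card h4
      _ = ∑ z ∈ S.erase 0, ‖ft Q (ft Q g) z‖ ^ 2 := by
          rw [← nsmul_eq_mul, ← Finset.sum_const]
          refine Finset.sum_congr rfl fun z hz => ?_
          obtain ⟨hz0, hz⟩ := Finset.mem_erase.mp hz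
          obtain ⟨hzQ, hzs⟩ := Finset.mem_filter.mp hz
          have hzQ := Finset.mem_range.mp hzQ
          rw [ft_ft hQ0 g (Nat.pos_of_ne_zero hz0) hzQ, hg, norm_mul, mul_pow, norm_inv_sqrt_sq,
            norm_trig_coeff_mul_sq hχ]
          rw [← ZMod.intCast_eq_intCast_iff] at hzs
          rw [Nat.cast_sub hzQ.le, ← hzs]
          push_cast [Nat.cast_sub (NeZero.pos ℓ : 1 ≤ ℓ)]
          rw [ZMod.natCast_self]
          ring
      _ ≤ _ := Finset.sum_le_sum_of_subset_of_nonneg (Finset.erase_subset _ _)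
          fun _ _ _ => by positivity
  have hft : ∑ z ∈ S, ‖ft Q (ft Q g) z - ft Q (fun v => c v * ft Q (valueState q f) v) z‖ ^ 2 ≤
      208 * N ^ 6 / Q := by
    simp only [← ft_sub]
    refine (sum_norm_ft_sq_le hQ0 _ S (Finset.filter_subset _ _)).trans ?_
    simpa only [norm_sub_rev] using hdiff
  have hsum : ∑ z ∈ S, ‖ft Q (ft Q g) z‖ ^ 2 ≤
      2 * ∑ z ∈ S, ‖ft Q (fun v => c v * ft Q (valueState q f) v) z‖ ^ 2 +
      2 * (208 * N ^ 6 / Q) := by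
    calc _ ≤ ∑ z ∈ S, (2 * ‖ft Q (fun v => c v * ft Q (valueState q f) v) z‖ ^ 2 +
          2 * ‖ft Q (ft Q g) z - ft Q (fun v => c v * ft Q (valueState q f) v) z‖ ^ 2) :=
          Finset.sum_le_sum fun z _ => norm_sq_le_two_mul _ _
      _ ≤ _ := by
          rw [Finset.sum_add_distrib, ← Finset.mul_sum, ← Finset.mul_sum]
          gcongr
  have hφ := inv_le_totient_div (NeZero.pos ℓ) (show ℓ < 2 ^ q by have := NeZero.pos ℓ; omega)
  have hφ2 : 1 / (q : ℝ) ^ 2 ≤ (Nat.totient ℓ / ℓ : ℝ) ^ 2 := by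
    rw [one_div, ← inv_pow]; gcongr
  have hH := pow_div_le hq H
  rw [hQR] at hH
  have e1 : (1 : ℝ) / (2 ^ 20 * q ^ 2) = 1 / 2 ^ 20 * (1 / q ^ 2) := by field_simp
  have e2 : (1 : ℝ) / (8 * q ^ 2) = 1 / 8 * (1 / q ^ 2) := by field_simp
  have e3 : (0 : ℝ) < 1 / (q : ℝ) ^ 2 := by positivity
  rw [e1] at hH
  rw [e2]
  rw [mul_div_assoc] at hsum
  linarith

end Recovery

section Algorithm

variable {O : Fin 2 → ℤ → ℂ} {B L : ℕ} {c d : Cmd} {σ : Store} {ψ : QState}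
  {Post Mid : Store → QState → Prop} {W W' : Store → QState → ℝ} {v : ℝ}

/-! ### Continued fractions -/

/-- Two consecutive convergents `p₀ / q₀` and `p₁ / q₁` of `v / Q`, with the remainders `r₀` and
`r₁` of the Euclidean algorithm. -/
def IsConvergent (Q v r₀ r₁ q₀ q₁ : ℕ) (p₀ p₁ : ℤ) : Prop :=
  ∃ ε : ℤ, (ε = 1 ∨ ε = -1) ∧ q₀ * v - p₀ * Q = -ε * r₀ ∧ q₁ * v - p₁ * Q = ε * r₁ ∧
    q₁ * p₀ - q₀ * p₁ = ε

theorem IsConvergent.init (Q v : ℕ) : IsConvergent Q v Q v 0 1 1 0 :=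
  ⟨1, by simp⟩

theorem IsConvergent.step {Q v r₀ r₁ q₀ q₁ : ℕ} {p₀ p₁ : ℤ}
    (h : IsConvergent Q v r₀ r₁ q₀ q₁ p₀ p₁) :
    IsConvergent Q v r₁ (r₀ % r₁) q₁ (q₀ + r₀ / r₁ * q₁) p₁ (p₀ + (r₀ / r₁ : ℕ) * p₁) := by
  obtain ⟨ε, hε, h0, h1, hd⟩ := h
  have hr : (r₀ : ℤ) = r₁ * (r₀ / r₁ : ℕ) + (r₀ % r₁ : ℕ) := by
    exact_mod_cast (Nat.div_add_mod r₀ r₁).symm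
  refine ⟨-ε, by omega, by rw [h1]; ring, ?_, ?_⟩
  · push_cast at hr ⊢
    linear_combination h0 + (r₀ / r₁ : ℤ) * h1 - ε * hr
  · push_cast
    linear_combination -hd

theorem IsConvergent.mul_add_mul {Q v r₀ r₁ q₀ q₁ : ℕ} {p₀ p₁ : ℤ}
    (h : IsConvergent Q v r₀ r₁ q₀ q₁ p₀ p₁) : q₁ * r₀ + q₀ * r₁ = Q := by
  obtain ⟨ε, hε, h0, h1, hd⟩ := h
  have hε2 : ε * ε = 1 := by rcases hε with rfl | rfl <;> rfl
  have : (q₁ * r₀ + q₀ * r₁ : ℤ) = Q := by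
    linear_combination ε * q₁ * h0 - ε * q₀ * h1 + ε * Q * hd + (Q - q₁ * r₀ - q₀ * r₁) * hε2
  exact_mod_cast this

/-- Two fractions in lowest terms with small difference are equal. -/
theorem den_eq_of_small {Q v ℓ q : ℕ} {w p : ℤ} (hwℓ : IsCoprime w (ℓ : ℤ))
    (hpq : IsCoprime p (q : ℤ))
    (h : |(q : ℤ) * (w * Q - ℓ * v) + ℓ * (q * v - p * Q)| < Q) : q = ℓ := by
  have e : (q : ℤ) * (w * Q - ℓ * v) + ℓ * (q * v - p * Q) = (q * w - ℓ * p) * Q := by ring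
  rw [e, abs_mul, Nat.abs_cast] at h
  have h0 : (q : ℤ) * w - ℓ * p = 0 := by
    rw [← Int.abs_lt_one_iff]
    by_contra h'
    have := mul_le_mul_of_nonneg_right (not_lt.mp h') (Nat.cast_nonneg (α := ℤ) Q)
    omega
  have h1 : (ℓ : ℤ) ∣ q := hwℓ.symm.dvd_of_dvd_mul_right ⟨p, by linarith⟩
  have h2 : (q : ℤ) ∣ ℓ := hpq.symm.dvd_of_dvd_mul_right ⟨w, by linarith⟩
  exact Nat.dvd_antisymm (by exact_mod_cast h2) (by exact_mod_cast h1)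

theorem IsConvergent.eq_of_isClose_of_eq_zero {Q v r₀ q₀ q₁ N ℓ : ℕ} {p₀ p₁ : ℤ}
    (h : IsConvergent Q v r₀ 0 q₀ q₁ p₀ p₁) (hQ : 0 < Q) (hq₁ : q₁ ≤ 2 * N)
    (hc : IsClose N ℓ Q v) : q₁ = ℓ := by
  obtain ⟨w, hw, hc⟩ := hc
  obtain ⟨ε, hε, h0, h1, hd⟩ := h
  have hε2 : ε * ε = 1 := by rcases hε with rfl | rfl <;> rfl
  refine den_eq_of_small (Q := Q) (v := v) hw
    (⟨-ε * q₀, ε * p₀, by linear_combination ε * hd + hε2⟩ : IsCoprime p₁ (q₁ : ℤ)) ?_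
  rw [h1, Nat.cast_zero, mul_zero, mul_zero, add_zero, abs_mul, Nat.abs_cast, abs_sub_comm]
  have e1 : (q₁ : ℤ) ≤ 2 * N := by exact_mod_cast hq₁
  have e2 := mul_le_mul_of_nonneg_right e1 (abs_nonneg ((ℓ : ℤ) * v - w * Q))
  have hQ' : (0 : ℤ) < Q := by exact_mod_cast hQ
  linarith

theorem IsConvergent.eq_of_isClose_of_lt {Q v r₀ r₁ q₀ q₁ N ℓ : ℕ} {p₀ p₁ : ℤ}
    (h : IsConvergent Q v r₀ r₁ q₀ q₁ p₀ p₁) (hQ : 0 < Q) (hq₀ : q₀ ≤ 2 * N)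
    (hq₁ : 2 * N < q₁) (hℓ : ℓ ≤ N) (hc : IsClose N ℓ Q v) : q₀ = ℓ := by
  have hsum := h.mul_add_mul
  obtain ⟨w, hw, hc⟩ := hc
  obtain ⟨ε, hε, h0, h1, hd⟩ := h
  have hε2 : ε * ε = 1 := by rcases hε with rfl | rfl <;> rfl
  have hε1 : |ε| = 1 := by rcases hε with rfl | rfl <;> rfl
  refine den_eq_of_small (Q := Q) (v := v) hw
    (⟨ε * q₁, -ε * p₁, by linear_combination ε * hd + hε2⟩ : IsCoprime p₀ (q₀ : ℤ)) ?_
  refine (abs_add_le _ _).trans_lt ?_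
  rw [h0, abs_mul, abs_mul, abs_mul, abs_neg, hε1, one_mul, Nat.abs_cast, Nat.abs_cast,
    Nat.abs_cast, abs_sub_comm]
  have e1 : (q₀ : ℤ) ≤ 2 * N := by exact_mod_cast hq₀
  have e2 := mul_le_mul_of_nonneg_right e1 (abs_nonneg ((ℓ : ℤ) * v - w * Q))
  have e3 : 2 * (ℓ * r₀) ≤ Q := by
    have : 2 * ℓ * r₀ ≤ q₁ * r₀ := Nat.mul_le_mul_right _ (by omega)
    have : 2 * (ℓ * r₀) = 2 * ℓ * r₀ := by ring
    have := Nat.zero_le (q₀ * r₁)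
    omega
  have e4 : 2 * ((ℓ : ℤ) * r₀) ≤ Q := by exact_mod_cast e3
  have hQ' : (0 : ℤ) < Q := by exact_mod_cast hQ
  linarith

/-- One step of the Euclidean algorithm on the registers `13` and `14`, with the denominators of the
convergents in registers `15` and `16`. -/
def contfracStep : Cmd :=
  .assign 17 (reg 15 + reg 13 / reg 14 * reg 16) ;; .assign 15 (reg 16) ;; .assign 16 (reg 17) ;;
    .assign 17 (reg 13 % reg 14) ;; .assign 13 (reg 14) ;; .assign 14 (reg 17)

/-- Compute in register `9` the denominator of the last convergent of `v / Q` with denominator at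
most `2 N`, for `N`, `Q` and `v` in the registers `0`, `3` and `7`. -/
def contfrac : Cmd :=
  .assign 13 (reg 3) ;; .assign 14 (reg 7) ;; .assign 15 (.const 0) ;; .assign 16 (.const 1) ;;
    .loop ((.const 2 * reg 0 + .const 1 - reg 16) * reg 14) contfracStep ;;
      .ite (.const 2 * reg 0 + .const 1 - reg 16) (.assign 9 (reg 16)) (.assign 9 (reg 15))

theorem Det.contfracStep {S : Finset ℕ} {σ₀ : Store} (hS : {13, 14, 15, 16, 17} ⊆ S)
    (hf : Frame B S σ₀ σ) (hB : 1 ≤ B) (hψ : QBounded B ψ)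
    (hq : Nat.size (σ 15 + σ 13 / σ 14 * σ 16) ≤ B) :
    Det O B L contfracStep σ ψ fun σ' ψ' => ψ' = ψ ∧ Frame B S σ₀ σ' ∧ σ' 13 = σ 14 ∧
      σ' 14 = σ 13 % σ 14 ∧ σ' 15 = σ 16 ∧ σ' 16 = σ 15 + σ 13 / σ 14 * σ 16 := by
  have m13 : 13 ∈ S := hS (by simp)
  have m14 : 14 ∈ S := hS (by simp)
  have m15 : 15 ∈ S := hS (by simp)
  have m16 : 16 ∈ S := hS (by simp)
  have m17 : 17 ∈ S := hS (by simp)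
  have hmod : Nat.size (σ 13 % σ 14) ≤ B :=
    (Nat.size_le_size (Nat.mod_le _ _)).trans (hf.size_le 13)
  have f1 := hf.update m17 hq
  refine Det.assign_seq ⟨hB, hf.size_le, hψ⟩ ?_
  have f2 := f1.update m15 (hf.size_le 16)
  refine Det.assign_seq ⟨hB, f1.size_le, hψ⟩ ?_
  have f3 := f2.update m16 hq
  refine Det.assign_seq ⟨hB, f2.size_le, hψ⟩ ?_
  have f4 := f3.update m17 hmod
  refine Det.assign_seq ⟨hB, f3.size_le, hψ⟩ ?_
  have f5 := f4.update m13 (hf.size_le 14)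
  refine Det.assign_seq ⟨hB, f4.size_le, hψ⟩ ?_
  have f6 := f5.update m14 hmod
  refine Det.assign ⟨hB, f5.size_le, hψ⟩ ⟨rfl, ?_, ?_⟩
  · simpa using f6
  · simp

/-- The loop invariant of the continued fraction expansion; the product of the remainders is at
least halved in each of the `i` iterations. -/
structure ContfracInv (B N Q v : ℕ) (σ₀ : Store) (i : ℕ) (σ : Store) : Prop where
  frame : Frame B {9, 13, 14, 15, 16, 17} σ₀ σ
  conv : ∃ p₀ p₁ : ℤ, IsConvergent Q v (σ 13) (σ 14) (σ 15) (σ 16) p₀ p₁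
  lt : σ 14 < σ 13
  pos : 1 ≤ σ 16
  eq_one : σ 15 = 0 → σ 16 = 1
  le : σ 15 ≤ 2 * N
  halved : 2 ^ i * (σ 13 * σ 14) ≤ Q * Q

/-- The denominator computed is at least `1` and at most `2 N`, and it is `ℓ` whenever `x` is close
to a fraction with denominator `ℓ` in lowest terms, by the uniqueness of such fractions
(`den_eq_of_small`). -/
theorem Det.contfrac {N q x : ℕ} (hN : 0 < N) (hB : 1 ≤ B) (hq : q + 1 ≤ B) (hL : 2 * q + 1 ≤ L)
    (hσ : ∀ i, Nat.size (σ i) ≤ B) (hψ : QBounded B ψ) (h0 : σ 0 = N) (h3 : σ 3 = 2 ^ q)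
    (h7 : σ 7 = x) (hx : x < 2 ^ q) :
    Det O B L contfrac σ ψ fun σ' ψ' => ψ' = ψ ∧ Frame B {9, 13, 14, 15, 16, 17} σ σ' ∧
      1 ≤ σ' 9 ∧ σ' 9 ≤ 2 * N ∧ ∀ ℓ ≤ N, IsClose N ℓ (2 ^ q) x → σ' 9 = ℓ := by
  set Q := 2 ^ q with hQ
  have hQ0 : 0 < Q := by positivity
  have hsQ : ∀ {a}, a ≤ Q → Nat.size a ≤ B := fun h => size_le_of_lt_two_pow (q := q + 1)
    (lt_of_le_of_lt h (Nat.pow_lt_pow_right (by norm_num) (by omega))) hq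
  have f0 := Frame.refl hσ {9, 13, 14, 15, 16, 17}
  have f1 := f0.update (i := 13) (a := Q) (by simp) (hsQ le_rfl)
  refine Det.assign_seq ⟨hB, f0.size_le, hψ⟩ ?_
  rw [show (reg 3).eval σ = Q from h3]
  have f2 := f1.update (i := 14) (a := x) (by simp) (hsQ hx.le)
  refine Det.assign_seq ⟨hB, f1.size_le, hψ⟩ ?_
  rw [show (reg 7).eval (Function.update σ 13 Q) = x by simp [h7]]
  have f3 := f2.update (i := 15) (a := 0) (by simp) (hsQ (by omega))
  refine Det.assign_seq ⟨hB, f2.size_le, hψ⟩ ?_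
  have f4 := f3.update (i := 16) (a := 1) (by simp) (hsQ hQ0)
  refine Det.assign_seq ⟨hB, f3.size_le, hψ⟩ ?_
  refine Det.seq (Det.loop (fun i σ' ψ' => ContfracInv B N Q x σ i σ' ∧ ψ' = ψ)
    ⟨⟨f4, ?_, ?_, ?_, ?_, ?_, ?_⟩, rfl⟩
    ?_ ?_) ?_
  · exact ⟨1, 0, by simpa using IsConvergent.init Q x⟩
  · simpa using hx
  · simp
  · simp
  · simp
  · simpa using Nat.mul_le_mul_left Q hx.le
  · rintro i σ' _ ⟨hi, rfl⟩
    exact ⟨hB, hi.frame.size_le, hψ⟩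
  · rintro i σ' ψ' ⟨hi, hψ'⟩ he
    subst hψ'
    have h0' : σ' 0 = N := by rw [hi.frame.eq 0 (by simp), h0]
    simp only [Expr.eval_mul, Expr.eval_sub, Expr.eval_add, Expr.eval_const, Expr.eval_var, h0',
      mul_ne_zero_iff] at he
    obtain ⟨p₀, p₁, hconv⟩ := hi.conv
    have h14 : 0 < σ' 14 := Nat.pos_of_ne_zero he.2
    have hmod : σ' 13 % σ' 14 < σ' 14 := Nat.mod_lt _ h14
    have hdiv : 1 ≤ σ' 13 / σ' 14 := (Nat.one_le_div_iff h14).mpr hi.lt.le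
    have hnext := hconv.step
    have hle : σ' 16 ≤ σ' 13 / σ' 14 * σ' 16 := Nat.le_mul_of_pos_left _ hdiv
    have hsize : σ' 15 + σ' 13 / σ' 14 * σ' 16 ≤ Q := by
      have := hnext.mul_add_mul
      have : σ' 15 + σ' 13 / σ' 14 * σ' 16 ≤ (σ' 15 + σ' 13 / σ' 14 * σ' 16) * σ' 14 :=
        Nat.le_mul_of_pos_right _ h14
      omega
    refine ⟨?_, (Det.contfracStep (by simp) hi.frame hB hψ (hsQ hsize)).mono ?_⟩
    · have h1 : 2 ^ i ≤ Q * Q := (Nat.le_mul_of_pos_right _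
        (Nat.mul_pos (h14.trans hi.lt) h14)).trans hi.halved
      rw [hQ, ← pow_add] at h1
      have := (Nat.pow_le_pow_iff_right (by norm_num : 1 < 2)).mp h1
      omega
    · rintro σ'' ψ'' ⟨rfl, hf, e13, e14, e15, e16⟩
      refine ⟨⟨hf, ⟨p₁, _, by rw [e13, e14, e15, e16]; exact hnext⟩, by omega, ?_, ?_, ?_, ?_⟩, rfl⟩
      · have := hi.pos; omega
      · have := hi.pos; omega
      · omega
      · have h1 : σ' 13 % σ' 14 * 2 ≤ σ' 13 := by
          have h2 := Nat.div_add_mod (σ' 13) (σ' 14)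
          have h3 : σ' 14 * 1 ≤ σ' 14 * (σ' 13 / σ' 14) := Nat.mul_le_mul_left _ hdiv
          omega
        rw [e13, e14]
        calc 2 ^ (i + 1) * (σ' 14 * (σ' 13 % σ' 14)) =
              2 ^ i * (σ' 13 % σ' 14 * 2 * σ' 14) := by ring
          _ ≤ 2 ^ i * (σ' 13 * σ' 14) := by gcongr
          _ ≤ _ := hi.halved
  · rintro σ' ψ' ⟨i, ⟨hi, hψ'⟩, he⟩
    subst hψ'
    have h0' : σ' 0 = N := by rw [hi.frame.eq 0 (by simp), h0]
    obtain ⟨p₀, p₁, hconv⟩ := hi.conv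
    have h16 := hi.pos
    have h15 := hi.le
    have hone := hi.eq_one
    simp only [Expr.eval_mul, Expr.eval_sub, Expr.eval_add, Expr.eval_const, Expr.eval_var, h0',
      mul_eq_zero] at he
    refine Det.ite ⟨hB, hi.frame.size_le, hψ⟩ (fun hc => ?_) (fun hc => ?_) <;>
      simp only [Expr.eval_sub, Expr.eval_add, Expr.eval_mul, Expr.eval_const, Expr.eval_var,
        h0'] at hc
    · refine Det.assign ⟨hB, hi.frame.size_le, hψ⟩
        ⟨rfl, hi.frame.update (by simp) (hi.frame.size_le 16), ?_⟩
      simp only [Function.update_self, Expr.eval_var]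
      refine ⟨h16, by omega, fun ℓ _ hcl => ?_⟩
      rw [he.resolve_left hc] at hconv
      exact hconv.eq_of_isClose_of_eq_zero hQ0 (by omega) hcl
    · refine Det.assign ⟨hB, hi.frame.size_le, hψ⟩
        ⟨rfl, hi.frame.update (by simp) (hi.frame.size_le 15), ?_⟩
      simp only [Function.update_self, Expr.eval_var]
      exact ⟨by omega, h15, fun ℓ hℓ hcl => hconv.eq_of_isClose_of_lt hQ0 h15 (by omega) hℓ hcl⟩

/-! ### Repetition -/

open scoped Classical in
/-- If an iteration reaches a good state from a bad one with probability at least `a`, and leaves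
the good states with probability at most `b`, then after `k` iterations the state is good except
with probability `k b + (1 - a) ^ k`. -/
theorem Ens.repeat {Good : Store → Prop} {Inv : Store → QState → Prop} {i k : ℕ} {a b : ℝ}
    (ha : a ≤ 1) (hb : 0 ≤ b) (ha0 : 0 ≤ a) (hk : k ≤ L) (hi : σ i = k) (hI : Inv σ ψ)
    (hB : ∀ σ ψ, Inv σ ψ → Bounded B σ ψ)
    (hc : ∀ σ ψ, Inv σ ψ → Ens O B L c σ ψ (fun σ' ψ' => Inv σ' ψ' ∧ σ' i = σ i - 1)
      (fun σ' ψ' => if Good σ' then normSq ψ' else 0) ((if Good σ then 1 - b else a) * normSq ψ)) :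
    Ens O B L (.loop (reg i) c) σ ψ Inv (fun σ' ψ' => if Good σ' then normSq ψ' else 0)
      ((1 - k * b - (1 - a) ^ k) * normSq ψ) := by
  set V : ℕ → Store → QState → ℝ := fun _ σ ψ =>
    (1 - (σ i : ℝ) * b - if Good σ then 0 else (1 - a) ^ σ i) * normSq ψ with hV
  refine (Ens.loop (fun j σ' ψ' => Inv σ' ψ' ∧ σ' i + j = k) V ⟨hI, by omega⟩
    (fun _ σ ψ h => hB σ ψ h.1) ?_ ?_).mono (W := fun σ' ψ' => if Good σ' then normSq ψ' else 0)
    (fun _ _ ⟨_, h, _⟩ => ⟨h.1, le_rfl⟩) ?_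
  · rintro j σ ψ ⟨hI, hj⟩ he
    have he : σ i ≠ 0 := he
    obtain ⟨r, hr⟩ : ∃ r, σ i = r + 1 := ⟨σ i - 1, by omega⟩
    refine ⟨by omega, ?_⟩
    have hp : 0 ≤ (1 - a) ^ r := pow_nonneg (by linarith) r
    have hp1 : (1 - a) ^ r ≤ 1 := pow_le_one₀ (by linarith) (by linarith)
    refine ((hc σ ψ hI).affine (1 - r * b - (1 - a) ^ r) hp).mono ?_ ?_
    · rintro σ' ψ' ⟨hI', hi'⟩
      rw [hr, Nat.add_sub_cancel] at hi'
      refine ⟨⟨hI', by omega⟩, le_of_eq ?_⟩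
      simp only [hV, hi']
      split_ifs <;> ring
    · simp only [hV, hr]
      have hn := normSq_nonneg ψ
      rw [← mul_assoc, ← add_mul]
      refine mul_le_mul_of_nonneg_right ?_ hn
      push_cast
      split_ifs
      · nlinarith
      · rw [pow_succ]; nlinarith
  · rintro j σ ψ ⟨hI, hj⟩ he
    have he : σ i = 0 := he
    simp only [hV, he]
    split_ifs <;> simp
  · simp only [hV, hi]
    refine mul_le_mul_of_nonneg_right ?_ (normSq_nonneg ψ)
    have hp : 0 ≤ (1 - a) ^ k := pow_nonneg (by linarith) k
    split_ifs <;> linarith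

/-! ### One attempt to find the period -/

/-- The classical registers between the iterations of both stages: the registers `0`, `2` and `3`
hold the input `N`, the number `q` of qubits and `2 ^ q`, and register `5` holds the current guess
for the period. -/
structure Ready (B N q : ℕ) (σ : Store) : Prop where
  size_le : ∀ i, Nat.size (σ i) ≤ B
  reg_zero : σ 0 = N
  reg_two : σ 2 = q
  reg_three : σ 3 = 2 ^ q
  one_le : 1 ≤ σ 5
  le : σ 5 ≤ 2 * N

theorem Ready.of_frame {N q : ℕ} {σ' : Store} {S : Finset ℕ} (h : Ready B N q σ)
    (hf : Frame B S σ σ')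
    (h0 : 0 ∉ S := by simp) (h2 : 2 ∉ S := by simp) (h3 : 3 ∉ S := by simp)
    (h5 : 5 ∉ S := by simp) : Ready B N q σ' where
  size_le := hf.size_le
  reg_zero := by rw [hf.eq 0 h0, h.reg_zero]
  reg_two := by rw [hf.eq 2 h2, h.reg_two]
  reg_three := by rw [hf.eq 3 h3, h.reg_three]
  one_le := by rw [hf.eq 5 h5]; exact h.one_le
  le := by rw [hf.eq 5 h5]; exact h.le

theorem Ready.frame {N q : ℕ} (h : Ready B N q σ) (S : Finset ℕ) : Frame B S σ σ :=
  .refl h.size_le S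

theorem single_zero_eq_regState (j q : ℕ) (α : ℂ) :
    Finsupp.single 0 α = regState j (2 ^ q) fun x => if x = 0 then α else 0 := by
  rw [regState, Finset.sum_eq_single_of_mem 0 (by simp)]
  · simp
  · intro x _ hx; simp [hx]

theorem det_uniform {N q : ℕ} {α : ℂ} (hB : q + 1 ≤ B) (hL : q ≤ L) (hσ : Ready B N q σ) :
    Det O B L (qft 2 0) σ (Finsupp.single 0 α) fun σ' ψ' => Frame B {10, 11, 12} σ σ' ∧
      ψ' = regState 0 (2 ^ q) fun _ => ((Real.sqrt (2 ^ q : ℕ) : ℝ) : ℂ)⁻¹ * α := by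
  rw [single_zero_eq_regState 2 q]
  refine (Det.qft (by norm_num) (by omega) hB hL hσ.size_le hσ.reg_two hσ.reg_three).mono ?_
  rintro σ' _ ⟨hf, rfl⟩
  refine ⟨hf, congrArg _ (funext fun v => ?_)⟩
  rw [ft, Finset.sum_eq_single_of_mem 0 (by simp)]
  · simp
  · intro x _ hx; simp [hx]

/-- Prepare the Fourier transform of the values of the black box `0` in the quantum register `2`,
provided that the measurement of the vanishing of the values, stored in register `6`, has the
outcome `1`. -/
def prepare : Cmd := qft 2 0 ;; flag ;; phaseOracle 0 (qu 0) ;; qft 0 2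

/-- The probability that the value of `f` at a random argument below `2 ^ q` does not vanish. -/
noncomputable def density (q : ℕ) (f : ℤ → ℂ) : ℝ :=
  ∑ x ∈ Finset.range (2 ^ q), ‖valueState q f x‖ ^ 2

theorem norm_valueState_sq (q : ℕ) (f : ℤ → ℂ) (x : ℕ) :
    ‖valueState q f x‖ ^ 2 = if f x = 0 then 0 else ((2 ^ q : ℕ) : ℝ)⁻¹ := by
  rw [valueState, norm_mul, mul_pow, norm_inv_sqrt_sq, norm_approxValue_sq]
  split_ifs <;> simp

theorem sum_inv_two_pow (q : ℕ) : ∑ _x ∈ Finset.range (2 ^ q), ((2 ^ q : ℕ) : ℝ)⁻¹ = 1 := by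
  rw [Finset.sum_const, Finset.card_range, nsmul_eq_mul, mul_inv_cancel₀ (by positivity)]

theorem one_sub_density (q : ℕ) (f : ℤ → ℂ) :
    1 - density q f = ∑ x ∈ Finset.range (2 ^ q), if f x = 0 then ((2 ^ q : ℕ) : ℝ)⁻¹ else 0 := by
  rw [density, ← sum_inv_two_pow q, ← Finset.sum_sub_distrib]
  refine Finset.sum_congr rfl fun x _ => ?_
  rw [norm_valueState_sq]
  split_ifs <;> simp

/-- If the value of the black box is found not to vanish, the state is proportional to the Fourier
transform of `valueState`; otherwise it is only known to have the weight of that outcome. The payoff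
for the latter outcome, `κ` times its weight, and that for the former, `r`, are chosen by the
caller. -/
theorem Ens.prepare {N q : ℕ} {α : ℂ} (κ r : ℝ) (hB : q + 1 ≤ B) (hL : q ≤ L)
    (hσ : Ready B N q σ) (hα : α ≠ 0) (hp : 0 < density q (O 0)) :
    Ens O B L prepare σ (Finsupp.single 0 α)
      (fun σ' ψ' => Frame B {6, 10, 11, 12} σ σ' ∧ ∃ β, ψ' = regState 2 (2 ^ q) β ∧
        ((σ' 6 = 1 ∧ ∀ v, β v = α * ft (2 ^ q) (valueState q (O 0)) v) ∨
          (σ' 6 = 0 ∧ ∑ v ∈ Finset.range (2 ^ q), ‖β v‖ ^ 2 = ‖α‖ ^ 2 * (1 - density q (O 0)))))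
      (fun σ' _ => if σ' 6 = 0 then κ * (‖α‖ ^ 2 * (1 - density q (O 0))) else r)
      (κ * (‖α‖ ^ 2 * (1 - density q (O 0))) + r) := by
  set Q := 2 ^ q with hQ
  have hQ0 : 0 < Q := by positivity
  set γ : ℂ := ((Real.sqrt Q : ℝ) : ℂ)⁻¹ with hγ
  have hγ0 : γ * α ≠ 0 := by
    refine mul_ne_zero (inv_ne_zero ?_) hα
    exact_mod_cast (Real.sqrt_pos.mpr (by exact_mod_cast hQ0)).ne'
  have hγ2 : ‖γ * α‖ ^ 2 = (Q : ℝ)⁻¹ * ‖α‖ ^ 2 := by rw [norm_mul, mul_pow, norm_inv_sqrt_sq]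
  refine Det.seq_ens (det_uniform hB hL hσ) ?_
  rintro σ₁ _ ⟨hf₁, rfl⟩
  have hσ₁ := hσ.of_frame hf₁
  have hf₁' := (Frame.refl hσ.size_le ∅).trans hf₁ (by simp)
  set r' : ℕ → ℝ := fun c => if c = 0 then κ * (‖α‖ ^ 2 * (1 - density q (O 0))) else r with hr'
  refine Ens.seq (W' := fun σ' _ => r' (σ' 6)) ((Ens.flag r' (by omega) (by omega) hσ₁.size_le
    ?_).mono (fun _ _ h => ⟨h, le_rfl⟩) (by simp [hr'])) ?_
  · intro c hc h
    obtain rfl | rfl : c = 0 ∨ c = 1 := by omega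
    · have : 1 - density q (O 0) = 0 := by
        rw [one_sub_density]
        refine Finset.sum_eq_zero fun x hx => if_neg fun h0 => ?_
        exact hγ0 (h x (Finset.mem_range.mp hx) (if_pos h0))
      simp [hr', this]
    · exfalso
      refine hp.ne' (Finset.sum_eq_zero fun x hx => ?_)
      rw [norm_valueState_sq]
      refine if_pos ?_
      by_contra h0
      exact hγ0 (h x (Finset.mem_range.mp hx) (if_neg h0))
  · rintro _ _ ⟨c, hc, rfl, rfl⟩
    have hf₂ : Frame B {6, 10, 11, 12} σ (Function.update σ₁ 6 c) :=
      (hf₁.trans (Frame.refl hf₁.size_le {6, 10, 11, 12}) (by simp)).update (by simp)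
        (size_le_of_lt_two_pow (q := 1) (by omega) (by omega))
    have hσ₂ := hσ.of_frame hf₂
    refine Det.seq_ens (Det.phaseOracle (by norm_num) (by omega) hB hσ₂.size_le hσ₂.reg_two) ?_
    rintro _ _ ⟨hσ', rfl⟩
    rw [hσ']
    refine Det.ens (Det.qft (by norm_num) (by omega) hB hL hσ₂.size_le hσ₂.reg_two hσ₂.reg_three) ?_
    rintro σ' _ ⟨hf₃, rfl⟩
    have h6 : σ' 6 = c := by rw [hf₃.eq 6 (by simp)]; simp
    refine ⟨⟨hf₂.trans (hf₃.trans (Frame.refl hf₃.size_le {6, 10, 11, 12}) (by simp)) subset_rfl,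
      _, rfl, ?_⟩, le_of_eq (by simp [hr', h6])⟩
    rw [h6]
    obtain rfl | rfl : c = 0 ∨ c = 1 := by omega
    · refine .inr ⟨rfl, ?_⟩
      rw [sum_norm_ft_sq hQ0, one_sub_density, Finset.mul_sum]
      refine Finset.sum_congr rfl fun x _ => ?_
      rw [norm_mul, norm_approxPhase, one_mul]
      by_cases h0 : O 0 x = 0
      · simp only [h0, if_true]; rw [hγ2, mul_comm]
      · simp [h0]
    · refine .inl ⟨rfl, fun v => ?_⟩
      rw [← ft_const_mul]
      refine ft_congr (fun x _ => ?_) v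
      simp only [Expr.eval_var, Sum.elim_inr, ket_self, valueState, approxValue]
      by_cases h0 : O 0 x = 0
      · simp [h0]
      · simp only [h0, if_false, if_true]; ring

/-- One attempt to find the period. -/
def periodStep : Cmd :=
  prepare ;; sample 2 7 ;; contfrac ;; .ite (reg 6) (.assign 5 (reg 9)) .skip ;;
    .assign 8 (reg 8 - .const 1)

open scoped Classical in
/-- With `b` a bound for the probability of a bad sample, a right guess survives with probability at
least `1 - b`, and a wrong one is replaced by the period with probability at least `density - b`. -/
theorem Ens.periodStep {N q ℓ : ℕ} {α : ℂ} (hN : 0 < N) (hB : q + 1 ≤ B) (hL : 2 * q + 1 ≤ L)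
    (hσ : Ready B N q σ) (hα : α ≠ 0) (hp : 0 < density q (O 0)) (hℓ : ℓ ≤ N) {b : ℝ}
    (hclose : ∑ v ∈ (Finset.range (2 ^ q)).filter (fun v => ¬ IsClose N ℓ (2 ^ q) v),
      ‖ft (2 ^ q) (valueState q (O 0)) v‖ ^ 2 ≤ b) :
    Ens O B L periodStep σ (Finsupp.single 0 α)
      (fun σ' ψ' => (Ready B N q σ' ∧ ∃ α : ℂ, α ≠ 0 ∧ ψ' = Finsupp.single 0 α) ∧ σ' 8 = σ 8 - 1)
      (fun σ' ψ' => if σ' 5 = ℓ then normSq ψ' else 0)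
      ((if σ 5 = ℓ then 1 - b else density q (O 0) - b) *
        normSq (Finsupp.single (0 : Store) α)) := by
  set Q := 2 ^ q with hQ
  set p := density q (O 0) with hpd
  have hQ0 : 0 < Q := by positivity
  refine Ens.seq ((Ens.prepare (if σ 5 = ℓ then 1 else 0) (‖α‖ ^ 2 * (p - b)) hB (by omega) hσ hα
    hp).mono (fun _ _ h => ⟨h, le_rfl⟩) ?_) ?_
  · rw [normSq_single, ← hpd]
    have := sq_nonneg ‖α‖
    split_ifs <;> nlinarith
  rintro σ₁ _ ⟨hf₁, β, rfl, hβ⟩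
  have hσ₁ := hσ.of_frame hf₁
  have h15 : σ₁ 5 = σ 5 := hf₁.eq 5 (by simp)
  set g : Store → ℝ := fun τ =>
    if τ 6 = 0 ∧ τ 5 = ℓ ∨ τ 6 ≠ 0 ∧ IsClose N ℓ Q (τ 7) then 1 else 0 with hg
  refine Ens.seq ((Ens.sample g (by omega) (by omega) hσ₁.size_le).mono
    (fun _ _ h => ⟨h, le_rfl⟩) ?_) ?_
  · rcases hβ with ⟨h6, hβ⟩ | ⟨h6, hβ⟩
    · simp only [hg, h6, Function.update_self]
      simp only [ne_eq, not_false_eq_true, Function.update_of_ne, show (6 : ℕ) ≠ 7 by norm_num, h6,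
        one_ne_zero, false_and, true_and, false_or, if_false, hβ, norm_mul, mul_pow, ite_mul,
        one_mul, zero_mul]
      rw [← Finset.sum_filter, ← Finset.mul_sum]
      have h1 := Finset.sum_filter_add_sum_filter_not (Finset.range Q) (fun v => IsClose N ℓ Q v)
        (fun v => ‖ft Q (valueState q (O 0)) v‖ ^ 2)
      rw [sum_norm_ft_sq hQ0,
        show ∑ x ∈ Finset.range Q, ‖valueState q (O 0) x‖ ^ 2 = p from rfl] at h1
      exact mul_le_mul_of_nonneg_left (by linarith) (by positivity)
    · simp only [hg, h6, Function.update_self]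
      simp only [ne_eq, not_false_eq_true, Function.update_of_ne, show (6 : ℕ) ≠ 7 by norm_num,
        show (5 : ℕ) ≠ 7 by norm_num, h6, h15, true_and, not_true_eq_false, false_and, or_false,
        if_true]
      rw [← Finset.mul_sum, hβ]
  rintro _ _ ⟨x, hx, α', hα', rfl, rfl⟩
  have hf₂ : Frame B {7} σ₁ (Function.update σ₁ 7 x) :=
    (hσ₁.frame _).update (by simp) (size_le_of_lt_two_pow hx (by omega))
  have hσ₂ := hσ₁.of_frame hf₂
  have hψ : QBounded B (Finsupp.single (0 : Store) α') := QBounded.single (by simp) _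
  refine Det.seq_ens (Det.contfrac hN (by omega) hB hL hσ₂.size_le hψ hσ₂.reg_zero
    hσ₂.reg_three (by simp) hx) ?_
  rintro σ₃ ψ' ⟨rfl, hf₃, h9, h9', hcf⟩
  have hσ₃ := hσ₂.of_frame hf₃
  have hfix : ∀ i ∉ ({6, 7, 9, 10, 11, 12, 13, 14, 15, 16, 17} : Finset ℕ), σ₃ i = σ i := by
    intro i hi
    simp only [Finset.mem_insert, Finset.mem_singleton, not_or] at hi
    rw [hf₃.eq i (by simp; omega), hf₂.eq i (by simp; omega), hf₁.eq i (by simp; omega)]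
  have h36 : σ₃ 6 = Function.update σ₁ 7 x 6 := hf₃.eq 6 (by simp)
  refine Det.seq_ens (Det.ite (Post := fun σ' ψ' => ψ' = Finsupp.single 0 α' ∧ Frame B {5} σ₃ σ' ∧
    σ' 5 = if σ₃ 6 = 0 then σ₃ 5 else σ₃ 9) ⟨by omega, hσ₃.size_le, hψ⟩
    (fun h => Det.assign ⟨by omega, hσ₃.size_le, hψ⟩ ⟨rfl, (hσ₃.frame _).update (by simp)
      (hσ₃.size_le 9), ?_⟩) (fun h => Det.skip ⟨rfl, hσ₃.frame _, ?_⟩)) ?_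
  · have h : σ₃ 6 ≠ 0 := h
    simp [h]
  · have h : σ₃ 6 = 0 := h
    simp [h]
  rintro σ₄ _ ⟨rfl, hf₄, h45⟩
  have hf₅ : Frame B {8} σ₄ (Function.update σ₄ 8 (σ₄ 8 - 1)) :=
    (Frame.refl hf₄.size_le _).update (by simp)
      ((Nat.size_le_size (Nat.sub_le _ _)).trans (hf₄.size_le 8))
  refine Det.ens (Det.assign (Post := fun σ' ψ' => σ' = Function.update σ₄ 8 (σ₄ 8 - 1) ∧
    ψ' = Finsupp.single 0 α') ⟨by omega, hf₄.size_le, hψ⟩ ⟨rfl, rfl⟩) ?_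
  rintro _ _ ⟨rfl, rfl⟩
  have h55 : Function.update σ₄ 8 (σ₄ 8 - 1) 5 = if σ₃ 6 = 0 then σ₃ 5 else σ₃ 9 := by
    simpa using h45
  refine ⟨⟨⟨⟨hf₅.size_le, ?_, ?_, ?_, ?_, ?_⟩, α', hα', rfl⟩, ?_⟩, ?_⟩
  · simpa [hf₄.eq 0 (by simp)] using hσ₃.reg_zero
  · simpa [hf₄.eq 2 (by simp)] using hσ₃.reg_two
  · simpa [hf₄.eq 3 (by simp)] using hσ₃.reg_three
  · rw [h55]; split_ifs
    exacts [hσ₃.one_le, h9]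
  · rw [h55]; split_ifs
    exacts [hσ₃.le, h9']
  · rw [Function.update_self, hf₄.eq 8 (by simp), hfix 8 (by simp)]
  · rw [h55]
    have hn := normSq_nonneg (Finsupp.single (0 : Store) α')
    have key : g (Function.update σ₁ 7 x) = 1 → (if σ₃ 6 = 0 then σ₃ 5 else σ₃ 9) = ℓ := by
      intro h
      simp only [hg, ← h36, ite_eq_left_iff, zero_ne_one, imp_false, not_not] at h
      rcases h with ⟨h, h'⟩ | ⟨h, h'⟩
      · rw [if_pos h, hf₃.eq 5 (by simp), h']
      · rw [if_neg h]
        exact hcf ℓ hℓ (by simpa using h')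
    by_cases h : g (Function.update σ₁ 7 x) = 1
    · rw [if_pos (key h), h, one_mul]
    · have h0 : g (Function.update σ₁ 7 x) = 0 := by
        simp only [hg] at h ⊢
        split_ifs at h ⊢ <;> simp_all
      rw [h0, zero_mul]
      split_ifs <;> first | exact hn | exact le_rfl

/-! ### One attempt to find the shift -/

/-- Sample a candidate for the shift, and accept it as the new guess in register `1` if register
`9`, in which the outcome of the verification of the previous guess is recorded, is not zero. -/
def recover : Cmd :=
  prepare ;; phaseOracle 1 ((.const 2 * qu 2 * cl 5 + cl 3) / (.const 2 * cl 3)) ;; qft 2 0 ;;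
    sample 0 7 ;; .ite (reg 9) (.assign 1 (reg 7 + reg 3 * (reg 5 - .const 1))) .skip ;;
      .assign 8 (reg 8 - .const 1)

/-- One attempt to find the shift: verify the current guess at a random argument, and replace
it if it is found to be wrong. -/
def shiftStep : Cmd := qft 2 0 ;; sample 0 7 ;; compare ;; recover

open scoped Classical in
/-- The probability that a candidate for the shift satisfies `G`, if the guess for the period
is `m`. -/
noncomputable def candidateProb (O : Fin 2 → ℤ → ℂ) (q m : ℕ) (G : ℕ → Prop) : ℝ :=
  ∑ z ∈ (Finset.range (2 ^ q)).filter (fun z => G (z + 2 ^ q * (m - 1))),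
    ‖ft (2 ^ q) (fun v => approxPhase q (O 1 (nearest m (2 ^ q) v : ℕ)) *
      ft (2 ^ q) (valueState q (O 0)) v) z‖ ^ 2

open scoped Classical in
/-- The guess is unchanged if the verification succeeded, that is, if register `9` is zero;
otherwise it is replaced by a good candidate with probability at least `candidateProb`. -/
theorem Ens.recover {N q m : ℕ} {α : ℂ} {G : ℕ → Prop} (hB : 2 * q + 1 ≤ B) (hL : 2 * q + 1 ≤ L)
    (hNq : 2 * N ≤ 2 ^ q) (hσ : Ready B N q σ) (hm : σ 5 = m) (hα : α ≠ 0)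
    (hp : 0 < density q (O 0)) :
    Ens O B L recover σ (Finsupp.single 0 α)
      (fun σ' ψ' => (Ready B N q σ' ∧ σ' 5 = m ∧ ∃ α : ℂ, α ≠ 0 ∧ ψ' = Finsupp.single 0 α) ∧
        σ' 8 = σ 8 - 1)
      (fun σ' ψ' => if G (σ' 1) then normSq ψ' else 0)
      ((if σ 9 = 0 then if G (σ 1) then 1 else 0 else candidateProb O q m G) *
        normSq (Finsupp.single (0 : Store) α)) := by
  set Q := 2 ^ q with hQ
  set p := density q (O 0) with hpd
  have hQ0 : 0 < Q := by positivity
  have hC0 : 0 ≤ candidateProb O q m G := Finset.sum_nonneg fun _ _ => by positivity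
  set κ : ℝ := if σ 9 = 0 then if G (σ 1) then 1 else 0 else 0 with hκ
  set r : ℝ := if σ 9 = 0 then if G (σ 1) then p else 0 else candidateProb O q m G with hr
  refine Ens.seq ((Ens.prepare κ (‖α‖ ^ 2 * r) (by omega) (by omega) hσ hα hp).mono
    (fun _ _ h => ⟨h, le_rfl⟩) ?_) ?_
  · rw [normSq_single, ← hpd, hκ, hr]
    refine le_of_eq ?_
    split_ifs <;> ring
  rintro σ₁ _ ⟨hf₁, β, rfl, hβ⟩
  have hσ₁ := hσ.of_frame hf₁
  have h19 : σ₁ 9 = σ 9 := hf₁.eq 9 (by simp)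
  have h11 : σ₁ 1 = σ 1 := hf₁.eq 1 (by simp)
  have h15 : σ₁ 5 = m := by rw [hf₁.eq 5 (by simp), hm]
  refine Det.seq_ens (Det.phaseOracle (by norm_num) (by omega) (by omega) hσ₁.size_le
    hσ₁.reg_two) ?_
  rintro _ _ ⟨hσ', rfl⟩
  rw [hσ']
  refine Det.seq_ens (Det.qft (by norm_num) (by omega) (by omega) (by omega) hσ₁.size_le hσ₁.reg_two
    hσ₁.reg_three) ?_
  rintro σ₂ _ ⟨hf₂, rfl⟩
  have hσ₂ := hσ₁.of_frame hf₂
  have h29 : σ₂ 9 = σ 9 := by rw [hf₂.eq 9 (by simp), h19]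
  have h21 : σ₂ 1 = σ 1 := by rw [hf₂.eq 1 (by simp), h11]
  have h25 : σ₂ 5 = m := by rw [hf₂.eq 5 (by simp), h15]
  set w : ℕ → ℂ := fun v => approxPhase q (O 1 (nearest m Q v : ℕ)) with hw
  have hwe : ∀ x, approxPhase q (O 1 ((((.const 2 * qu 2 * cl 5 + cl 3) / (.const 2 * cl 3)) :
      Expr (ℕ ⊕ ℕ)).eval (Sum.elim σ₁ (ket 2 x)) : ℕ)) = w x := by
    intro x
    simp [hw, nearest, h15, hσ₁.reg_three, hQ]
  simp only [hwe]
  set g : Store → ℝ := fun τ =>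
    if (if σ 9 = 0 then G (σ 1) else G (τ 7 + Q * (m - 1))) then 1 else 0 with hg
  refine Ens.seq ((Ens.sample g (by omega) (by omega) hσ₂.size_le).mono
    (fun _ _ h => ⟨h, le_rfl⟩) ?_) ?_
  · simp only [hg, Function.update_self]
    by_cases h9 : σ 9 = 0
    · simp only [hκ, hr, h9, if_true]
      rw [← Finset.mul_sum, sum_norm_ft_sq hQ0]
      simp only [norm_mul, hw, norm_approxPhase, one_mul]
      rcases hβ with ⟨h6, hβ⟩ | ⟨h6, hβ⟩
      · have h1 : ∑ v ∈ Finset.range Q, ‖β v‖ ^ 2 = ‖α‖ ^ 2 * p := by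
          simp only [hβ, norm_mul, mul_pow]
          rw [← Finset.mul_sum, sum_norm_ft_sq hQ0]; rfl
        rw [h1, h6, if_neg one_ne_zero]
        split_ifs <;> simp
      · rw [hβ, h6, if_pos rfl]
    · simp only [hκ, hr, h9, if_false, zero_mul]
      rcases hβ with ⟨h6, hβ⟩ | ⟨h6, hβ⟩
      · rw [h6, if_neg one_ne_zero, candidateProb, Finset.mul_sum, Finset.sum_filter]
        refine Finset.sum_le_sum fun z _ => ?_
        have h1 : ft Q (fun x => w x * β x) z =
            α * ft Q (fun v => w v * ft Q (valueState q (O 0)) v) z := by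
          rw [← ft_const_mul]
          exact ft_congr (fun v _ => by rw [hβ]; ring) z
        rw [h1, norm_mul, mul_pow]
        split_ifs
        · exact (one_mul _).ge
        · simp
      · rw [h6, if_pos rfl]
        refine Finset.sum_nonneg fun z _ => mul_nonneg ?_ (by positivity)
        split_ifs <;> norm_num
  rintro _ _ ⟨z, hz, α', hα', rfl, rfl⟩
  have hf₃ : Frame B {7} σ₂ (Function.update σ₂ 7 z) :=
    (hσ₂.frame _).update (by simp) (size_le_of_lt_two_pow hz (by omega))
  have hσ₃ := hσ₂.of_frame hf₃
  set σ₃ := Function.update σ₂ 7 z with hσ₃d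
  have h37 : σ₃ 7 = z := by simp [hσ₃d]
  have h39 : σ₃ 9 = σ 9 := by simp [hσ₃d, h29]
  have h31 : σ₃ 1 = σ 1 := by simp [hσ₃d, h21]
  have h35 : σ₃ 5 = m := by simp [hσ₃d, h25]
  have h38 : σ₃ 8 = σ 8 := by
    simp [hσ₃d, hf₂.eq 8 (by simp), hf₁.eq 8 (by simp)]
  have hψ : QBounded B (Finsupp.single (0 : Store) α') := QBounded.single (by simp) _
  have hT : Nat.size (z + Q * (m - 1)) ≤ B := by
    refine size_le_of_lt_two_pow (q := 2 * q) ?_ (by omega)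
    have h1 := hσ.one_le
    have h2 := hσ.le
    calc z + Q * (m - 1) < Q * 1 + Q * (m - 1) := by omega
      _ = Q * m := by rw [← mul_add]; congr 1; omega
      _ ≤ Q * Q := Nat.mul_le_mul_left _ (by omega)
      _ = 2 ^ (2 * q) := by rw [hQ, ← pow_add, two_mul]
  have he : (reg 7 + reg 3 * (reg 5 - .const 1)).eval σ₃ = z + Q * (m - 1) := by
    simp [h37, h35, hσ₃.reg_three, hQ]
  refine Det.seq_ens (Det.ite (Post := fun σ' ψ' => ψ' = Finsupp.single 0 α' ∧ Frame B {1} σ₃ σ' ∧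
    σ' 1 = if σ 9 = 0 then σ 1 else z + Q * (m - 1)) ⟨by omega, hσ₃.size_le, hψ⟩
    (fun h => Det.assign ⟨by omega, hσ₃.size_le, hψ⟩ ⟨rfl, (hσ₃.frame _).update (by simp)
      (he ▸ hT), ?_⟩) (fun h => Det.skip ⟨rfl, hσ₃.frame _, ?_⟩)) ?_
  · have h : σ₃ 9 ≠ 0 := h
    rw [Function.update_self, he, if_neg (h39 ▸ h)]
  · have h : σ₃ 9 = 0 := h
    rw [if_pos (h39 ▸ h), h31]
  rintro σ₄ _ ⟨rfl, hf₄, h41⟩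
  have hσ₄ := hσ₃.of_frame hf₄
  have hf₅ : Frame B {8} σ₄ (Function.update σ₄ 8 (σ₄ 8 - 1)) :=
    (hσ₄.frame _).update (by simp) ((Nat.size_le_size (Nat.sub_le _ _)).trans (hf₄.size_le 8))
  refine Det.ens (Det.assign (Post := fun σ' ψ' => σ' = Function.update σ₄ 8 (σ₄ 8 - 1) ∧
    ψ' = Finsupp.single 0 α') ⟨by omega, hf₄.size_le, hψ⟩ ⟨rfl, rfl⟩) ?_
  rintro _ _ ⟨rfl, rfl⟩
  refine ⟨⟨⟨hσ₄.of_frame hf₅, ?_, α', hα', rfl⟩, ?_⟩, ?_⟩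
  · rw [hf₅.eq 5 (by simp), hf₄.eq 5 (by simp), h35]
  · rw [Function.update_self, hf₄.eq 8 (by simp), h38]
  · rw [hf₅.eq 1 (by simp), h41]
    have hn := normSq_nonneg (Finsupp.single (0 : Store) α')
    simp only [hg, h37]
    by_cases h9 : σ 9 = 0
    · simp only [h9, if_true]
      split_ifs <;> simp
    · simp only [h9, if_false]
      split_ifs <;> simp

open scoped Classical in
/-- The probability that the guess is good after the step is an average over the random argument `x`
at which the old guess `σ 1` is verified. -/
theorem Ens.shiftStep {N q m : ℕ} {α : ℂ} {G : ℕ → Prop} (hB : 2 * q + 1 ≤ B)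
    (hL : 2 * q + 1 ≤ L) (hNq : 2 * N ≤ 2 ^ q) (hσ : Ready B N q σ) (hm : σ 5 = m)
    (hp : 0 < density q (O 0)) :
    Ens O B L shiftStep σ (Finsupp.single 0 α)
      (fun σ' ψ' => (Ready B N q σ' ∧ σ' 5 = m ∧ ∃ α : ℂ, α ≠ 0 ∧ ψ' = Finsupp.single 0 α) ∧
        σ' 8 = σ 8 - 1)
      (fun σ' ψ' => if G (σ' 1) then normSq ψ' else 0)
      ((∑ x ∈ Finset.range (2 ^ q), (if phaseCode q (O 0 (x : ℕ)) =
          phaseCode q (O 1 ((x + σ 1 : ℕ) : ℤ)) then if G (σ 1) then 1 else 0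
            else candidateProb O q m G) * ((2 ^ q : ℕ) : ℝ)⁻¹) *
        normSq (Finsupp.single (0 : Store) α)) := by
  set Q := 2 ^ q with hQ
  refine Det.seq_ens (det_uniform (by omega) (by omega) hσ) ?_
  rintro σ₁ _ ⟨hf₁, rfl⟩
  have hσ₁ := hσ.of_frame hf₁
  have h11 : σ₁ 1 = σ 1 := hf₁.eq 1 (by simp)
  set g : Store → ℝ := fun τ => if phaseCode q (O 0 (τ 7 : ℕ)) =
    phaseCode q (O 1 ((τ 7 + σ 1 : ℕ) : ℤ)) then if G (σ 1) then 1 else 0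
      else candidateProb O q m G with hg
  refine Ens.seq ((Ens.sample g (by omega) (by omega) hσ₁.size_le).mono
    (fun _ _ h => ⟨h, le_rfl⟩) (le_of_eq ?_)) ?_
  · rw [Finset.sum_mul]
    refine Finset.sum_congr rfl fun x _ => ?_
    simp only [hg, Function.update_self]
    rw [norm_mul, mul_pow, norm_inv_sqrt_sq, normSq_single, mul_assoc]
  rintro _ _ ⟨x, hx, α', hα', rfl, rfl⟩
  have hf₂ : Frame B {7} σ₁ (Function.update σ₁ 7 x) :=
    (hσ₁.frame _).update (by simp) (size_le_of_lt_two_pow hx (by omega))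
  have hσ₂ := hσ₁.of_frame hf₂
  refine Det.seq_ens (Det.compare hα' (by omega) (by omega) hσ₂.size_le hσ₂.reg_two) ?_
  rintro σ₃ _ ⟨rfl, hf₃, h39⟩
  have hσ₃ := hσ₂.of_frame hf₃
  have hfix : ∀ i ∉ ({7, 9, 10, 11, 12} : Finset ℕ), σ₃ i = σ i := by
    intro i hi
    simp only [Finset.mem_insert, Finset.mem_singleton, not_or] at hi
    rw [hf₃.eq i (by simp; omega), hf₂.eq i (by simp; omega), hf₁.eq i (by simp; omega)]
  rw [hf₂.eq 1 (by simp), h11, Function.update_self] at h39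
  refine (Ens.recover (G := G) hB hL hNq hσ₃ (by rw [hfix 5 (by simp), hm]) hα' hp).mono
    (fun σ' ψ' h => ⟨⟨h.1, by rw [h.2, hfix 8 (by simp)]⟩, le_rfl⟩) (le_of_eq ?_)
  rw [hfix 1 (by simp)]
  simp only [hg, Function.update_self, h39]

/-! ### The algorithm -/

/-- The cube of the input. -/
def inputCube : Expr ℕ := reg 0 * reg 0 * reg 0

/-- Find the number `q` of qubits, the least one with `2 ^ 40 * N ^ 12 ≤ 2 ^ q`. -/
def chooseQubits : Cmd :=
  .assign 3 (.const 1) ;;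
    .loop (.const (2 ^ 40) * (inputCube * inputCube * (inputCube * inputCube)) - reg 3)
      (.assign 3 (reg 3 * .const 2) ;; .assign 2 (reg 2 + .const 1)) ;;
        .assign 5 (.const 1) ;; .assign 8 (.const 16 * reg 2)

/-- The algorithm: on input `N`, it first finds the period and then the shift. -/
def program : Cmd :=
  chooseQubits ;; .loop (reg 8) periodStep ;; .assign 8 (.const 1024 * reg 2 * reg 2 * reg 2) ;;
    .loop (reg 8) shiftStep ;; .assign 0 (reg 5)

theorem pow_four_le_two_pow {q : ℕ} (hq : 16 ≤ q) : q ^ 4 ≤ 2 ^ q := by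
  induction q, hq using Nat.le_induction with
  | base => norm_num
  | succ q hq ih =>
      obtain ⟨r, rfl⟩ := Nat.exists_eq_add_of_le hq
      have h : (16 + r + 1) ^ 4 ≤ 2 * (16 + r) ^ 4 := by
        have : 2 * (16 + r) ^ 4 = (16 + r + 1) ^ 4 + (r ^ 4 + 60 * r ^ 3 + 1338 * r ^ 2 + 13116 * r
          + 47551) := by ring
        omega
      rw [pow_succ 2]
      omega

/-- The program tests a condition on `q` that does not involve powers of `q`. It implies the one
under which the Fourier transform is precise enough, as `q ^ 4 ≤ 2 ^ q`. -/
theorem le_two_pow {N q : ℕ} (hN : 0 < N) (h : 2 ^ 40 * N ^ 12 ≤ 2 ^ q) :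
    40 ≤ q ∧ 2 ^ 20 * N ^ 6 * q ^ 2 ≤ 2 ^ q := by
  have hq : 40 ≤ q := by
    have : 2 ^ 40 ≤ 2 ^ q := (Nat.le_mul_of_pos_right _ (by positivity)).trans h
    exact (Nat.pow_le_pow_iff_right (by norm_num)).mp this
  refine ⟨hq, ?_⟩
  rw [← Nat.pow_le_pow_iff_left (two_ne_zero)]
  calc (2 ^ 20 * N ^ 6 * q ^ 2) ^ 2 = 2 ^ 40 * N ^ 12 * q ^ 4 := by ring
    _ ≤ 2 ^ q * 2 ^ q := Nat.mul_le_mul h (pow_four_le_two_pow (by omega))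
    _ = (2 ^ q) ^ 2 := by ring

theorem size_le_of_le {a : ℕ} (h : a ≤ B) : Nat.size a ≤ B :=
  (Nat.size_le.mpr Nat.lt_two_pow_self).trans h

/-- The number of qubits is linear in the size of the input; the loop ends because
`2 ^ 40 * N ^ 12 ≤ 2 ^ (40 + 12 * size N)`. -/
theorem Det.chooseQubits {N : ℕ} (hN : 0 < N) (hB : 1024 * (60 + 12 * Nat.size N) ≤ B)
    (hL : 1024 * (60 + 12 * Nat.size N) ≤ L) :
    Det O B L chooseQubits (Function.update 0 0 N) (Finsupp.single 0 1) fun σ' ψ' =>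
      ψ' = Finsupp.single 0 1 ∧ ∃ q, q ≤ 40 + 12 * Nat.size N ∧ 2 ^ 40 * N ^ 12 ≤ 2 ^ q ∧
        Ready B N q σ' ∧ σ' 8 = 16 * q := by
  set S := Nat.size N with hS
  have hb : 2 ^ 40 * N ^ 12 ≤ 2 ^ (40 + 12 * S) := by
    rw [pow_add, pow_mul']
    exact Nat.mul_le_mul_left _ (Nat.pow_le_pow_left (Nat.lt_size_self N).le 12)
  have hψ : QBounded B (Finsupp.single (0 : Store) (1 : ℂ)) := QBounded.single (by simp) _
  have hσ : ∀ i, Nat.size (Function.update (0 : Store) 0 N i) ≤ B :=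
    size_update_le (by simp) 0 (by omega)
  have hB1 : 1 ≤ B := by omega
  have f0 := Frame.refl hσ {2, 3}
  have f1 := f0.update (i := 3) (a := 1) (by simp) (size_le_of_le hB1)
  refine Det.assign_seq ⟨hB1, f0.size_le, hψ⟩ ?_
  refine Det.seq (Det.loop (fun i σ' ψ' => i ≤ 40 + 12 * S ∧
    Frame B {2, 3} (Function.update 0 0 N) σ' ∧ σ' 2 = i ∧ σ' 3 = 2 ^ i ∧
      ψ' = Finsupp.single 0 1) ⟨by omega, f1, by simp, by simp, rfl⟩ ?_ ?_) ?_
  · rintro i σ' _ ⟨-, hf, -, -, rfl⟩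
    exact ⟨hB1, hf.size_le, hψ⟩
  · rintro i σ' _ ⟨hi, hf, h2, h3, rfl⟩ he
    have h0 : σ' 0 = N := by rw [hf.eq 0 (by simp)]; simp
    have hlt : i < 40 + 12 * S := by
      rw [← Nat.pow_lt_pow_iff_right (a := 2) (by norm_num)]
      have e : (Expr.const (2 ^ 40) * (inputCube * inputCube * (inputCube * inputCube)) -
          reg 3).eval σ' = 2 ^ 40 * N ^ 12 - 2 ^ i := by
        simp only [inputCube, Expr.eval_sub, Expr.eval_mul, Expr.eval_const, Expr.eval_var, h0, h3]
        congr 1; ring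
      rw [e] at he
      omega
    refine ⟨by omega, ?_⟩
    have f2 := hf.update (i := 3) (a := (reg 3 * .const 2).eval σ') (by simp) (by
      simp only [Expr.eval_mul, Expr.eval_var, Expr.eval_const, h3, ← pow_succ]
      exact size_le_of_lt_two_pow (q := i + 2) (Nat.pow_lt_pow_right (by norm_num) (by omega))
        (by omega))
    refine Det.assign_seq ⟨hB1, hf.size_le, hψ⟩ ?_
    refine Det.assign ⟨hB1, f2.size_le, hψ⟩ ⟨by omega, f2.update (by simp) ?_, ?_, ?_, rfl⟩
    · refine size_le_of_le ?_
      have : (reg 2 + .const 1).eval (Function.update σ' 3 ((reg 3 * .const 2).eval σ')) =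
          i + 1 := by
        simp [h2]
      omega
    · simp [h2]
    · simp [h3, pow_succ]
  · rintro σ₁ _ ⟨q, ⟨hq, hf, h2, h3, rfl⟩, he⟩
    have h0 : σ₁ 0 = N := by rw [hf.eq 0 (by simp)]; simp
    have hge : 2 ^ 40 * N ^ 12 ≤ 2 ^ q := by
      have e : (Expr.const (2 ^ 40) * (inputCube * inputCube * (inputCube * inputCube)) -
          reg 3).eval σ₁ = 2 ^ 40 * N ^ 12 - 2 ^ q := by
        simp only [inputCube, Expr.eval_sub, Expr.eval_mul, Expr.eval_const, Expr.eval_var, h0, h3]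
        congr 1; ring
      rw [e] at he
      omega
    have g1 := (Frame.refl hf.size_le {5, 8}).update (i := 5) (a := 1) (by simp) (size_le_of_le hB1)
    refine Det.assign_seq ⟨hB1, hf.size_le, hψ⟩ ?_
    have e8 : (Expr.const 16 * reg 2).eval (Function.update σ₁ 5 ((Expr.const 1).eval σ₁)) =
        16 * q := by
      simp [h2]
    have g2 := g1.update (i := 8) (a := 16 * q) (by simp) (size_le_of_le (by omega))
    refine Det.assign ⟨hB1, g1.size_le, hψ⟩ ?_
    rw [e8, Expr.eval_const]
    refine ⟨rfl, q, hq, hge, ⟨g2.size_le, ?_, ?_, ?_, ?_, ?_⟩, by simp⟩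
    · rw [g2.eq 0 (by simp), h0]
    · rw [g2.eq 2 (by simp), h2]
    · rw [g2.eq 3 (by simp), h3]
    · simp
    · simp; omega

/-- After `4 / a` independent attempts with probability of success `a`, the probability of failure
is at most `exp (-4) < 1 / 50`. -/
theorem one_sub_pow_le {a : ℝ} {k : ℕ} (ha : a ≤ 1) (h : 4 ≤ k * a) : (1 - a) ^ k ≤ 1 / 50 := by
  calc (1 - a) ^ k ≤ Real.exp (-a) ^ k :=
        pow_le_pow_left₀ (by linarith) (Real.one_sub_le_exp_neg a) k
    _ = Real.exp (-(k * a)) := by rw [← Real.exp_nat_mul]; ring_nf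
    _ ≤ Real.exp (-4) := Real.exp_le_exp.mpr (by linarith)
    _ = 1 / Real.exp 1 ^ 4 := by rw [← Real.exp_nat_mul, one_div, ← Real.exp_neg]; norm_num
    _ ≤ 1 / 2.7 ^ 4 := by
        gcongr
        linarith [Real.exp_one_gt_d9]
    _ ≤ 1 / 50 := by norm_num

section Correctness

variable {ℓ : ℕ} [NeZero ℓ] {χ : DirichletCharacter ℂ ℓ} {s : ℤ} {N q : ℕ}

/-- At least a proportion `φ(ℓ) / ℓ ≥ 1 / q` of each complete period of arguments has `f x ≠ 0`. -/
theorem inv_le_density {f : ℤ → ℂ} (hf : ∀ x : ℤ, f x = χ ((x + s : ℤ) : ZMod ℓ)) (hN : ℓ ≤ N)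
    (hq : 1 ≤ q) (H : 2 ^ 20 * N ^ 6 * q ^ 2 ≤ 2 ^ q) : 1 / (2 * q : ℝ) ≤ density q f := by
  have h := inv_le_sum_norm_ft_valueState hf hN hq H
  rwa [sum_norm_ft_sq (by positivity)] at h

open scoped Classical in
/-- The `16 q` attempts of the first stage end with the period in register `5` with probability at
least `47 / 50`. -/
theorem ens_repeat_periodStep (hχ : χ.IsPrimitive)
    (h0 : ∀ x : ℤ, O 0 x = χ ((x + s : ℤ) : ZMod ℓ)) (hN : ℓ ≤ N) (hq : 1 ≤ q)
    (H : 2 ^ 20 * N ^ 6 * q ^ 2 ≤ 2 ^ q) (hB : 2 * q + 1 ≤ B) (hL : 16 * q ≤ L)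
    (hσ : Ready B N q σ) (h8 : σ 8 = 16 * q) :
    Ens O B L (.loop (reg 8) periodStep) σ (Finsupp.single 0 1)
      (fun σ ψ => Ready B N q σ ∧ ∃ α : ℂ, α ≠ 0 ∧ ψ = Finsupp.single 0 α)
      (fun σ ψ => if σ 5 = ℓ then normSq ψ else 0) (47 / 50) := by
  have hq1 : (1 : ℝ) ≤ q := by exact_mod_cast hq
  have hp := inv_le_density h0 hN hq H
  have ha1 : 1 / (4 * q : ℝ) ≤ 1 := by rw [div_le_one (by positivity)]; linarith
  -- an attempt finds the period with probability `1 / (2 q) - 1 / (400 q) ≥ 1 / (4 q)`; it destroys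
  -- a right guess with probability `1 / (400 q)`, which adds up to `1 / 25` over `16 q` attempts
  refine (Ens.repeat (a := 1 / (4 * q)) (b := 1 / (400 * q)) (Good := fun σ => σ 5 = ℓ)
    (Inv := fun σ ψ => Ready B N q σ ∧ ∃ α : ℂ, α ≠ 0 ∧ ψ = Finsupp.single 0 α) ha1 (by positivity)
    (by positivity) hL h8 ⟨hσ, 1, one_ne_zero, rfl⟩ ?_ ?_).mono
      (fun _ _ h => ⟨h, le_of_eq (by congr)⟩) ?_
  · rintro σ _ ⟨h, α, -, rfl⟩
    exact ⟨by omega, h.size_le, QBounded.single (by simp) _⟩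
  · rintro σ _ ⟨h, α, hα, rfl⟩
    refine (Ens.periodStep ((NeZero.pos ℓ).trans_le hN) (by omega) (by omega) h hα
      (lt_of_lt_of_le (by positivity) hp) hN (sum_not_isClose_le hχ h0 hN hq H)).mono
      (fun _ _ h => ⟨h, le_of_eq (by congr)⟩) (mul_le_mul_of_nonneg_right ?_ (normSq_nonneg _))
    split_ifs
    · exact le_rfl
    · have e1 : 1 / (4 * q : ℝ) = 100 * (1 / (400 * q)) := by field_simp; norm_num
      have e2 : 1 / (2 * q : ℝ) = 200 * (1 / (400 * q)) := by field_simp; norm_num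
      have e3 : 0 ≤ 1 / (400 * q : ℝ) := by positivity
      linarith
  · rw [normSq_single]
    push_cast
    have e1 := one_sub_pow_le (a := 1 / (4 * q : ℝ)) (k := 16 * q) ha1
      (by push_cast; field_simp; norm_num)
    have e2 : 16 * (q : ℝ) * (1 / (400 * q)) = 1 / 25 := by field_simp; norm_num
    rw [e2]
    norm_num
    norm_num at e1
    linarith

theorem candidateProb_nonneg (m : ℕ) (G : ℕ → Prop) : 0 ≤ candidateProb O q m G :=
  Finset.sum_nonneg fun _ _ => by positivity

open scoped Classical in
/-- The probability that an iteration of the second stage ends with the right shift. -/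
theorem le_shiftStep_value (hχ : χ.IsPrimitive)
    (h0 : ∀ x : ℤ, O 0 x = χ ((x + s : ℤ) : ZMod ℓ)) (h1 : ∀ x : ℤ, O 1 x = χ (x : ZMod ℓ))
    (hN : ℓ ≤ N) (hq : 1 ≤ q) (H : 2 ^ 20 * N ^ 6 * q ^ 2 ≤ 2 ^ q) (m t : ℕ) {G : ℕ → Prop}
    (hG : ∀ t : ℕ, G t ↔ m = ℓ ∧ (t : ℤ) ≡ s [ZMOD ℓ]) :
    (if G t then 1 else if m = ℓ then 1 / (128 * q ^ 3 : ℝ) else 0) ≤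
      ∑ x ∈ Finset.range (2 ^ q), (if phaseCode q (O 0 (x : ℕ)) =
          phaseCode q (O 1 ((x + t : ℕ) : ℤ)) then if G t then 1 else 0
            else candidateProb O q m G) * ((2 ^ q : ℕ) : ℝ)⁻¹ := by
  have hC := candidateProb_nonneg (O := O) (q := q) m G
  by_cases hm : m = ℓ
  · subst hm
    by_cases ht : (t : ℤ) ≡ s [ZMOD m]
    · have hGt : G t := (hG t).mpr ⟨rfl, ht⟩
      rw [if_pos hGt]
      refine (sum_inv_two_pow q).ge.trans ?_
      refine Finset.sum_le_sum fun x _ => ?_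
      have : O 0 (x : ℕ) = O 1 ((x + t : ℕ) : ℤ) := by
        rw [h0, h1]
        have := (ZMod.intCast_eq_intCast_iff _ _ _).mpr ht
        push_cast at this ⊢
        rw [this]
      rw [this, if_pos rfl, if_pos hGt, one_mul]
    · have hGt : ¬ G t := fun h => ht ((hG t).mp h).2
      rw [if_neg hGt, if_pos rfl]
      have e1 := le_sum_phaseCode_ne hχ h0 hN hq H ht
      have e2 : 1 / (8 * q ^ 2 : ℝ) ≤ candidateProb O q m G := by
        have h := inv_le_sum_norm_recovered hχ h0 hN hq H
        rw [candidateProb]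
        convert h using 4 with z _ z _
        · simp only [hG, true_and]
        · simp only [h1]; push_cast; rfl
      calc 1 / (128 * q ^ 3 : ℝ) = 1 / (8 * q ^ 2) * (1 / (16 * q)) := by
            rw [div_mul_div_comm]; congr 1 <;> ring
        _ ≤ candidateProb O q m G * _ := mul_le_mul e2 e1 (by positivity) hC
        _ = _ := by
            rw [Finset.mul_sum]
            refine Finset.sum_congr rfl fun x _ => ?_
            rw [h1]
            split_ifs <;> simp
  · have hGt : ¬ G t := fun h => hm ((hG t).mp h).1
    rw [if_neg hGt, if_neg hm]
    refine Finset.sum_nonneg fun x _ => mul_nonneg ?_ (by positivity)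
    split_ifs
    exacts [le_rfl, hC]

open scoped Classical in
/-- If register `5` holds the period, then the `1024 q ^ 3` attempts of the second stage end with a
right shift in register `1` with probability at least `49 / 50`. -/
theorem ens_repeat_shiftStep (hχ : χ.IsPrimitive)
    (h0 : ∀ x : ℤ, O 0 x = χ ((x + s : ℤ) : ZMod ℓ)) (h1 : ∀ x : ℤ, O 1 x = χ (x : ZMod ℓ))
    (hN : ℓ ≤ N) (hq : 1 ≤ q) (H : 2 ^ 20 * N ^ 6 * q ^ 2 ≤ 2 ^ q) (hB : 2 * q + 1 ≤ B)
    (hL : 2 * q + 1 ≤ L) (hL' : 1024 * q ^ 3 ≤ L) (hσ : Ready B N q σ) (h8 : σ 8 = 1024 * q ^ 3)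
    {α : ℂ} (hα : α ≠ 0) :
    Ens O B L (.loop (reg 8) shiftStep) σ (Finsupp.single 0 α)
      (fun σ ψ => Ready B N q σ ∧ QBounded B ψ)
      (fun σ ψ => if σ 5 = ℓ ∧ (σ 1 : ℤ) ≡ s [ZMOD ℓ] then normSq ψ else 0)
      (if σ 5 = ℓ then 49 / 50 * normSq (Finsupp.single (0 : Store) α) else 0) := by
  set m := σ 5 with hm
  set G : ℕ → Prop := fun t => m = ℓ ∧ (t : ℤ) ≡ s [ZMOD ℓ] with hG
  have hq1 : (1 : ℝ) ≤ q := by exact_mod_cast hq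
  have hp := inv_le_density h0 hN hq H
  have hNq : 2 * N ≤ 2 ^ q := by
    have e1 : N ≤ N ^ 6 := Nat.le_self_pow (by norm_num) N
    have e2 : 1 ≤ q ^ 2 := Nat.one_le_pow _ _ hq
    nlinarith
  have hq3 : (1 : ℝ) ≤ q ^ 3 := one_le_pow₀ hq1
  have ha : 1 / (128 * q ^ 3 : ℝ) ≤ 1 := by rw [div_le_one (by positivity)]; linarith
  -- a right guess is never lost, whence `b = 0`; `1 / (128 q ^ 3)` is the product of the
  -- probabilities `1 / (16 q)` of exposing a wrong guess and `1 / (8 q ^ 2)` of a right candidate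
  refine (Ens.repeat (a := if m = ℓ then 1 / (128 * q ^ 3) else 0) (b := 0)
    (Good := fun σ => G (σ 1))
    (Inv := fun σ ψ => Ready B N q σ ∧ σ 5 = m ∧ ∃ α : ℂ, α ≠ 0 ∧ ψ = Finsupp.single 0 α)
    (by split_ifs; exacts [ha, zero_le_one]) le_rfl (by split_ifs <;> positivity) hL' h8
    ⟨hσ, hm.symm, α, hα, rfl⟩ ?_ ?_).mono ?_ ?_
  · rintro σ _ ⟨h, -, α, -, rfl⟩
    exact ⟨by omega, h.size_le, QBounded.single (by simp) _⟩
  · rintro σ _ ⟨h, h5, α, hα, rfl⟩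
    refine (Ens.shiftStep (G := G) hB hL hNq h h5 (lt_of_lt_of_le (by positivity) hp)).mono
      (fun _ _ h => ⟨h, le_rfl⟩) (mul_le_mul_of_nonneg_right ?_ (normSq_nonneg _))
    rw [sub_zero]
    exact le_shiftStep_value hχ h0 h1 hN hq H m (σ 1) fun _ => Iff.rfl
  · rintro σ' _ ⟨h, h5, α', -, rfl⟩
    refine ⟨⟨h, QBounded.single (by simp) _⟩, le_of_eq ?_⟩
    simp only [hG, h5]
  · by_cases h : m = ℓ
    · simp only [h, if_true, mul_zero, sub_zero]
      refine mul_le_mul_of_nonneg_right ?_ (normSq_nonneg _)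
      have e1 := one_sub_pow_le (a := 1 / (128 * q ^ 3 : ℝ)) (k := 1024 * q ^ 3) ha
        (by push_cast; field_simp; norm_num)
      linarith
    · simp [h]

open scoped Classical in
/-- The two stages succeed with probability at least `47 / 50 * (49 / 50) ≥ 2 / 3`. One bound `B`,
cubic in the size of the input, serves for the sizes of all registers and for the numbers of
iterations of all loops; the cube is due to the second stage. -/
theorem ens_program (hχ : χ.IsPrimitive)
    (h0 : ∀ x : ℤ, O 0 x = χ ((x + s : ℤ) : ZMod ℓ)) (h1 : ∀ x : ℤ, O 1 x = χ (x : ZMod ℓ))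
    (hN : ℓ ≤ N) (hB : B = 1024 * (60 + 12 * Nat.size N) ^ 3) :
    Ens O B B program (Function.update 0 0 N) (Finsupp.single 0 1) (fun _ _ => True)
      (fun σ ψ => if σ 0 = ℓ ∧ (σ 1 : ℤ) ≡ s [ZMOD ℓ] then normSq ψ else 0) (2 / 3) := by
  have hN0 : 0 < N := (NeZero.pos ℓ).trans_le hN
  have hK : 1024 * (60 + 12 * Nat.size N) ≤ B := by
    rw [hB]; exact Nat.mul_le_mul_left _ (Nat.le_self_pow (by norm_num) _)
  refine Det.seq_ens (Det.chooseQubits hN0 hK hK) ?_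
  rintro σ₁ _ ⟨rfl, q, hq, hNq, hσ₁, h8⟩
  obtain ⟨hq1, H⟩ := le_two_pow hN0 hNq
  have hq3 : 1024 * q ^ 3 ≤ B := by
    rw [hB]; exact Nat.mul_le_mul_left _ (Nat.pow_le_pow_left (by omega) 3)
  have hB1 : 2 * q + 1 ≤ B := by omega
  refine Ens.seq (W' := fun σ ψ => if σ 5 = ℓ then 49 / 50 * normSq ψ else 0)
    (((ens_repeat_periodStep hχ h0 hN (by omega) H hB1 (by omega) hσ₁ h8).affine 0
      (β := 49 / 50) (by norm_num)).mono (fun σ ψ h => ⟨h, le_of_eq ?_⟩) (by norm_num)) ?_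
  · split_ifs <;> ring
  rintro σ₂ _ ⟨hσ₂, α, hα, rfl⟩
  have hψ : QBounded B (Finsupp.single (0 : Store) α) := QBounded.single (by simp) _
  refine Det.seq_ens (Det.assign (Post := fun σ' ψ' => σ' = Function.update σ₂ 8 (1024 * q ^ 3) ∧
    ψ' = Finsupp.single 0 α) ⟨by omega, hσ₂.size_le, hψ⟩ ⟨?_, rfl⟩) ?_
  · congr 1
    simp only [Expr.eval_mul, Expr.eval_const, Expr.eval_var, hσ₂.reg_two]
    ring
  rintro _ _ ⟨rfl, rfl⟩
  have hf₃ : Frame B {8} σ₂ (Function.update σ₂ 8 (1024 * q ^ 3)) :=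
    (hσ₂.frame _).update (by simp) (size_le_of_le hq3)
  have hσ₃ := hσ₂.of_frame hf₃
  refine Ens.seq ((ens_repeat_shiftStep hχ h0 h1 hN (by omega) H hB1 hB1 hq3 hσ₃ (by simp)
    hα).mono (fun _ _ h => ⟨h, le_rfl⟩) (le_of_eq (by simp))) ?_
  rintro σ₄ ψ₄ ⟨hσ₄, hψ₄⟩
  refine Det.ens (Det.assign (Post := fun σ' ψ' => σ' = Function.update σ₄ 0 (σ₄ 5) ∧ ψ' = ψ₄)
    ⟨by omega, hσ₄.size_le, hψ₄⟩ ⟨rfl, rfl⟩) ?_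
  rintro _ _ ⟨rfl, rfl⟩
  exact ⟨trivial, by simp⟩

end Correctness

end Algorithm

end HiddenShift

theorem mainTheorem4 :
    ∃ (P : HiddenShift.Cmd) (p : Polynomial ℕ),
      ∀ (n : ℕ), 0 < n →
      ∀ (χ : DirichletCharacter ℂ n), HiddenShift.CompletelyNontrivial χ →
      ∀ (s : ℤ) (f : ℤ → ℂ), (∀ x : ℤ, f x = χ ((x + s : ℤ) : ZMod n)) →
      ∀ (ℓ : ℕ), HiddenShift.IsPeriodOf f ℓ →
      ∀ (N : ℕ), ℓ ≤ N →
        HiddenShift.HaltsWithin ![f, fun x : ℤ => χ (x : ZMod n)] P N (p.eval (Nat.size N)) ∧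
        2 / 3 ≤ HiddenShift.successProb ![f, fun x : ℤ => χ (x : ZMod n)] P N
          (p.eval (Nat.size N))
          (fun out => ∀ t : ℤ,
            (∀ x : ℤ, f x = χ ((x + t : ℤ) : ZMod n)) ↔ t ≡ (out 1 : ℤ) [ZMOD (out 0 : ℤ)]) := by
  classical
  set b : Polynomial ℕ := 1024 * (60 + 12 * Polynomial.X) ^ 3 with hb
  refine ⟨HiddenShift.program, HiddenShift.program.timeBound b b, ?_⟩
  intro n hn χ hχ s f hf ℓ hℓ N hN
  have hprim := hχ.eq_primitiveCharacter hn
  have hn0 : NeZero n := ⟨hn.ne'⟩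
  have hne : NeZero χ.conductor := ⟨χ.conductor_ne_zero⟩
  have hf' : ∀ x : ℤ, f x = χ.primitiveCharacter ((x + s : ℤ) : ZMod χ.conductor) := fun x => by
    rw [hf, hprim]
  obtain rfl := HiddenShift.eq_of_isPeriodOf χ.primitiveCharacter_isPrimitive hf' hℓ
  have hT : (HiddenShift.program.timeBound b b).eval (Nat.size N) =
      HiddenShift.program.timeBound (1024 * (60 + 12 * Nat.size N) ^ 3)
        (1024 * (60 + 12 * Nat.size N) ^ 3) := by
    have h := HiddenShift.Cmd.map_timeBound (Polynomial.evalRingHom (Nat.size N)) b b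
      HiddenShift.program
    have h2 : Polynomial.evalRingHom (Nat.size N) b = 1024 * (60 + 12 * Nat.size N) ^ 3 := by
      simp [hb]
    rwa [h2] at h
  rw [hT]
  refine HiddenShift.Ens.halts_and_succeeds (Post := fun _ _ => True)
    ((HiddenShift.ens_program (O := ![f, fun x : ℤ => χ (x : ZMod n)])
      χ.primitiveCharacter_isPrimitive hf' hprim hN rfl).mono (fun σ ψ _ => ⟨trivial, ?_⟩) le_rfl)
  have hn := HiddenShift.normSq_nonneg ψ
  have key : σ 0 = χ.conductor ∧ (σ 1 : ℤ) ≡ s [ZMOD χ.conductor] →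
      ∀ t : ℤ, (∀ x : ℤ, f x = χ ((x + t : ℤ) : ZMod n)) ↔ t ≡ (σ 1 : ℤ) [ZMOD (σ 0 : ℤ)] := by
    rintro ⟨h0, h1⟩ t
    rw [h0]
    simp only [hprim]
    rw [HiddenShift.shift_iff hf' hℓ]
    exact ⟨fun h => h.trans h1.symm, fun h => h.trans h1⟩
  by_cases h : σ 0 = χ.conductor ∧ (σ 1 : ℤ) ≡ s [ZMOD χ.conductor]
  · rw [if_pos h, if_pos (key h)]
  · rw [if_neg h]
    split_ifs
    exacts [hn, le_rfl]
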